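/- Let $F$ be a non-archimedean local field with ring of integers $\mathcal O_F$, maximal ideal $\mathfrak p_F$ and residue characteristic $p$. Let $G=\mathrm{GL}_2(F)$ with centre $Z$, and let $X$ be the Bruhat–Tits tree of $\mathrm{PGL}_2(F)$, with set of vertices $X^0$, set of edges $X^1$ and path distance $d$; an edge is identified with its set of end points. Fix an edge $\sigma=\{x_+,x_-\}$ and an integer $e\ge 1$. Let $\mathfrak o$ be a complete discrete valuation ring with residue field $k$ of characteristic $p$, and let $\Lambda$ be an Artinian local $\mathfrak o$-algebra with residue field $k$. *Subgroups.* For $x\in X^0$ let $K_x\subset G$ be the maximal compact subgroup fixing $x$, let $U_x^{(1)}$ be its maximal normal pro-$p$ subgroup, and let $U_x^{(e)}=\bigcap_{d(x,y)\le e-1}U_y^{(1)}$. For an edge $\eta=\{x_1,x_2\}$ let $U_\eta^{(e)}$ be the subgroup generated by $U_{x_1}^{(e)}$ and $U_{x_2}^{(e)}$. For $m\ge 0$ put $Z^{(m)}(x)=\{y : d(x,y)\le m\}$ and $Z^{(m)}(\eta)=Z^{(m)}(x_1)\cup Z^{(m)}(x_2)$. Let $\widehat G^{(e)}$ be the group of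 automorphisms $g$ of $X$ such that for every edge $\mu$ there is $g'\in G$ with $g=g'$ on $Z^{(e)}(\mu)$. For an edge $\eta$ let $\widehat U_\eta^{(e)}\subset\widehat G^{(e)}$ be the subgroup of those $g$ such that for every edge $\mu$ there is $g'\in U_\eta^{(e)}$ with $g=g'$ on $Z^{(e)}(\mu)$. The group $\widehat U^{(e)}_\sigma$ is given the profinite topology in which the pointwise stabilizers of the sets $Z^{(m)}(\sigma)$, $m\ge 0$, form a basis of neighbourhoods of $1$. *Categories.* A coefficient system $\mathcal F$ consists of $\Lambda$-modules $\mathcal F(\tau)$ for all simplices (vertices and edges) $\tau$ and $\Lambda$-linear transition maps $r^\eta_x:\mathcal F(\eta)\to\mathcal F(x)$ for $x\in\eta\in X^1$. It is $G$-equivariant if it is equipped with linear maps $g_\tau:\mathcal F(\tau)\to\mathcal F(g\tau)$ for $g\in G$, with $g_{h\tau}h_\tau=(gh)_\tau$, $1_\tau=\mathrm{id}$, and $r^{g\eta}_{gx}g_\eta=g_xr^\eta_x$. Morphisms are families of linear maps compatible with all these maps. Let $\mathfrak C_0^{(e)}(\Lambda)$ be the category of the $G$-equivariant coefficient systems such that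 $U_\tau^{(e)}$ acts trivially on $\mathcal F(\tau)$ for all simplices $\tau$; each $r^\eta_z$ is injective with image $\mathcal F(z)^{U_\eta^{(e)}}$; this image generates $\mathcal F(z)$ as a representation of $K_z$; and $Z$ acts trivially. Let $\widehat{\mathfrak R}_0^{(e)}(\Lambda)$ be the category of the representations of $\widehat G^{(e)}$ on $\Lambda$-modules that are generated by their $\widehat U_\sigma^{(e)}$-invariants and whose restriction to $\widehat U_\sigma^{(e)}$ is smooth (all stabilizers of vectors are open). *Functors.* For $\mathcal F\in\mathfrak C_0^{(e)}(\Lambda)$ let $H_0(X,\mathcal F)$ be the cokernel of $\bigoplus_{\eta\in X^1}\mathcal F(\eta)\to\bigoplus_{x\in X^0}\mathcal F(x)$, $f\in\mathcal F(\eta)\mapsto\sum_{x\in\eta}r^\eta_x(f)$, on which $g\in\widehat G^{(e)}$ acts by sending the class of $f\in\mathcal F(x)$ to the class of $g'_x(f)\in\mathcal F(gx)$ for any $g'\in G$ that agrees with $g$ on $Z^{(e)}(x)$. For a representation $V$ of $\widehat G^{(e)}$ put $\widehat{\mathcal F}_V^{(e)}(\eta)=V^{\widehat U_\eta^{(e)}}$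 and $\widehat{\mathcal F}_V^{(e)}(x)=\sum_{\eta\ni x}V^{\widehat U^{(e)}_\eta}\subset V$; the map $r^\eta_x$ is the inclusion if $x\in\mathrm{SL}_2(F)x_+$ and the negative of the inclusion otherwise; $g\in G$ acts on the modules at vertices through its action on $V$, and on the modules at edges through its action on $V$ if $g$ preserves the $\mathrm{SL}_2(F)$-orbits of vertices, and through the negative of its action on $V$ if $g$ exchanges the two orbits. On morphisms the functors are the induced maps and the restrictions. **Theorem.** (a) $H_0(X,\mathcal F)\in\widehat{\mathfrak R}_0^{(e)}(\Lambda)$ for every $\mathcal F\in\mathfrak C_0^{(e)}(\Lambda)$, and $\widehat{\mathcal F}_V^{(e)}\in\mathfrak C_0^{(e)}(\Lambda)$ for every $V\in\widehat{\mathfrak R}_0^{(e)}(\Lambda)$. (b) The functor $\mathcal F\mapsto H_0(X,\mathcal F)$ is left adjoint to the functor $V\mapsto\widehat{\mathcal F}_V^{(e)}$: there are natural isomorphisms $$\mathrm{Hom}_{\widehat{\mathfrak R}_0^{(e)}(\Lambda)}(H_0(X,\mathcal F),V)\cong\mathrm{Hom}_{\mathfrak C_0^{(e)}(\Lambda)}(\mathcal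 F,\widehat{\mathcal F}_V^{(e)}).$$ The unit $\mathcal F\to\widehat{\mathcal F}^{(e)}_{H_0(X,\mathcal F)}$ of this adjunction is given on $\mathcal F(x)$ by the natural map $\mathcal F(x)\to H_0(X,\mathcal F)$, and on $\mathcal F(\eta)$ by $\mathcal F(\eta)\xrightarrow{r^\eta_x}\mathcal F(x)\to H_0(X,\mathcal F)$ for the vertex $x\in\eta\cap\mathrm{SL}_2(F)x_+$; the counit $H_0(X,\widehat{\mathcal F}_V^{(e)})\to V$ is induced by the inclusions $\widehat{\mathcal F}_V^{(e)}(x)\subset V$. (c) These two functors are equivalences of categories between $\mathfrak C_0^{(e)}(\Lambda)$ and $\widehat{\mathfrak R}_0^{(e)}(\Lambda)$. (d) For all $\mathcal F\in\mathfrak C_0^{(e)}(\Lambda)$ and $V\in\widehat{\mathfrak R}_0^{(e)}(\Lambda)$ the natural maps $\mathcal F\to\widehat{\mathcal F}^{(e)}_{H_0(X,\mathcal F)}$ and $H_0(X,\widehat{\mathcal F}_V^{(e)})\to V$ of (b) are isomorphisms. -/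

import Mathlib

open CategoryTheory
open scoped ValuativeRel Pointwise Matrix MatrixGroups DirectSum

universe u v w

noncomputable section

namespace BruhatTits

/-! ### The tree of `PGL₂(F)` -/

section Tree

variable (F : Type u) [Field F] [ValuativeRel F]

/-- An `𝒪_F`-lattice in `F²`. -/
structure Lat where
  /-- the underlying `𝒪_F`-submodule -/
  toSub : Submodule 𝒪[F] (Fin 2 → F)
  isLattice : toSub.IsLattice F

variable {F}

theorem Lat.ext' {L M : Lat F} (h : L.toSub = M.toSub) : L = M := by
  cases L; cases M; cases h; rfl

/-- The `𝒪_F`-linear map of `F²` given by an invertible matrix. -/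
def glMap (g : GL (Fin 2) F) : (Fin 2 → F) →ₗ[𝒪[F]] (Fin 2 → F) :=
  (Matrix.mulVecLin (g : Matrix (Fin 2) (Fin 2) F)).restrictScalars 𝒪[F]

theorem glMap_apply (g : GL (Fin 2) F) (v : Fin 2 → F) :
    glMap g v = (g : Matrix (Fin 2) (Fin 2) F) *ᵥ v := rfl

theorem glMap_smul (g : GL (Fin 2) F) (c : F) (v : Fin 2 → F) :
    glMap g (c • v) = c • glMap g v := by
  simp [glMap_apply, Matrix.mulVec_smul]

theorem glMap_usmul (g : GL (Fin 2) F) (c : Fˣ) (v : Fin 2 → F) :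
    glMap g (c • v) = c • glMap g v := glMap_smul g (c : F) v

theorem glMap_mul (g h : GL (Fin 2) F) (v : Fin 2 → F) :
    glMap (g * h) v = glMap g (glMap h v) := by
  simp only [glMap_apply, Units.val_mul, Matrix.mulVec_mulVec]

theorem glMap_one (v : Fin 2 → F) : glMap (1 : GL (Fin 2) F) v = v := by
  simp [glMap_apply]

theorem glMap_inv_apply (g : GL (Fin 2) F) (v : Fin 2 → F) : glMap g⁻¹ (glMap g v) = v := by
  rw [← glMap_mul, inv_mul_cancel, glMap_one]

theorem glMap_apply_inv (g : GL (Fin 2) F) (v : Fin 2 → F) : glMap g (glMap g⁻¹ v) = v := by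
  rw [← glMap_mul, mul_inv_cancel, glMap_one]

/-- The lattice `g L`. -/
def Lat.act (g : GL (Fin 2) F) (L : Lat F) : Lat F where
  toSub := L.toSub.map (glMap g)
  isLattice :=
    { fg := L.isLattice.fg.map _
      span_eq_top := by
        have h : ((L.toSub.map (glMap g) : Submodule 𝒪[F] (Fin 2 → F)) : Set (Fin 2 → F)) =
            Matrix.mulVecLin (g : Matrix (Fin 2) (Fin 2) F) '' (L.toSub : Set (Fin 2 → F)) := rfl
        rw [h, Submodule.span_image, L.isLattice.span_eq_top, Submodule.map_top,
          LinearMap.range_eq_top]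
        intro v
        exact ⟨glMap g⁻¹ v, glMap_apply_inv g v⟩ }

theorem Lat.mem_act {g : GL (Fin 2) F} {L : Lat F} {v : Fin 2 → F} :
    v ∈ (L.act g).toSub ↔ glMap g⁻¹ v ∈ L.toSub := by
  constructor
  · rintro ⟨w, hw, rfl⟩
    rw [glMap_inv_apply]; exact hw
  · intro h
    exact ⟨_, h, glMap_apply_inv g v⟩

theorem Lat.act_mul (g h : GL (Fin 2) F) (L : Lat F) : L.act (g * h) = (L.act h).act g := by
  apply Lat.ext'
  ext v
  rw [Lat.mem_act, Lat.mem_act, Lat.mem_act, mul_inv_rev, glMap_mul]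

theorem Lat.act_one (L : Lat F) : L.act 1 = L := by
  apply Lat.ext'
  ext v
  rw [Lat.mem_act, inv_one, glMap_one]

theorem mem_usmul {c : Fˣ} {L : Submodule 𝒪[F] (Fin 2 → F)} {v : Fin 2 → F} :
    v ∈ c • L ↔ c⁻¹ • v ∈ L := by
  change v ∈ c • (L : Set (Fin 2 → F)) ↔ _
  exact Set.mem_smul_set_iff_inv_smul_mem

theorem map_usmul (g : GL (Fin 2) F) (c : Fˣ) (L : Submodule 𝒪[F] (Fin 2 → F)) :
    (c • L).map (glMap g) = c • L.map (glMap g) := by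
  ext v
  constructor
  · rintro ⟨w, hw, rfl⟩
    rw [mem_usmul, ← glMap_usmul]
    exact ⟨_, mem_usmul.1 hw, rfl⟩
  · intro h
    obtain ⟨w, hw, hw'⟩ := mem_usmul.1 h
    refine ⟨c • w, mem_usmul.2 (by rwa [inv_smul_smul]), ?_⟩
    rw [glMap_usmul, hw', smul_inv_smul]

variable (F) in
/-- Homothety of lattices. -/
def homothety : Setoid (Lat F) where
  r L M := ∃ c : Fˣ, M.toSub = c • L.toSub
  iseqv :=
    { refl := fun L => ⟨1, (one_smul _ _).symm⟩
      symm := by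
        rintro L M ⟨c, h⟩
        exact ⟨c⁻¹, by rw [h, inv_smul_smul]⟩
      trans := by
        rintro L M N ⟨c, h⟩ ⟨d, h'⟩
        exact ⟨d * c, by rw [h', h, smul_smul]⟩ }

variable (F) in
/-- The vertices of the Bruhat–Tits tree of `PGL₂(F)`: homothety classes of lattices in `F²`. -/
def Vertex : Type u := Quotient (homothety F)

/-- The homothety class of a lattice. -/
def Lat.cls (L : Lat F) : Vertex F := Quotient.mk (homothety F) L

theorem Lat.cls_eq {L M : Lat F} : L.cls = M.cls ↔ ∃ c : Fˣ, M.toSub = c • L.toSub :=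
  Quotient.eq (r := homothety F)

theorem Lat.exists_cls (x : Vertex F) : ∃ L : Lat F, L.cls = x := Quotient.exists_rep x

theorem Lat.cls_act {L M : Lat F} (g : GL (Fin 2) F) (h : L.cls = M.cls) :
    (L.act g).cls = (M.act g).cls := by
  obtain ⟨c, hc⟩ := Lat.cls_eq.1 h
  refine Lat.cls_eq.2 ⟨c, ?_⟩
  simp only [Lat.act, hc]
  exact map_usmul g c _

/-- The action of `GL₂(F)` on the vertices. -/
def vertexAct (g : GL (Fin 2) F) : Vertex F → Vertex F :=
  Quotient.lift (fun L : Lat F => (L.act g).cls)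
    (fun _ _ h => Lat.cls_act g (Quotient.sound (s := homothety F) h))

theorem vertexAct_cls (g : GL (Fin 2) F) (L : Lat F) : vertexAct g L.cls = (L.act g).cls := rfl

theorem vertexAct_mul (g h : GL (Fin 2) F) (x : Vertex F) :
    vertexAct (g * h) x = vertexAct g (vertexAct h x) := by
  obtain ⟨L, rfl⟩ := Lat.exists_cls x
  rw [vertexAct_cls, vertexAct_cls, vertexAct_cls, Lat.act_mul]

theorem vertexAct_one (x : Vertex F) : vertexAct (1 : GL (Fin 2) F) x = x := by
  obtain ⟨L, rfl⟩ := Lat.exists_cls x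
  rw [vertexAct_cls, Lat.act_one]

/-- `y` is represented by a lattice `M` strictly between `𝔭_F L` and `L`, with `L` a lattice
representing `x`. -/
def Neighbour (x y : Vertex F) : Prop :=
  ∃ L M : Lat F, L.cls = x ∧ M.cls = y ∧ 𝓂[F] • L.toSub < M.toSub ∧ M.toSub < L.toSub

variable (F) in
/-- The Bruhat–Tits tree of `PGL₂(F)`, as a graph: two distinct vertices are adjacent if they are
represented by lattices `L`, `M` with `𝔭_F L ⊂ M ⊂ L`. -/
def tree : SimpleGraph (Vertex F) := SimpleGraph.fromRel Neighbour

variable (F) in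
/-- The automorphism group of the tree (bijections on vertices that preserve adjacency in both
directions, equivalently that preserve the distance). -/
abbrev AutTree : Type u := tree F ≃g tree F

variable (F) in
/-- The edges of the tree; an edge is identified with its unordered pair of end points. -/
abbrev Edge : Type u := (tree F).edgeSet

theorem map_ideal_smul (g : GL (Fin 2) F) (L : Lat F) :
    𝓂[F] • (L.act g).toSub = (𝓂[F] • L.toSub).map (glMap g) := by
  simp only [Lat.act, Submodule.map_smul'']

theorem glMap_injective (g : GL (Fin 2) F) : Function.Injective (glMap g) :=
  Function.LeftInverse.injective (glMap_inv_apply g)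

theorem Neighbour.act {x y : Vertex F} (g : GL (Fin 2) F) (h : Neighbour x y) :
    Neighbour (vertexAct g x) (vertexAct g y) := by
  obtain ⟨L, M, rfl, rfl, h1, h2⟩ := h
  refine ⟨L.act g, M.act g, rfl, rfl, ?_, ?_⟩
  · rw [map_ideal_smul]
    exact Submodule.map_strictMono_of_injective (glMap_injective g) h1
  · exact Submodule.map_strictMono_of_injective (glMap_injective g) h2

theorem tree_adj_act {x y : Vertex F} (g : GL (Fin 2) F) (h : (tree F).Adj x y) :
    (tree F).Adj (vertexAct g x) (vertexAct g y) := by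
  simp only [tree, SimpleGraph.fromRel_adj] at h ⊢
  refine ⟨fun e => h.1 ?_, h.2.imp (Neighbour.act g) (Neighbour.act g)⟩
  rw [← vertexAct_one x, ← vertexAct_one y, ← inv_mul_cancel g, vertexAct_mul, vertexAct_mul, e]

/-- The homomorphism `GL₂(F) → Aut(X)`. -/
def toAut : GL (Fin 2) F →* AutTree F where
  toFun g :=
    { toFun := vertexAct g
      invFun := vertexAct g⁻¹
      left_inv := fun x => by rw [← vertexAct_mul, inv_mul_cancel, vertexAct_one]
      right_inv := fun x => by rw [← vertexAct_mul, mul_inv_cancel, vertexAct_one]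
      map_rel_iff' := by
        intro x y
        refine ⟨fun h => ?_, tree_adj_act g⟩
        have := tree_adj_act g⁻¹ h
        simpa only [Equiv.coe_fn_mk, ← vertexAct_mul, inv_mul_cancel, vertexAct_one] using this }
  map_one' := by
    ext x
    exact vertexAct_one x
  map_mul' g h := by
    ext x
    exact vertexAct_mul g h x

theorem toAut_cls (g : GL (Fin 2) F) (L : Lat F) : toAut g L.cls = (L.act g).cls := rfl

/-- The ball `Z^{(e)}(x)` of radius `e` around the vertex `x`, for the path distance. (The tree is
connected, so that the extended distance is the usual one.) -/
def ball (e : ℕ) (x : Vertex F) : Set (Vertex F) := {y | (tree F).edist x y ≤ e}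

/-- `Z^{(e)}(η) = Z^{(e)}(x₁) ∪ Z^{(e)}(x₂)` for an edge `η = {x₁, x₂}`. -/
def edgeBall (e : ℕ) (η : Edge F) : Set (Vertex F) := {y | ∃ x ∈ η.1, y ∈ ball e x}

theorem edist_aut_le (g : AutTree F) (x y : Vertex F) :
    (tree F).edist (g x) (g y) ≤ (tree F).edist x y := by
  by_cases h : (tree F).edist x y = ⊤
  · rw [h]; exact le_top
  · obtain ⟨p, hp⟩ := SimpleGraph.exists_walk_of_edist_ne_top h
    rw [← hp]
    have := SimpleGraph.edist_le (p.map g.toHom)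
    rwa [SimpleGraph.Walk.length_map] at this

theorem ball_aut {e : ℕ} {x y : Vertex F} (g : AutTree F) (h : y ∈ ball e x) :
    g y ∈ ball e (g x) :=
  (edist_aut_le g x y).trans h

theorem edgeBall_aut {e : ℕ} {η : Edge F} {y : Vertex F} (g : AutTree F) (h : y ∈ edgeBall e η) :
    g y ∈ edgeBall e (g.mapEdgeSet η) := by
  obtain ⟨x, hx, hy⟩ := h
  exact ⟨g x, Sym2.mem_map.2 ⟨x, hx, rfl⟩, ball_aut g hy⟩

theorem self_mem_ball (e : ℕ) (x : Vertex F) : x ∈ ball e x := by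
  simp [ball]

theorem mapEdgeSet_mul (g h : AutTree F) (η : Edge F) :
    (g * h).mapEdgeSet η = g.mapEdgeSet (h.mapEdgeSet η) := by
  apply Subtype.ext
  change Sym2.map _ _ = Sym2.map _ (Sym2.map _ _)
  rw [Sym2.map_map]
  rfl

theorem mapEdgeSet_one (η : Edge F) : (1 : AutTree F).mapEdgeSet η = η := by
  apply Subtype.ext
  change Sym2.map id _ = _
  rw [Sym2.map_id]
  rfl

end Tree

/-! ### Subgroups of `GL₂(F)` and of the automorphism group of the tree -/

section Groups

variable {F : Type u} [Field F] [ValuativeRel F]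

/-- `K_x`: the maximal compact subgroup of `GL₂(F)` fixing the vertex `x`, i.e. the stabilizer of
the lattices which represent `x`. -/
def vertexK (x : Vertex F) : Subgroup (GL (Fin 2) F) where
  carrier := {g | ∀ L : Lat F, L.cls = x → L.act g = L}
  one_mem' L _ := L.act_one
  mul_mem' {g h} hg hh L hL := by rw [Lat.act_mul, hh L hL, hg L hL]
  inv_mem' {g} hg L hL := by
    conv_lhs => rw [← hg L hL]
    rw [← Lat.act_mul, inv_mul_cancel, Lat.act_one]

/-- `U_x^{(1)}`: the maximal normal pro-`p` subgroup of `K_x = GL(L)`, i.e. the kernel of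
`GL(L) → GL(L / 𝔭_F L)`. -/
def vertexU1 (x : Vertex F) : Subgroup (GL (Fin 2) F) where
  carrier := {g | g ∈ vertexK x ∧
    ∀ L : Lat F, L.cls = x → ∀ v ∈ L.toSub, glMap g v - v ∈ 𝓂[F] • L.toSub}
  one_mem' := ⟨one_mem _, fun L _ v _ => by rw [glMap_one, sub_self]; exact zero_mem _⟩
  mul_mem' {g h} hg hh := by
    refine ⟨mul_mem hg.1 hh.1, fun L hL v hv => ?_⟩
    have hv' : glMap h v ∈ L.toSub := by
      have : glMap h v ∈ (L.act h).toSub := ⟨v, hv, rfl⟩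
      rwa [hh.1 L hL] at this
    rw [glMap_mul, ← sub_add_sub_cancel _ (glMap h v)]
    exact add_mem (hg.2 L hL _ hv') (hh.2 L hL v hv)
  inv_mem' {g} hg := by
    refine ⟨inv_mem hg.1, fun L hL v hv => ?_⟩
    have hv' : glMap g⁻¹ v ∈ L.toSub := by
      rw [← Lat.mem_act, hg.1 L hL]; exact hv
    have := neg_mem (hg.2 L hL _ hv')
    rwa [glMap_apply_inv, neg_sub] at this

/-- `U_x^{(e)} = ⋂ U_y^{(1)}`, over the vertices `y` with `d(x, y) ≤ e - 1`. -/
def vertexU (e : ℕ) (x : Vertex F) : Subgroup (GL (Fin 2) F) :=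
  ⨅ y ∈ ball (e - 1) x, vertexU1 y

/-- `U_η^{(e)}`: the subgroup generated by `U_{x₁}^{(e)}` and `U_{x₂}^{(e)}`, for an edge
`η = {x₁, x₂}`. -/
def edgeU (e : ℕ) (η : Edge F) : Subgroup (GL (Fin 2) F) :=
  ⨆ x ∈ η.1, vertexU e x

variable (F) in
/-- `Ĝ^{(e)}`: the group of locally algebraic automorphisms of level `e` of the tree. -/
def hatG (e : ℕ) : Subgroup (AutTree F) where
  carrier := {g | ∀ μ : Edge F, ∃ g' : GL (Fin 2) F, ∀ y ∈ edgeBall e μ, g y = toAut g' y}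
  one_mem' μ := ⟨1, fun y _ => by rw [map_one]⟩
  mul_mem' {g h} hg hh μ := by
    obtain ⟨h', hh'⟩ := hh μ
    obtain ⟨g', hg'⟩ := hg (h.mapEdgeSet μ)
    refine ⟨g' * h', fun y hy => ?_⟩
    rw [map_mul, RelIso.mul_apply, RelIso.mul_apply, ← hh' y hy]
    exact hg' _ (edgeBall_aut h hy)
  inv_mem' {g} hg μ := by
    obtain ⟨g', hg'⟩ := hg (g⁻¹.mapEdgeSet μ)
    refine ⟨g'⁻¹, fun y hy => ?_⟩
    have := hg' _ (edgeBall_aut g⁻¹ hy)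
    rw [RelIso.apply_inv_self] at this
    conv_rhs => rw [this]
    rw [map_inv, RelIso.inv_apply_self]

/-- `Û_η^{(e)}`: the automorphisms of the tree which, on each `Z^{(e)}(μ)`, agree with an element of
`U_η^{(e)}`. -/
def hatU (e : ℕ) (η : Edge F) : Subgroup (AutTree F) where
  carrier := {g | ∀ μ : Edge F, ∃ g' ∈ edgeU e η, ∀ y ∈ edgeBall e μ, g y = toAut g' y}
  one_mem' μ := ⟨1, one_mem _, fun y _ => by rw [map_one]⟩
  mul_mem' {g h} hg hh μ := by
    obtain ⟨h', hhU, hh'⟩ := hh μ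
    obtain ⟨g', hgU, hg'⟩ := hg (h.mapEdgeSet μ)
    refine ⟨g' * h', mul_mem hgU hhU, fun y hy => ?_⟩
    rw [map_mul, RelIso.mul_apply, RelIso.mul_apply, ← hh' y hy]
    exact hg' _ (edgeBall_aut h hy)
  inv_mem' {g} hg μ := by
    obtain ⟨g', hgU, hg'⟩ := hg (g⁻¹.mapEdgeSet μ)
    refine ⟨g'⁻¹, inv_mem hgU, fun y hy => ?_⟩
    have := hg' _ (edgeBall_aut g⁻¹ hy)
    rw [RelIso.apply_inv_self] at this
    conv_rhs => rw [this]
    rw [map_inv, RelIso.inv_apply_self]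

variable (F) in
/-- The homomorphism `GL₂(F) → Ĝ^{(e)}`. -/
def toHatG (e : ℕ) : GL (Fin 2) F →* hatG F e :=
  toAut.codRestrict (hatG F e) (fun g _ => ⟨g, fun _ _ => rfl⟩)

theorem coe_toHatG (e : ℕ) (g : GL (Fin 2) F) : (toHatG F e g : AutTree F) = toAut g := rfl

end Groups

/-! ### Pointwise stabilizers of balls -/

section Stabilizer

variable {F : Type u} [Field F] [ValuativeRel F]

theorem coe_mem_smul {L : Submodule 𝒪[F] (Fin 2 → F)} {c : F} (hc : c ∈ 𝒪[F]) {v : Fin 2 → F}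
    (hv : v ∈ L) : c • v ∈ L :=
  L.smul_mem (⟨c, hc⟩ : 𝒪[F]) hv

theorem smul_mem_usmul {L : Submodule 𝒪[F] (Fin 2 → F)} {c : Fˣ} {v : Fin 2 → F}
    (hv : v ∈ L) : c • v ∈ c • L := by
  rw [mem_usmul, inv_smul_smul]; exact hv

theorem mem_of_mem_usmul {L : Submodule 𝒪[F] (Fin 2 → F)} {c : Fˣ} (hc : (c : F) ∈ 𝒪[F])
    {v : Fin 2 → F} (hv : v ∈ c • L) : v ∈ L := by
  rw [mem_usmul] at hv
  have := coe_mem_smul hc hv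
  rwa [← Units.smul_def, smul_inv_smul] at this

/-- The scalar matrix `c`. -/
abbrev sc (c : Fˣ) : GL (Fin 2) F := Matrix.GeneralLinearGroup.scalar (Fin 2) c

theorem glMap_sc (c : Fˣ) (v : Fin 2 → F) : glMap (sc c) v = c • v := by
  rw [glMap_apply]
  simp [sc, Matrix.GeneralLinearGroup.scalar, Units.smul_def]

theorem toAut_sc (c : Fˣ) (x : Vertex F) : toAut (sc c) x = x := by
  obtain ⟨L, rfl⟩ := Lat.exists_cls x
  rw [toAut_cls]
  refine (Lat.cls_eq.2 ⟨c, ?_⟩).symm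
  ext v
  rw [Lat.mem_act, ← map_inv, mem_usmul]
  exact iff_of_eq (congrArg (· ∈ L.toSub) (glMap_sc c⁻¹ v))

variable [TopologicalSpace F] [IsNonarchimedeanLocalField F]

variable (F) in
/-- A uniformizer. -/
theorem exists_uniformizer : ∃ ϖ : Fˣ, (ϖ : F) ∈ 𝒪[F] ∧
    (∀ L : Submodule 𝒪[F] (Fin 2 → F), 𝓂[F] • L = ϖ • L) ∧
    ∀ c : Fˣ, (c : F) ∉ 𝒪[F] → (((ϖ * c)⁻¹ : Fˣ) : F) ∈ 𝒪[F] := by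
  obtain ⟨p, hp⟩ := IsDiscreteValuationRing.exists_irreducible 𝒪[F]
  have hp0 : (p : F) ≠ 0 := fun h => hp.ne_zero (Subtype.ext h)
  refine ⟨Units.mk0 (p : F) hp0, p.2, fun L => ?_, fun c hc => ?_⟩
  · rw [hp.maximalIdeal_eq, Submodule.ideal_span_singleton_smul]
    rfl
  · have h1 : ((c : F)⁻¹) ∈ 𝒪[F] := by
      rw [Valuation.mem_integer_iff] at hc ⊢
      rw [map_inv₀]
      exact inv_le_one_of_one_le₀ (not_le.1 hc).le
    have h2 : (⟨(c : F)⁻¹, h1⟩ : 𝒪[F]) ∈ 𝓂[F] := by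
      rw [IsLocalRing.mem_maximalIdeal, mem_nonunits_iff]
      intro hu
      obtain ⟨d, hd⟩ := hu.exists_right_inv
      have hd' : (c : F)⁻¹ * (d : F) = 1 := congrArg Subtype.val hd
      apply hc
      have : (d : F) = c := by
        field_simp at hd'
        exact hd'
      rw [← this]; exact d.2
    rw [hp.maximalIdeal_eq, Ideal.mem_span_singleton] at h2
    obtain ⟨a, ha⟩ := h2
    have ha' : (c : F)⁻¹ = (p : F) * a := congrArg Subtype.val ha
    have : (((Units.mk0 (p : F) hp0 * c)⁻¹ : Fˣ) : F) = a := by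
      rw [Units.val_inv_eq_inv_val, Units.val_mul, mul_inv, ha', Units.val_mk0]
      field_simp
    rw [this]; exact a.2

theorem exists_neighbour (L : Lat F) (v : Fin 2 → F) (hv : v ∈ L.toSub)
    (hv' : v ∉ 𝓂[F] • L.toSub) : ∃ M : Lat F,
      M.toSub = Submodule.span 𝒪[F] {v} ⊔ 𝓂[F] • L.toSub ∧
      𝓂[F] • L.toSub < M.toSub ∧ M.toSub < L.toSub := by
  obtain ⟨ϖ, -, hϖ, -⟩ := exists_uniformizer F
  have hle : Submodule.span 𝒪[F] {v} ⊔ 𝓂[F] • L.toSub ≤ L.toSub :=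
    sup_le ((Submodule.span_singleton_le_iff_mem _ _).2 hv) Submodule.smul_le_right
  have hlat : (𝓂[F] • L.toSub).IsLattice F := by
    have := L.isLattice
    rw [hϖ]
    exact Submodule.IsLattice.smul F L.toSub ϖ
  refine ⟨⟨Submodule.span 𝒪[F] {v} ⊔ 𝓂[F] • L.toSub, ?_⟩, rfl, ?_, ?_⟩
  · exact Submodule.IsLattice.of_le_of_isLattice_of_fg F
      (le_sup_right : 𝓂[F] • L.toSub ≤ _)
      ((Submodule.fg_span_singleton v).sup hlat.fg)
  · refine lt_of_le_of_ne le_sup_right fun h => hv' ?_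
    rw [h]
    exact (le_sup_left : _ ≤ Submodule.span 𝒪[F] {v} ⊔ 𝓂[F] • L.toSub)
      (Submodule.mem_span_singleton_self v)
  · refine lt_of_le_of_ne hle fun h => ?_
    have h1 : L.toSub ≤ Submodule.span 𝒪[F] {v} :=
      Submodule.le_of_le_smul_of_le_jacobson_bot L.isLattice.fg
        (IsLocalRing.maximalIdeal_le_jacobson ⊥) h.ge
    have h2 : Submodule.span F {v} = (⊤ : Submodule F (Fin 2 → F)) := by
      rw [eq_top_iff, ← L.isLattice.span_eq_top, Submodule.span_le]
      intro w hw
      obtain ⟨a, rfl⟩ := Submodule.mem_span_singleton.1 (h1 hw)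
      exact Submodule.smul_mem _ (a : F) (Submodule.mem_span_singleton_self v)
    have h3 := finrank_span_le_card (R := F) ({v} : Set (Fin 2 → F))
    rw [h2, finrank_top] at h3
    simp at h3

/-- A homothetic lattice in the same range is the same lattice. -/
theorem eq_of_between {L M : Submodule 𝒪[F] (Fin 2 → F)} {c : Fˣ}
    (h1 : 𝓂[F] • L < M) (h2 : M < L) (h3 : 𝓂[F] • L ≤ c • M) (h4 : c • M ≤ L) : c • M = M := by
  obtain ⟨ϖ, hϖ0, hϖ, hϖ1⟩ := exists_uniformizer F
  rw [hϖ] at h1 h3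
  have hc : (c : F) ∈ 𝒪[F] := by
    by_contra hc
    have ha := hϖ1 c hc
    refine h1.not_ge fun v hv => ?_
    rw [mem_usmul]
    have h5 : (ϖ * c)⁻¹ • c • v ∈ L := coe_mem_smul ha (h4 (smul_mem_usmul hv))
    rwa [smul_smul, mul_inv_rev, mul_comm (c⁻¹) _, mul_assoc, inv_mul_cancel, mul_one] at h5
  have hc' : ((c⁻¹ : Fˣ) : F) ∈ 𝒪[F] := by
    by_contra hc'
    have ha := hϖ1 c⁻¹ hc'
    refine h2.not_ge fun v hv => ?_
    have h5 := mem_usmul.1 (h3 (smul_mem_usmul hv))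
    have h6 := coe_mem_smul ha h5
    rw [← Units.smul_def, smul_smul, smul_smul, mul_assoc, mul_comm c⁻¹ ϖ, inv_mul_cancel,
      one_smul] at h6
    exact h6
  apply le_antisymm
  · intro v hv
    exact mem_of_mem_usmul hc hv
  · intro v hv
    rw [mem_usmul]
    exact coe_mem_smul hc' hv

theorem exists_not_mem_maximalIdeal_smul (L : Lat F) :
    ∃ v ∈ L.toSub, v ∉ 𝓂[F] • L.toSub := by
  by_contra! h
  have h1 : L.toSub ≤ ⊥ := Submodule.le_of_le_smul_of_le_jacobson_bot L.isLattice.fg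
    (IsLocalRing.maximalIdeal_le_jacobson ⊥) (fun v hv => by rw [bot_sup_eq]; exact h v hv)
  have h2 := L.isLattice.span_eq_top
  rw [le_bot_iff.1 h1] at h2
  simp at h2

theorem tree_adj_of_between {L M : Lat F} (h1 : 𝓂[F] • L.toSub < M.toSub)
    (h2 : M.toSub < L.toSub) : (tree F).Adj L.cls M.cls := by
  rw [tree, SimpleGraph.fromRel_adj]
  refine ⟨fun h => ?_, Or.inl ⟨L, M, rfl, rfl, h1, h2⟩⟩
  obtain ⟨c, hc⟩ := Lat.cls_eq.1 h.symm
  have h3 := eq_of_between h1 h2 (c := c) (hc ▸ h1.le.trans h2.le) hc.ge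
  exact h2.ne (h3.symm.trans hc.symm)

theorem Neighbour.symm {x y : Vertex F} (h : Neighbour x y) : Neighbour y x := by
  obtain ⟨ϖ, hϖ0, hϖ, hϖ1⟩ := exists_uniformizer F
  obtain ⟨L, M, rfl, rfl, h1, h2⟩ := h
  have hlat : (ϖ • L.toSub).IsLattice F := by
    have := L.isLattice
    exact Submodule.IsLattice.smul F L.toSub ϖ
  have h3 : (⟨ϖ • L.toSub, hlat⟩ : Lat F).cls = L.cls := (Lat.cls_eq.2 ⟨ϖ, rfl⟩).symm
  refine ⟨M, ⟨ϖ • L.toSub, hlat⟩, rfl, h3, ?_, ?_⟩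
  · rw [hϖ]
    refine lt_of_le_of_ne (fun v hv => ?_) fun h => ?_
    · rw [mem_usmul] at hv ⊢
      exact h2.le hv
    · refine h2.ne ?_
      have := congrArg (fun N => ϖ⁻¹ • N) h
      simpa only [inv_smul_smul] using this
  · have h4 := h1
    rw [hϖ] at h4
    exact h4

theorem exists_lattices {L : Lat F} {y : Vertex F} (h : (tree F).Adj L.cls y) :
    ∃ M : Lat F, M.cls = y ∧ 𝓂[F] • L.toSub < M.toSub ∧ M.toSub < L.toSub := by
  obtain ⟨ϖ, hϖ0, hϖ, hϖ1⟩ := exists_uniformizer F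
  rw [tree, SimpleGraph.fromRel_adj] at h
  obtain ⟨L', M', hL, rfl, h1, h2⟩ := h.2.elim id Neighbour.symm
  obtain ⟨c, hc⟩ := Lat.cls_eq.1 hL
  have hlat : (c • M'.toSub).IsLattice F := by
    have := M'.isLattice
    exact Submodule.IsLattice.smul F M'.toSub c
  have key : ∀ {N N' : Submodule 𝒪[F] (Fin 2 → F)}, N < N' → c • N < c • N' := by
    intro N N' hN
    refine lt_of_le_of_ne (fun v hv => ?_) fun h => ?_
    · rw [mem_usmul] at hv ⊢
      exact hN.le hv
    · refine hN.ne ?_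
      have := congrArg (fun N => c⁻¹ • N) h
      simpa only [inv_smul_smul] using this
  refine ⟨⟨c • M'.toSub, hlat⟩, (Lat.cls_eq.2 ⟨c, rfl⟩).symm, ?_, ?_⟩
  · have := key h1
    rw [hϖ, smul_smul, mul_comm, ← smul_smul, ← hc] at this
    rw [hϖ]; exact this
  · rw [hc]; exact key h2

/-- Every vertex lies on an edge. -/
theorem exists_edge (x : Vertex F) : ∃ η : Edge F, x ∈ η.1 := by
  obtain ⟨L, rfl⟩ := Lat.exists_cls x
  obtain ⟨v, hv, hv'⟩ := exists_not_mem_maximalIdeal_smul L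
  obtain ⟨M, -, h1, h2⟩ := exists_neighbour L v hv hv'
  exact ⟨⟨s(L.cls, M.cls), tree_adj_of_between h1 h2⟩, Sym2.mem_mk_left _ _⟩

/-- An element of `GL₂(F)` that fixes a vertex and all its neighbours is congruent to a scalar. -/
theorem exists_scalar (g : GL (Fin 2) F) (L : Lat F) (h0 : (L.act g).cls = L.cls)
    (h1 : ∀ M : Lat F, 𝓂[F] • L.toSub < M.toSub → M.toSub < L.toSub → (M.act g).cls = M.cls) :
    ∃ c : Fˣ, ∀ v ∈ L.toSub, c⁻¹ • glMap g v - v ∈ 𝓂[F] • L.toSub := by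
  obtain ⟨a, ha⟩ := Lat.cls_eq.1 h0.symm
  -- the map `h = a⁻¹ g` preserves `L`
  have hh : ∀ N : Lat F, ∀ v ∈ N.toSub, a⁻¹ • glMap g v ∈ a⁻¹ • (N.act g).toSub := by
    intro N v hv
    exact smul_mem_usmul ⟨v, hv, rfl⟩
  have hL : ∀ v ∈ L.toSub, a⁻¹ • glMap g v ∈ L.toSub := by
    intro v hv
    have := hh L v hv
    rwa [ha, inv_smul_smul] at this
  obtain ⟨ϖ, hϖ0, hϖ, hϖ1⟩ := exists_uniformizer F
  have hmL : ∀ v ∈ 𝓂[F] • L.toSub, a⁻¹ • glMap g v ∈ 𝓂[F] • L.toSub := by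
    intro v hv
    rw [hϖ, mem_usmul] at hv ⊢
    have := hL _ hv
    rwa [glMap_usmul, smul_comm] at this
  -- every vector is an eigenvector modulo `𝔭 L`
  have heig : ∀ v ∈ L.toSub, v ∉ 𝓂[F] • L.toSub → ∃ r : 𝒪[F],
      a⁻¹ • glMap g v - r • v ∈ 𝓂[F] • L.toSub := by
    intro v hv hv'
    obtain ⟨M, hM, hM1, hM2⟩ := exists_neighbour L v hv hv'
    obtain ⟨b, hb⟩ := Lat.cls_eq.1 (h1 M hM1 hM2).symm
    have hM3 : a⁻¹ • (M.act g).toSub = M.toSub := by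
      rw [hb, smul_smul]
      have hcM : (a⁻¹ * b) • M.toSub = a⁻¹ • (M.act g).toSub := by rw [hb, smul_smul]
      apply eq_of_between hM1 hM2
      · rw [hcM]
        intro w hw
        rw [mem_usmul, inv_inv]
        rw [hϖ, mem_usmul] at hw
        have hw2 : a • ϖ⁻¹ • w ∈ (L.act g).toSub := by rw [ha]; exact smul_mem_usmul hw
        rw [Lat.mem_act] at hw2 ⊢
        apply hM1.le
        rw [hϖ, mem_usmul, ← glMap_usmul, smul_comm]
        exact hw2
      · rw [hcM]
        intro w hw
        rw [mem_usmul, inv_inv] at hw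
        have : a • w ∈ (L.act g).toSub := by
          rw [Lat.mem_act] at hw ⊢
          exact hM2.le hw
        rw [ha, mem_usmul, inv_smul_smul] at this
        exact this
    have hvM : v ∈ M.toSub := by
      rw [hM]
      exact Submodule.mem_sup_left (Submodule.mem_span_singleton_self v)
    have := hh M v hvM
    rw [hM3, hM, Submodule.mem_sup] at this
    obtain ⟨y, hy, z, hz, hyz⟩ := this
    obtain ⟨r, rfl⟩ := Submodule.mem_span_singleton.1 hy
    exact ⟨r, by rw [← hyz, add_sub_cancel_left]; exact hz⟩
  obtain ⟨e, he, he'⟩ := exists_not_mem_maximalIdeal_smul L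
  obtain ⟨r, hr⟩ := heig e he he'
  -- cancellation of units
  have hcan : ∀ (s : 𝒪[F]) (v : Fin 2 → F) (N : Submodule 𝒪[F] (Fin 2 → F)), s ∉ 𝓂[F] →
      s • v ∈ N → v ∈ N := by
    intro s v N hs hsv
    rw [IsLocalRing.mem_maximalIdeal, mem_nonunits_iff, not_not] at hs
    exact (Submodule.smul_mem_iff_of_isUnit N hs).1 hsv
  -- the eigenvalue is the same everywhere
  have hall : ∀ v ∈ L.toSub, a⁻¹ • glMap g v - r • v ∈ 𝓂[F] • L.toSub := by
    intro v hv
    by_cases hcase : v ∈ Submodule.span 𝒪[F] {e} ⊔ 𝓂[F] • L.toSub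
    · obtain ⟨y, hy, z, hz, rfl⟩ := Submodule.mem_sup.1 hcase
      obtain ⟨s, rfl⟩ := Submodule.mem_span_singleton.1 hy
      have e1 : a⁻¹ • glMap g (s • e + z) - r • (s • e + z) =
          s • (a⁻¹ • glMap g e - r • e) + (a⁻¹ • glMap g z - r • z) := by
        rw [map_add, map_smul, smul_add, smul_add, smul_sub, smul_comm s (a⁻¹), smul_comm r s]
        abel
      rw [e1]
      exact add_mem (Submodule.smul_mem _ _ hr)
        (sub_mem (hmL z hz) (Submodule.smul_mem _ _ hz))
    · have hv' : v ∉ 𝓂[F] • L.toSub := fun h => hcase (Submodule.mem_sup_right h)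
      have hev : e + v ∉ 𝓂[F] • L.toSub := by
        intro h
        apply hcase
        have : v = (-1 : 𝒪[F]) • e + (e + v) := by rw [neg_one_smul]; abel
        rw [this]
        exact add_mem (Submodule.mem_sup_left
          (Submodule.smul_mem _ _ (Submodule.mem_span_singleton_self e)))
          (Submodule.mem_sup_right h)
      obtain ⟨s, hs⟩ := heig v hv hv'
      obtain ⟨t, ht⟩ := heig (e + v) (add_mem he hv) hev
      have hsum : (t - r) • e + (t - s) • v ∈ 𝓂[F] • L.toSub := by
        have : (t - r) • e + (t - s) • v = (a⁻¹ • glMap g e - r • e) + (a⁻¹ • glMap g v - s • v)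
            - (a⁻¹ • glMap g (e + v) - t • (e + v)) := by
          rw [map_add, smul_add, smul_add, sub_smul, sub_smul]
          abel
        rw [this]
        exact sub_mem (add_mem hr hs) ht
      have hts : t - s ∈ 𝓂[F] := by
        by_contra hts
        apply hcase
        apply hcan (t - s) v _ hts
        have : (t - s) • v = (-(t - r)) • e + ((t - r) • e + (t - s) • v) := by
          rw [neg_smul]; abel
        rw [this]
        exact add_mem (Submodule.mem_sup_left
          (Submodule.smul_mem _ _ (Submodule.mem_span_singleton_self e)))
          (Submodule.mem_sup_right hsum)
      have htr : t - r ∈ 𝓂[F] := by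
        by_contra htr
        apply he'
        apply hcan (t - r) e _ htr
        have : (t - r) • e = ((t - r) • e + (t - s) • v) - (t - s) • v := by abel
        rw [this]
        exact sub_mem hsum (Submodule.smul_mem_smul hts hv)
      have : a⁻¹ • glMap g v - r • v = (a⁻¹ • glMap g v - s • v) - (t - s) • v + (t - r) • v := by
        rw [sub_smul, sub_smul]; abel
      rw [this]
      exact add_mem (sub_mem hs (Submodule.smul_mem_smul hts hv)) (Submodule.smul_mem_smul htr hv)
  -- the eigenvalue is a unit
  have hru : r ∉ 𝓂[F] := by
    intro hr'
    apply he'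
    have h2 : a⁻¹ • glMap g e ∈ 𝓂[F] • L.toSub := by
      have : a⁻¹ • glMap g e = (a⁻¹ • glMap g e - r • e) + r • e := by abel
      rw [this]
      exact add_mem hr (Submodule.smul_mem_smul hr' he)
    rw [hϖ, mem_usmul] at h2 ⊢
    have h3 : glMap g (ϖ⁻¹ • e) ∈ (L.act g).toSub := by
      rw [ha, mem_usmul, glMap_usmul, smul_comm]
      exact h2
    rw [Lat.mem_act, glMap_inv_apply] at h3
    exact h3
  rw [IsLocalRing.mem_maximalIdeal, mem_nonunits_iff, not_not] at hru
  obtain ⟨u, rfl⟩ := hru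
  refine ⟨a * Units.map (𝒪[F].subtype : 𝒪[F] →* F) u, fun v hv => ?_⟩
  have h2 := Submodule.smul_mem _ ((u⁻¹ : (𝒪[F])ˣ) : 𝒪[F]) (hall v hv)
  have h3 : ∀ w : Fin 2 → F, ((u⁻¹ : (𝒪[F])ˣ) : 𝒪[F]) • w =
      (Units.map (𝒪[F].subtype : 𝒪[F] →* F) u)⁻¹ • w := by
    intro w
    rw [← map_inv]; rfl
  rw [smul_sub, smul_smul, Units.inv_mul, one_smul, h3, smul_smul, ← mul_inv_rev] at h2
  exact h2

theorem mem_vertexU1_of {g : GL (Fin 2) F} {L : Lat F} (h1 : (L.act g).cls = L.cls)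
    (h : ∀ v ∈ L.toSub, glMap g v - v ∈ 𝓂[F] • L.toSub) : g ∈ vertexU1 L.cls := by
  obtain ⟨a, ha⟩ := Lat.cls_eq.1 h1.symm
  obtain ⟨ϖ, hϖ0, hϖ, hϖ1⟩ := exists_uniformizer F
  have hsub : (L.act g).toSub ≤ L.toSub := by
    rintro _ ⟨v, hv, rfl⟩
    have : glMap g v = (glMap g v - v) + v := by abel
    rw [this]
    exact add_mem (Submodule.smul_le_right (h v hv)) hv
  have hact : L.act g = L := by
    apply Lat.ext'
    apply le_antisymm hsub
    -- Nakayama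
    refine Submodule.le_of_le_smul_of_le_jacobson_bot L.isLattice.fg
      (IsLocalRing.maximalIdeal_le_jacobson ⊥) (fun v hv => ?_)
    have : v = glMap g v - (glMap g v - v) := by abel
    rw [this]
    exact sub_mem (Submodule.mem_sup_left ⟨v, hv, rfl⟩) (Submodule.mem_sup_right (h v hv))
  have hK : g ∈ vertexK L.cls := by
    intro M hM
    obtain ⟨c, hc⟩ := Lat.cls_eq.1 hM.symm
    apply Lat.ext'
    simp only [Lat.act, hc, map_usmul]
    congr 1
    exact congrArg Lat.toSub hact
  refine ⟨hK, fun M hM v hv => ?_⟩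
  obtain ⟨c, hc⟩ := Lat.cls_eq.1 hM.symm
  rw [hc, mem_usmul] at hv
  have := h _ hv
  rw [hϖ, mem_usmul, glMap_usmul, ← smul_sub] at this
  rw [hc, hϖ, mem_usmul, mem_usmul, smul_comm]
  exact this

/-- Propagation of congruences along an edge. -/
theorem vertexU1_adj {g : GL (Fin 2) F} {x y : Vertex F} (hxy : (tree F).Adj x y)
    (hg : g ∈ vertexU1 x) (hy : toAut g y = y) (hy' : ∀ z, (tree F).Adj y z → toAut g z = z) :
    g ∈ vertexU1 y := by
  obtain ⟨L, rfl⟩ := Lat.exists_cls x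
  obtain ⟨M, rfl, h1, h2⟩ := exists_lattices hxy
  obtain ⟨c, hc⟩ := exists_scalar g M hy
    (fun N hN1 hN2 => hy' _ (tree_adj_of_between hN1 hN2))
  obtain ⟨ϖ, hϖ0, hϖ, hϖ1⟩ := exists_uniformizer F
  obtain ⟨v, hv, hvM⟩ := Set.exists_of_ssubset h2
  have e1 : glMap g v - v ∈ M.toSub := h1.le (hg.2 L rfl v hv)
  have e2 : c⁻¹ • glMap g v - v ∈ M.toSub := by
    have h3 : ϖ • v ∈ M.toSub := h1.le (by rw [hϖ]; exact smul_mem_usmul hv)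
    have := hc _ h3
    rw [hϖ, mem_usmul, glMap_usmul, smul_sub, inv_smul_smul, smul_comm (c⁻¹) ϖ,
      inv_smul_smul] at this
    exact this
  -- `c` is a unit congruent to `1`
  have hunit : ∀ s : 𝒪[F], s • v ∈ M.toSub → s ∈ 𝓂[F] := by
    intro s hs
    by_contra hs'
    rw [IsLocalRing.mem_maximalIdeal, mem_nonunits_iff, not_not] at hs'
    exact hvM ((Submodule.smul_mem_iff_of_isUnit _ hs').1 hs)
  have hc1 : ((c⁻¹ : Fˣ) : F) ∈ 𝒪[F] := by
    by_contra hcc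
    have ha := hϖ1 c⁻¹ hcc
    have hcO : (c : F) ∈ 𝒪[F] := by
      have := mul_mem hϖ0 ha
      rwa [← Units.val_mul, mul_inv_rev, inv_inv, mul_comm c, mul_inv_cancel_left] at this
    have hcm : (⟨c, hcO⟩ : 𝒪[F]) ∈ 𝓂[F] := by
      rw [IsLocalRing.mem_maximalIdeal, mem_nonunits_iff]
      intro hu
      obtain ⟨d, hd⟩ := hu.exists_right_inv
      have hd' : (c : F) * (d : F) = 1 := congrArg Subtype.val hd
      apply hcc
      rw [Units.val_inv_eq_inv_val, ← eq_inv_of_mul_eq_one_right hd']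
      exact d.2
    have e3 : ((1 : 𝒪[F]) - ⟨c, hcO⟩) • v ∈ M.toSub := by
      have e4 : c • (c⁻¹ • glMap g v - v) ∈ M.toSub := coe_mem_smul hcO e2
      rw [smul_sub, smul_inv_smul] at e4
      have e5 := sub_mem e4 e1
      have e6 : ((1 : 𝒪[F]) - ⟨c, hcO⟩) • v = glMap g v - c • v - (glMap g v - v) := by
        rw [sub_smul, one_smul]
        change v - c • v = _
        abel
      rw [e6]; exact e5
    have e7 := add_mem (hunit _ e3) hcm
    rw [sub_add_cancel] at e7
    exact (Ideal.ne_top_iff_one _).1 (IsLocalRing.maximalIdeal.isMaximal _).ne_top e7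
  have hcm : (⟨_, hc1⟩ - 1 : 𝒪[F]) ∈ 𝓂[F] := by
    apply hunit
    have e4 : c⁻¹ • (glMap g v - v) ∈ M.toSub := coe_mem_smul hc1 e1
    have e5 := sub_mem e2 e4
    have e6 : (⟨_, hc1⟩ - 1 : 𝒪[F]) • v = c⁻¹ • glMap g v - v - c⁻¹ • (glMap g v - v) := by
      rw [sub_smul, one_smul, smul_sub]
      change c⁻¹ • v - v = _
      abel
    rw [e6]; exact e5
  apply mem_vertexU1_of hy
  intro w hw
  have hgw : glMap g w ∈ M.toSub := by
    have : glMap g w = (glMap g w - w) + w := by abel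
    rw [this]
    exact add_mem (h1.le (hg.2 L rfl w (h2.le hw))) hw
  have e8 : glMap g w - w = (c⁻¹ • glMap g w - w) - (⟨_, hc1⟩ - 1 : 𝒪[F]) • glMap g w := by
    rw [sub_smul, one_smul]
    change _ = _ - (c⁻¹ • glMap g w - glMap g w)
    abel
  rw [e8]
  exact sub_mem (hc w hw) (Submodule.smul_mem_smul hcm hgw)

theorem vertexU1_walk {g : GL (Fin 2) F} {x y : Vertex F} (p : (tree F).Walk x y)
    (hb : ∀ z ∈ ball (p.length + 1) x, toAut g z = z) (hg : g ∈ vertexU1 x) :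
    g ∈ vertexU1 y := by
  induction p with
  | nil => exact hg
  | @cons a b c h p ih =>
    have hsub : ∀ z ∈ ball (p.length + 1) b, toAut g z = z := by
      intro z hz
      apply hb
      refine ((tree F).edist_triangle (v := b)).trans ?_
      rw [SimpleGraph.Walk.length_cons]
      have h1 : (tree F).edist a b ≤ 1 := by
        rw [SimpleGraph.edist_eq_one_iff_adj.2 h]
      have h2 : (tree F).edist b z ≤ ((p.length + 1 : ℕ) : ℕ∞) := hz
      calc _ ≤ 1 + ((p.length + 1 : ℕ) : ℕ∞) := add_le_add h1 h2
        _ = _ := by push_cast; ring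
    refine ih hsub (vertexU1_adj h hg (hsub b (self_mem_ball _ _)) fun z hz => hsub z ?_)
    change (tree F).edist b z ≤ _
    rw [SimpleGraph.edist_eq_one_iff_adj.2 hz]
    exact_mod_cast Nat.le_add_left 1 _

/-- The pointwise stabilizer of `Z^{(e)}(x)` in `GL₂(F)` is contained in `Z · U_x^{(e)}`. -/
theorem exists_scalar_mul {e : ℕ} [NeZero e] {g : GL (Fin 2) F} {x : Vertex F}
    (hg : ∀ y ∈ ball e x, toAut g y = y) :
    ∃ z ∈ Subgroup.center (GL (Fin 2) F), ∃ u ∈ vertexU e x, g = z * u := by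
  have he : 1 ≤ e := NeZero.one_le
  obtain ⟨L, rfl⟩ := Lat.exists_cls x
  have hL : (L.act g).cls = L.cls := hg _ (self_mem_ball _ _)
  obtain ⟨c, hc⟩ := exists_scalar g L hL (fun M h1 h2 => by
    refine hg M.cls ?_
    change (tree F).edist _ _ ≤ _
    rw [SimpleGraph.edist_eq_one_iff_adj.2 (tree_adj_of_between h1 h2)]
    exact_mod_cast he)
  refine ⟨sc c, ?_, (sc c)⁻¹ * g, ?_, (mul_inv_cancel_left _ _).symm⟩
  · rw [Matrix.GeneralLinearGroup.center_eq_range_scalar]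
    exact ⟨c, rfl⟩
  · have hg' : ∀ y ∈ ball e L.cls, toAut ((sc c)⁻¹ * g) y = y := by
      intro y hy
      rw [map_mul, RelIso.mul_apply, hg y hy, ← map_inv]
      exact toAut_sc _ _
    have h1 : (sc c)⁻¹ * g ∈ vertexU1 L.cls := by
      apply mem_vertexU1_of (hg' _ (self_mem_ball _ _))
      intro v hv
      rw [glMap_mul, ← map_inv]
      have := hc v hv
      rw [← glMap_sc] at this
      exact this
    simp only [vertexU, Subgroup.mem_iInf]
    intro y hy
    have hy1 : (tree F).edist L.cls y ≤ ((e - 1 : ℕ) : ℕ∞) := hy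
    obtain ⟨p, hp⟩ := SimpleGraph.exists_walk_of_edist_ne_top
      (ne_top_of_le_ne_top (ENat.natCast_ne_top _) hy1)
    refine vertexU1_walk p (fun z hz => hg' z ?_) h1
    have hpe : p.length ≤ e - 1 := by
      rw [← hp] at hy1
      exact_mod_cast hy1
    have hz' : (tree F).edist L.cls z ≤ ((p.length + 1 : ℕ) : ℕ∞) := hz
    refine hz'.trans ?_
    exact_mod_cast (by omega : p.length + 1 ≤ e)

end Stabilizer

/-! ### Coefficient systems -/

section Coefficients

variable (F : Type u) [Field F] [ValuativeRel F]
variable (Λ : Type v) [CommRing Λ]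

/-- A homological coefficient system in `Λ`-modules on the tree. -/
structure CoeffSystem where
  /-- the module at a vertex -/
  V : Vertex F → ModuleCat.{max u w} Λ
  /-- the module at an edge -/
  E : Edge F → ModuleCat.{max u w} Λ
  /-- the transition maps -/
  r : ∀ (η : Edge F) (x : Vertex F), x ∈ η.1 → (E η →ₗ[Λ] V x)

/-- A homological coefficient system together with the data of linear maps
`g_τ : 𝓕(τ) → 𝓕(g τ)` for all `g ∈ GL₂(F)` and all simplices `τ`. To avoid transports, the target
is `𝓕(τ')` for any `τ'` with a proof of `g τ = τ'`. The laws of an equivariant coefficient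
system are the property `GSystem.IsEquivariant`. -/
structure GSystem extends CoeffSystem.{u, v, w} F Λ where
  /-- the maps `g_x` -/
  actV : ∀ (g : GL (Fin 2) F) (x y : Vertex F), toAut g x = y → (V x →ₗ[Λ] V y)
  /-- the maps `g_η` -/
  actE : ∀ (g : GL (Fin 2) F) (η θ : Edge F), (toAut g).mapEdgeSet η = θ → (E η →ₗ[Λ] E θ)

variable {F Λ}

/-- Morphisms: families of linear maps, compatible with the transition maps and with the maps
`g_τ`. -/
@[ext]
structure GSystem.Hom (S T : GSystem.{u, v, w} F Λ) where
  /-- the maps at the vertices -/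
  onV : ∀ x : Vertex F, S.V x →ₗ[Λ] T.V x
  /-- the maps at the edges -/
  onE : ∀ η : Edge F, S.E η →ₗ[Λ] T.E η
  comm_r : ∀ (η : Edge F) (x : Vertex F) (h : x ∈ η.1) (f : S.E η),
    onV x (S.r η x h f) = T.r η x h (onE η f)
  comm_actV : ∀ (g : GL (Fin 2) F) (x y : Vertex F) (h : toAut g x = y) (f : S.V x),
    onV y (S.actV g x y h f) = T.actV g x y h (onV x f)
  comm_actE : ∀ (g : GL (Fin 2) F) (η θ : Edge F) (h : (toAut g).mapEdgeSet η = θ) (f : S.E η),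
    onE θ (S.actE g η θ h f) = T.actE g η θ h (onE η f)

instance : Category (GSystem.{u, v, w} F Λ) where
  Hom := GSystem.Hom
  id S :=
    { onV := fun _ => LinearMap.id
      onE := fun _ => LinearMap.id
      comm_r := fun _ _ _ _ => rfl
      comm_actV := fun _ _ _ _ _ => rfl
      comm_actE := fun _ _ _ _ _ => rfl }
  comp φ ψ :=
    { onV := fun x => (ψ.onV x).comp (φ.onV x)
      onE := fun η => (ψ.onE η).comp (φ.onE η)
      comm_r := fun η x h f => by
        simp only [LinearMap.comp_apply, φ.comm_r, ψ.comm_r]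
      comm_actV := fun g x y h f => by
        simp only [LinearMap.comp_apply, φ.comm_actV, ψ.comm_actV]
      comm_actE := fun g η θ h f => by
        simp only [LinearMap.comp_apply, φ.comm_actE, ψ.comm_actE] }

namespace GSystem

variable (S : GSystem.{u, v, w} F Λ)

/-- The laws of a `GL₂(F)`-equivariant homological coefficient system. -/
structure IsEquivariant : Prop where
  mulV : ∀ (g h : GL (Fin 2) F) (x y z : Vertex F) (hxy : toAut h x = y) (hyz : toAut g y = z)
    (hxz : toAut (g * h) x = z) (f : S.V x),
    S.actV g y z hyz (S.actV h x y hxy f) = S.actV (g * h) x z hxz f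
  mulE : ∀ (g h : GL (Fin 2) F) (x y z : Edge F) (hxy : (toAut h).mapEdgeSet x = y)
    (hyz : (toAut g).mapEdgeSet y = z) (hxz : (toAut (g * h)).mapEdgeSet x = z) (f : S.E x),
    S.actE g y z hyz (S.actE h x y hxy f) = S.actE (g * h) x z hxz f
  oneV : ∀ (x : Vertex F) (h : toAut 1 x = x) (f : S.V x), S.actV 1 x x h f = f
  oneE : ∀ (η : Edge F) (h : (toAut 1).mapEdgeSet η = η) (f : S.E η), S.actE 1 η η h f = f
  comm : ∀ (g : GL (Fin 2) F) (η θ : Edge F) (x y : Vertex F) (hη : (toAut g).mapEdgeSet η = θ)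
    (hx : toAut g x = y) (hxη : x ∈ η.1) (hyθ : y ∈ θ.1) (f : S.E η),
    S.r θ y hyθ (S.actE g η θ hη f) = S.actV g x y hx (S.r η x hxη f)

/-- The conditions that define the category `ℭ^{(e)}(Λ)` among all equivariant coefficient
systems: `U_τ^{(e)}` acts trivially on `𝓕(τ)`; the transition maps `𝓕(η) → 𝓕(z)` are injective,
with image `𝓕(z)^{U_η^{(e)}}`; and this image generates `𝓕(z)` as a representation of `K_z`. -/
structure IsLevel (e : ℕ) : Prop where
  trivialV : ∀ (x : Vertex F), ∀ u ∈ vertexU e x, ∀ (h : toAut u x = x) (f : S.V x),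
    S.actV u x x h f = f
  trivialE : ∀ (η : Edge F), ∀ u ∈ edgeU e η, ∀ (h : (toAut u).mapEdgeSet η = η) (f : S.E η),
    S.actE u η η h f = f
  injective : ∀ (η : Edge F) (z : Vertex F) (hz : z ∈ η.1), Function.Injective (S.r η z hz)
  range : ∀ (η : Edge F) (z : Vertex F) (hz : z ∈ η.1) (f : S.V z),
    f ∈ LinearMap.range (S.r η z hz) ↔
      ∀ u ∈ edgeU e η, ∀ h : toAut u z = z, S.actV u z z h f = f
  generates : ∀ (η : Edge F) (z : Vertex F) (hz : z ∈ η.1),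
    Submodule.span Λ {f : S.V z | ∃ k ∈ vertexK z, ∃ h : toAut k z = z,
      ∃ f' ∈ LinearMap.range (S.r η z hz), S.actV k z z h f' = f} = ⊤

/-- The action of `GL₂(F)` factors through `PGL₂(F)`: the centre acts trivially. -/
structure TrivialCentre : Prop where
  onV : ∀ (x : Vertex F), ∀ z ∈ Subgroup.center (GL (Fin 2) F), ∀ (h : toAut z x = x) (f : S.V x),
    S.actV z x x h f = f
  onE : ∀ (η : Edge F), ∀ z ∈ Subgroup.center (GL (Fin 2) F),
    ∀ (h : (toAut z).mapEdgeSet η = η) (f : S.E η), S.actE z η η h f = f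

end GSystem

variable (F Λ) in
/-- The category `ℭ_0^{(e)}(Λ)`, as a full subcategory. -/
def isC0 (e : ℕ) : ObjectProperty (GSystem.{u, v, w} F Λ) :=
  fun S => S.IsEquivariant ∧ S.IsLevel e ∧ S.TrivialCentre

variable (F Λ) in
/-- The category `ℭ_0^{(e)}(Λ)` of equivariant coefficient systems of level `e` with trivial
central character. -/
abbrev C0 (e : ℕ) := (isC0.{u, v, w} F Λ e).FullSubcategory

instance : DecidableEq (Vertex F) := Classical.decEq _

namespace CoeffSystem

variable (S : CoeffSystem.{u, v, w} F Λ)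

/-- The map `⨁_η 𝓕(η) → ⨁_x 𝓕(x)` sending `f ∈ 𝓕(η)` to the sum of its images
`r^η_x(f)` for `x ∈ η`. -/
def boundary : (⨁ η : Edge F, S.E η) →ₗ[Λ] (⨁ x : Vertex F, S.V x) :=
  DirectSum.toModule Λ (Edge F) _ fun η =>
    ∑ x ∈ η.1.toFinset.attach,
      (DirectSum.lof Λ (Vertex F) (fun x => S.V x) x.1).comp
        (S.r η x.1 (Sym2.mem_toFinset.1 x.2))

/-- `H_0(X, 𝓕)`, the cokernel of the boundary map. -/
abbrev H0 : Type (max u w) := (⨁ x : Vertex F, S.V x) ⧸ LinearMap.range S.boundary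

/-- The natural map `𝓕(x) → H_0(X, 𝓕)`. -/
def toH0 (x : Vertex F) : S.V x →ₗ[Λ] S.H0 :=
  (LinearMap.range S.boundary).mkQ.comp (DirectSum.lof Λ (Vertex F) (fun x => S.V x) x)

variable {S} in
theorem H0_hom_ext {M : Type*} [AddCommGroup M] [Module Λ M] {φ ψ : S.H0 →ₗ[Λ] M}
    (h : ∀ x f, φ (S.toH0 x f) = ψ (S.toH0 x f)) : φ = ψ := by
  apply Submodule.linearMap_qext
  apply DirectSum.linearMap_ext
  intro x
  ext f
  exact h x f

theorem boundary_lof (η : Edge F) (f : S.E η) :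
    S.boundary (DirectSum.lof Λ (Edge F) (fun η => S.E η) η f) =
      ∑ x ∈ η.1.toFinset.attach, DirectSum.lof Λ (Vertex F) (fun x => S.V x) x.1
        (S.r η x.1 (Sym2.mem_toFinset.1 x.2) f) := by
  rw [boundary, DirectSum.toModule_lof, LinearMap.sum_apply]
  rfl

theorem sum_toH0 (η : Edge F) (f : S.E η) :
    ∑ x ∈ η.1.toFinset.attach, S.toH0 x.1 (S.r η x.1 (Sym2.mem_toFinset.1 x.2) f) = 0 := by
  have h : (LinearMap.range S.boundary).mkQ
      (S.boundary (DirectSum.lof Λ (Edge F) (fun η => S.E η) η f)) = 0 :=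
    (Submodule.Quotient.mk_eq_zero _).2 ⟨_, rfl⟩
  rw [boundary_lof, map_sum] at h
  exact h

/-- A family of linear maps on the `𝓕(x)` which kills the boundaries induces a linear map on
`H_0(X, 𝓕)`. -/
def H0lift {M : Type*} [AddCommGroup M] [Module Λ M] (φ : ∀ x : Vertex F, S.V x →ₗ[Λ] M)
    (h : ∀ (η : Edge F) (f : S.E η),
      ∑ x ∈ η.1.toFinset.attach, φ x.1 (S.r η x.1 (Sym2.mem_toFinset.1 x.2) f) = 0) :
    S.H0 →ₗ[Λ] M :=
  (LinearMap.range S.boundary).liftQ (DirectSum.toModule Λ (Vertex F) M φ) (by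
    rintro _ ⟨c, rfl⟩
    rw [LinearMap.mem_ker, ← LinearMap.comp_apply]
    have : (DirectSum.toModule Λ (Vertex F) M φ).comp S.boundary = 0 := by
      apply DirectSum.linearMap_ext
      intro η
      ext f
      rw [LinearMap.comp_apply, LinearMap.comp_apply, boundary_lof, map_sum]
      simp only [DirectSum.toModule_lof]
      exact h η f
    rw [this, LinearMap.zero_apply])

theorem H0lift_toH0 {M : Type*} [AddCommGroup M] [Module Λ M] (φ : ∀ x : Vertex F, S.V x →ₗ[Λ] M)
    (h : ∀ (η : Edge F) (f : S.E η),
      ∑ x ∈ η.1.toFinset.attach, φ x.1 (S.r η x.1 (Sym2.mem_toFinset.1 x.2) f) = 0)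
    (x : Vertex F) (f : S.V x) : S.H0lift φ h (S.toH0 x f) = φ x f := by
  change DirectSum.toModule Λ (Vertex F) M φ (DirectSum.lof Λ _ _ x f) = _
  rw [DirectSum.toModule_lof]

end CoeffSystem

theorem ball_subset_edgeBall {e : ℕ} {η : Edge F} {x : Vertex F} (hx : x ∈ η.1) :
    ball e x ⊆ edgeBall e η := fun _ hy => ⟨x, hx, hy⟩

/-- The map induced on `H_0` by a morphism. -/
def H0map {S T : GSystem.{u, v, w} F Λ} (φ : S ⟶ T) : S.H0 →ₗ[Λ] T.H0 :=
  S.H0lift (fun x => (T.toH0 x).comp (φ.onV x)) (fun η f => by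
    simp only [LinearMap.comp_apply, φ.comm_r]
    exact T.sum_toH0 η (φ.onE η f))

theorem H0map_toH0 {S T : GSystem.{u, v, w} F Λ} (φ : S ⟶ T) (x : Vertex F) (f : S.V x) :
    H0map φ (S.toH0 x f) = T.toH0 x (φ.onV x f) := by
  rw [H0map, CoeffSystem.H0lift_toH0]
  rfl

end Coefficients

/-! ### The functor `𝓕 ↦ H_0(X, 𝓕)` -/

section H0functor

variable {F : Type u} [Field F] [ValuativeRel F] [TopologicalSpace F]
  [IsNonarchimedeanLocalField F]
variable {Λ : Type v} [CommRing Λ]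

theorem exists_agree {e : ℕ} (g : hatG F e) (x : Vertex F) :
    ∃ g' : GL (Fin 2) F, ∀ y ∈ ball e x, (g : AutTree F) y = toAut g' y := by
  obtain ⟨η, hη⟩ := exists_edge x
  obtain ⟨g', hg'⟩ := g.2 η
  exact ⟨g', fun y hy => hg' y (ball_subset_edgeBall hη hy)⟩

/-- The map `g_x : 𝓕(x) → 𝓕(g x)` for `g ∈ Ĝ^{(e)}`: it is `g'_x` for a `g' ∈ GL₂(F)` that agrees
with `g` on `Z^{(e)}(x)`. -/
def hatV {e : ℕ} (S : GSystem.{u, v, w} F Λ) (g : hatG F e) (x : Vertex F) :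
    S.V x →ₗ[Λ] S.V ((g : AutTree F) x) :=
  S.actV (exists_agree g x).choose x _
    ((exists_agree g x).choose_spec x (self_mem_ball e x)).symm

section

variable {e : ℕ} [NeZero e] {S : GSystem.{u, v, w} F Λ}

/-- The action on `𝓕(x)` only depends on the action on `Z^{(e)}(x)`. -/
theorem actV_congr (hS : isC0 F Λ e S) {g h : GL (Fin 2) F} {x y : Vertex F}
    (hgh : ∀ z ∈ ball e x, toAut g z = toAut h z) (hg : toAut g x = y) (hh : toAut h x = y)
    (f : S.V x) : S.actV g x y hg f = S.actV h x y hh f := by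
  have hfix : ∀ z ∈ ball e x, toAut (h⁻¹ * g) z = z := by
    intro z hz
    rw [map_mul, RelIso.mul_apply, hgh z hz, map_inv, RelIso.inv_apply_self]
  obtain ⟨z, hz, u, hu, hzu⟩ := exists_scalar_mul hfix
  have hg' : g = h * (z * u) := by rw [← hzu, mul_inv_cancel_left]
  have hzx : toAut z x = x := by
    rw [Matrix.GeneralLinearGroup.center_eq_range_scalar] at hz
    obtain ⟨c, rfl⟩ := hz
    exact toAut_sc c x
  have hux : toAut u x = x := by
    have := hfix x (self_mem_ball e x)
    rw [hzu, map_mul, RelIso.mul_apply] at this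
    apply (toAut z).injective
    rw [this, hzx]
  have hzux : toAut (z * u) x = x := by rw [map_mul, RelIso.mul_apply, hux, hzx]
  subst hg'
  rw [← hS.1.mulV h (z * u) x x y hzux hh, ← hS.1.mulV z u x x x hux hzx,
    hS.2.1.trivialV x u hu, hS.2.2.onV x z hz]

theorem hatV_eq (hS : isC0 F Λ e S) (g : hatG F e) (x : Vertex F) (g' : GL (Fin 2) F)
    (h : ∀ y ∈ ball e x, (g : AutTree F) y = toAut g' y)
    (hx : toAut g' x = (g : AutTree F) x) (f : S.V x) :
    hatV S g x f = S.actV g' x _ hx f := by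
  apply actV_congr hS
  intro z hz
  rw [← h z hz, ← (exists_agree g x).choose_spec z hz]

theorem hat_sum (hS : isC0 F Λ e S) (g : hatG F e) (η : Edge F) (f : S.E η) :
    ∑ x ∈ η.1.toFinset.attach, ((S.toH0 ((g : AutTree F) x.1)).comp (hatV S g x.1))
      (S.r η x.1 (Sym2.mem_toFinset.1 x.2) f) = 0 := by
  obtain ⟨g', hg'⟩ := g.2 η
  rw [← S.sum_toH0 ((toAut g').mapEdgeSet η) (S.actE g' η _ rfl f)]
  have hgx : ∀ x ∈ η.1, toAut g' x = (g : AutTree F) x := fun x hx =>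
    (hg' x (ball_subset_edgeBall hx (self_mem_ball e x))).symm
  have hmem : ∀ x ∈ η.1, (g : AutTree F) x ∈ ((toAut g').mapEdgeSet η).1 := fun x hx =>
    Sym2.mem_map.2 ⟨x, hx, hgx x hx⟩
  refine Finset.sum_bij (fun x _ => ⟨(g : AutTree F) x.1,
    Sym2.mem_toFinset.2 (hmem x.1 (Sym2.mem_toFinset.1 x.2))⟩)
    (fun _ _ => Finset.mem_attach _ _) ?_ ?_ ?_
  · intro x _ y _ h
    exact Subtype.ext ((g : AutTree F).injective (congrArg Subtype.val h))
  · rintro ⟨y, hy⟩ _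
    obtain ⟨x, hx, hxy⟩ := Sym2.mem_map.1 (Sym2.mem_toFinset.1 hy)
    exact ⟨⟨x, Sym2.mem_toFinset.2 hx⟩, Finset.mem_attach _ _,
      Subtype.ext ((hgx x hx).symm.trans hxy)⟩
  · intro x _
    have hx := Sym2.mem_toFinset.1 x.2
    rw [LinearMap.comp_apply, hatV_eq hS g x.1 g'
      (fun y hy => hg' y (ball_subset_edgeBall hx hy)) (hgx _ hx)]
    rw [hS.1.comm g' η _ x.1 _ rfl (hgx _ hx) hx (hmem _ hx)]

/-- The action of `g ∈ Ĝ^{(e)}` on `H_0(X, 𝓕)`, given by the maps `g_x : 𝓕(x) → 𝓕(g x)`. -/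
def H0act (hS : isC0 F Λ e S) (g : hatG F e) : S.H0 →ₗ[Λ] S.H0 :=
  S.H0lift (fun x => (S.toH0 ((g : AutTree F) x)).comp (hatV S g x)) (hat_sum hS g)

theorem H0act_toH0 (hS : isC0 F Λ e S) (g : hatG F e) (x : Vertex F) (f : S.V x) :
    H0act hS g (S.toH0 x f) = S.toH0 _ (hatV S g x f) := by
  rw [H0act, CoeffSystem.H0lift_toH0]
  rfl

theorem H0act_toH0_eq (hS : isC0 F Λ e S) (g : hatG F e) (x y : Vertex F) (g' : GL (Fin 2) F)
    (h : ∀ z ∈ ball e x, (g : AutTree F) z = toAut g' z)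
    (hx : toAut g' x = y) (f : S.V x) :
    H0act hS g (S.toH0 x f) = S.toH0 y (S.actV g' x y hx f) := by
  have hy : (g : AutTree F) x = y := (h x (self_mem_ball e x)).trans hx
  subst hy
  rw [H0act_toH0, hatV_eq hS g x g' h hx]

/-- `H_0(X, 𝓕)` as a representation of `Ĝ^{(e)}`. -/
def H0ρ (hS : isC0 F Λ e S) : Representation Λ (hatG F e) S.H0 where
  toFun := H0act hS
  map_one' := by
    apply CoeffSystem.H0_hom_ext
    intro x f
    rw [H0act_toH0_eq hS 1 x x 1 (fun z _ => by rw [map_one]; rfl) (by rw [map_one]; rfl),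
      hS.1.oneV]
    rfl
  map_mul' g h := by
    apply CoeffSystem.H0_hom_ext
    intro x f
    obtain ⟨h', hh'⟩ := exists_agree h x
    obtain ⟨g', hg'⟩ := exists_agree g (toAut h' x)
    have hx : (h : AutTree F) x = toAut h' x := hh' x (self_mem_ball e x)
    have hgh : ∀ z ∈ ball e x, ((g * h : hatG F e) : AutTree F) z = toAut (g' * h') z := by
      intro z hz
      rw [Subgroup.coe_mul, map_mul, RelIso.mul_apply, RelIso.mul_apply, ← hh' z hz]
      apply hg'
      rw [← hx]
      exact ball_aut _ hz
    rw [Module.End.mul_apply, H0act_toH0_eq hS h x _ h' hh' rfl,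
      H0act_toH0_eq hS g _ _ g' hg' rfl, H0act_toH0_eq hS (g * h) x (toAut g' (toAut h' x)) (g' * h') hgh
        (by rw [map_mul]; rfl),
      hS.1.mulV g' h' x _ _ rfl rfl (by rw [map_mul]; rfl)]

end

variable (F Λ) in
/-- The functor `𝓕 ↦ H_0(X, 𝓕)` from `ℭ_0^{(e)}(Λ)` to representations of `Ĝ^{(e)}`. -/
def H0functor (e : ℕ) [NeZero e] : C0.{u, v, w} F Λ e ⥤ Rep.{max u w} Λ (hatG F e) where
  obj S := Rep.of (H0ρ S.property)
  map {S T} φ := Rep.ofHom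
    { toLinearMap := H0map φ.hom
      isIntertwining' := fun g => by
        apply CoeffSystem.H0_hom_ext
        intro x f
        obtain ⟨g', hg'⟩ := exists_agree g x
        change H0map φ.hom (H0act S.property g (S.obj.toH0 x f)) =
          H0act T.property g (H0map φ.hom (S.obj.toH0 x f))
        rw [H0act_toH0_eq S.property g x _ g' hg' rfl, H0map_toH0, H0map_toH0,
          H0act_toH0_eq T.property g x _ g' hg' rfl, φ.hom.comm_actV] }
  map_id S := by
    apply Rep.hom_ext
    apply Representation.IntertwiningMap.ext
    apply CoeffSystem.H0_hom_ext
    intro x f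
    exact H0map_toH0 _ x f
  map_comp {S T W} φ ψ := by
    apply Rep.hom_ext
    apply Representation.IntertwiningMap.ext
    apply CoeffSystem.H0_hom_ext
    intro x f
    change H0map (φ.hom ≫ ψ.hom) (S.obj.toH0 x f) = H0map ψ.hom (H0map φ.hom (S.obj.toH0 x f))
    rw [H0map_toH0, H0map_toH0, H0map_toH0]
    rfl

end H0functor

/-! ### Representations of `Ĝ^{(e)}` and the functor `V ↦ 𝓕̂_V` -/

section Fhat

variable {F : Type u} [Field F] [ValuativeRel F]
variable {Λ : Type v} [CommRing Λ]

/-- The submodule `V^{Û_η^{(e)}}` of a representation `V` of `Ĝ^{(e)}`. -/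
def edgeInv {e : ℕ} (V : Rep.{max u w} Λ (hatG F e)) (η : Edge F) : Submodule Λ V.V where
  carrier := {v | ∀ u : hatG F e, (u : AutTree F) ∈ hatU e η → V.ρ u v = v}
  add_mem' {v w} hv hw u hu := by rw [map_add, hv u hu, hw u hu]
  zero_mem' u _ := map_zero _
  smul_mem' a v hv u hu := by rw [map_smul, hv u hu]

/-- The submodule `∑_η V^{Û_η^{(e)}}` of `V`, the sum being over the edges `η` at the vertex
`x`. -/
def vertexSum {e : ℕ} (V : Rep.{max u w} Λ (hatG F e)) (x : Vertex F) : Submodule Λ V.V :=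
  ⨆ (η : Edge F) (_ : x ∈ η.1), edgeInv V η

variable (F Λ) in
/-- The objects of `ℜ̂_0^{(e)}(Λ)`: the representations of `Ĝ^{(e)}` on `Λ`-modules which are
generated by their `Û_σ^{(e)}`-invariants and smooth as representations of `Û_σ^{(e)}`. Here
`Û_σ^{(e)}` carries its profinite topology, in which the pointwise stabilizers of the sets
`Z^{(m)}(σ)` form a basis of neighbourhoods of `1`; smooth means that each vector has an open
stabilizer. -/
def isR0 (e : ℕ) (σ : Edge F) : ObjectProperty (Rep.{max u w} Λ (hatG F e)) := fun V =>
  Submodule.span Λ {w : V.V | ∃ g : hatG F e, ∃ v ∈ edgeInv.{u, v, w} V σ, V.ρ g v = w} = ⊤ ∧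
  ∀ v : V.V, ∃ m : ℕ, ∀ u : hatG F e, (u : AutTree F) ∈ hatU e σ →
    (∀ y ∈ edgeBall m σ, (u : AutTree F) y = y) → V.ρ u v = v

variable (F Λ) in
/-- The category `ℜ̂_0^{(e)}(Λ)`. -/
abbrev R0 (e : ℕ) (σ : Edge F) := (isR0.{u, v, w} F Λ e σ).FullSubcategory

theorem vertexK_conj {g u : GL (Fin 2) F} {x : Vertex F} (hu : u ∈ vertexK (toAut g x)) :
    g⁻¹ * u * g ∈ vertexK x := by
  intro L hL
  have h1 : (L.act g).cls = toAut g x := by rw [← toAut_cls, hL]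
  rw [Lat.act_mul, Lat.act_mul, hu _ h1, ← Lat.act_mul, inv_mul_cancel, Lat.act_one]

theorem vertexU1_conj {g u : GL (Fin 2) F} {x : Vertex F} (hu : u ∈ vertexU1 (toAut g x)) :
    g⁻¹ * u * g ∈ vertexU1 x := by
  refine ⟨vertexK_conj hu.1, fun L hL v hv => ?_⟩
  have h1 : (L.act g).cls = toAut g x := by rw [← toAut_cls, hL]
  have h2 := hu.2 _ h1 (glMap g v) ⟨v, hv, rfl⟩
  rw [map_ideal_smul] at h2
  obtain ⟨w, hw, hw'⟩ := h2
  have h3 : glMap (g⁻¹ * u * g) v - v = w := by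
    apply glMap_injective g
    rw [hw', map_sub, glMap_mul, glMap_mul, glMap_apply_inv]
  rw [h3]; exact hw

theorem edgeU_conj {e : ℕ} {g u : GL (Fin 2) F} {η : Edge F}
    (hu : u ∈ edgeU e ((toAut g).mapEdgeSet η)) : g⁻¹ * u * g ∈ edgeU e η := by
  have key : edgeU e ((toAut g).mapEdgeSet η) ≤
      (edgeU e η).comap (MulAut.conj g⁻¹).toMonoidHom := by
    refine iSup₂_le fun y hy => ?_
    obtain ⟨x, hx, rfl⟩ := Sym2.mem_map.1 hy
    intro u hu
    have h1 : vertexU e x ≤ edgeU e η := le_iSup₂_of_le x hx le_rfl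
    apply h1
    rw [vertexU, Subgroup.mem_iInf] at hu ⊢
    intro z
    rw [Subgroup.mem_iInf]
    intro hz
    have h2 := Subgroup.mem_iInf.1 (hu (toAut g z)) (ball_aut (toAut g) hz)
    have h3 := vertexU1_conj h2
    simpa using h3
  simpa using key hu

theorem hatU_conj {e : ℕ} (g : GL (Fin 2) F) (u : hatG F e) {η : Edge F}
    (hu : (u : AutTree F) ∈ hatU e ((toAut g).mapEdgeSet η)) :
    (((toHatG F e g)⁻¹ * u * toHatG F e g : hatG F e) : AutTree F) ∈ hatU e η := by
  intro μ
  obtain ⟨u', hu', h⟩ := hu ((toAut g).mapEdgeSet μ)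
  refine ⟨g⁻¹ * u' * g, edgeU_conj hu', fun y hy => ?_⟩
  have h1 := h _ (edgeBall_aut (toAut g) hy)
  rw [map_mul, map_mul, map_inv]
  simp only [Subgroup.coe_mul, Subgroup.coe_inv, RelIso.mul_apply, coe_toHatG]
  rw [h1]

theorem edgeInv_act {e : ℕ} (V : Rep.{max u w} Λ (hatG F e)) (g : GL (Fin 2) F) {η θ : Edge F}
    (h : (toAut g).mapEdgeSet η = θ) {v : V.V} (hv : v ∈ edgeInv.{u, v, w} V η) :
    V.ρ (toHatG F e g) v ∈ edgeInv.{u, v, w} V θ := by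
  subst h
  intro u hu
  have h1 := hv _ (hatU_conj g u hu)
  conv_rhs => rw [← h1]
  rw [← Module.End.mul_apply, ← Module.End.mul_apply, ← map_mul, ← map_mul]
  congr 2
  group

theorem edgeInv_le_vertexSum {e : ℕ} (V : Rep.{max u w} Λ (hatG F e)) {η : Edge F} {x : Vertex F}
    (hx : x ∈ η.1) : edgeInv.{u, v, w} V η ≤ vertexSum.{u, v, w} V x :=
  le_iSup₂_of_le (f := fun (η : Edge F) (_ : x ∈ η.1) => edgeInv.{u, v, w} V η) η hx le_rfl

theorem vertexSum_act {e : ℕ} (V : Rep.{max u w} Λ (hatG F e)) (g : GL (Fin 2) F) {x y : Vertex F}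
    (h : toAut g x = y) : vertexSum.{u, v, w} V x ≤
      (vertexSum.{u, v, w} V y).comap (V.ρ (toHatG F e g)) := by
  subst h
  refine iSup₂_le fun η hη v hv => ?_
  exact edgeInv_le_vertexSum V (η := (toAut g).mapEdgeSet η) (Sym2.mem_map.2 ⟨x, hη, rfl⟩)
    (edgeInv_act V g rfl hv)

/-- `y` lies in the `SL₂(F)`-orbit of `x`. -/
def InSLOrbit (x y : Vertex F) : Prop :=
  ∃ s : SL(2, F), toAut (Matrix.SpecialLinearGroup.toGL s) x = y

open Classical in
/-- The sign `+1` if `x` lies in the `SL₂(F)`-orbit of `x₊`, and `-1` otherwise. -/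
def vertexSign (xp x : Vertex F) : ℤ := if InSLOrbit xp x then 1 else -1

/-- The coefficient system `𝓕̂_V^{(e)}`. The transition map `𝓕̂_V(η) → 𝓕̂_V(x)` is `±` the
inclusion, with the sign `+` if and only if `x` lies in the `SL₂(F)`-orbit of `x₊`. The maps `g_x`
are given by the action of `g` on `V`; accordingly `g_η` is given by the action of `g` if `g`
preserves the `SL₂(F)`-orbits of vertices, and by its negative if `g` exchanges the two orbits. -/
def FhatObj {e : ℕ} (xp : Vertex F) (V : Rep.{max u w} Λ (hatG F e)) : GSystem.{u, v, w} F Λ where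
  V x := ModuleCat.of Λ (vertexSum.{u, v, w} V x)
  E η := ModuleCat.of Λ (edgeInv.{u, v, w} V η)
  r _ x hx := vertexSign xp x • Submodule.inclusion (edgeInv_le_vertexSum.{u, v, w} V hx)
  actV g _ _ h := (V.ρ (toHatG F e g)).restrict (vertexSum_act V g h)
  actE g _ _ h := vertexSign xp (toAut g xp) •
    (V.ρ (toHatG F e g)).restrict (fun _ hv => edgeInv_act V g h hv)

/-- The inclusion of `𝓕̂_V^{(e)}(x)` into `V`. -/
def FhatInclV {e : ℕ} (xp : Vertex F) (V : Rep.{max u w} Λ (hatG F e)) (x : Vertex F) :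
    (FhatObj.{u, v, w} xp V).V x →ₗ[Λ] V.V := (vertexSum.{u, v, w} V x).subtype

/-- The inclusion of `𝓕̂_V^{(e)}(η)` into `V`. -/
def FhatInclE {e : ℕ} (xp : Vertex F) (V : Rep.{max u w} Λ (hatG F e)) (η : Edge F) :
    (FhatObj.{u, v, w} xp V).E η →ₗ[Λ] V.V := (edgeInv.{u, v, w} V η).subtype

theorem edgeInv_map {e : ℕ} {V W : Rep.{max u w} Λ (hatG F e)} (φ : V ⟶ W) (η : Edge F) :
    edgeInv.{u, v, w} V η ≤ (edgeInv.{u, v, w} W η).comap φ.hom.toLinearMap := by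
  intro v hv u hu
  have h1 := Rep.hom_comm_apply φ u v
  rw [hv u hu] at h1
  exact h1.symm

theorem vertexSum_map {e : ℕ} {V W : Rep.{max u w} Λ (hatG F e)} (φ : V ⟶ W) (x : Vertex F) :
    vertexSum.{u, v, w} V x ≤ (vertexSum.{u, v, w} W x).comap φ.hom.toLinearMap := by
  refine iSup₂_le fun η hη v hv => ?_
  exact edgeInv_le_vertexSum W hη (edgeInv_map φ η hv)

variable (F Λ) in
/-- The functor `V ↦ 𝓕̂_V^{(e)}`; on morphisms it is given by restriction. -/
def Fhat (e : ℕ) (xp : Vertex F) : Rep.{max u w} Λ (hatG F e) ⥤ GSystem.{u, v, w} F Λ where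
  obj V := FhatObj xp V
  map {V W} φ :=
    { onV := fun x => φ.hom.toLinearMap.restrict (vertexSum_map φ x)
      onE := fun η => φ.hom.toLinearMap.restrict (edgeInv_map φ η)
      comm_r := fun η x hx f => by
        apply Subtype.ext
        change φ.hom.toLinearMap (vertexSign xp x • f.1) = vertexSign xp x • φ.hom.toLinearMap f.1
        rw [map_zsmul]
      comm_actV := fun g x y h f => by
        apply Subtype.ext
        exact Rep.hom_comm_apply φ _ _
      comm_actE := fun g η θ h f => by
        apply Subtype.ext
        change φ.hom.toLinearMap (vertexSign xp (toAut g xp) • V.ρ (toHatG F e g) f.1) =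
          vertexSign xp (toAut g xp) • W.ρ (toHatG F e g) (φ.hom.toLinearMap f.1)
        rw [map_zsmul]
        congr 1
        exact Rep.hom_comm_apply φ _ _ }
  map_id V := rfl
  map_comp φ ψ := rfl

end Fhat

/-! ### The two functors between `ℭ_0^{(e)}(Λ)` and `ℜ̂_0^{(e)}(Λ)` -/

section Functors

variable {F : Type u} [Field F] [ValuativeRel F] [TopologicalSpace F]
  [IsNonarchimedeanLocalField F]
variable {Λ : Type v} [CommRing Λ] {e : ℕ} [NeZero e]

/-- The functor `𝓕 ↦ H_0(X, 𝓕)` from `ℭ_0^{(e)}(Λ)` to `ℜ̂_0^{(e)}(Λ)`, given that it takes values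
in `ℜ̂_0^{(e)}(Λ)`. -/
abbrev H0toR0 {σ : Edge F} (hH : ∀ S : C0.{u, v, w} F Λ e,
    isR0.{u, v, w} F Λ e σ ((H0functor.{u, v, w} F Λ e).obj S)) :
    C0.{u, v, w} F Λ e ⥤ R0.{u, v, w} F Λ e σ :=
  (isR0.{u, v, w} F Λ e σ).lift (H0functor.{u, v, w} F Λ e) hH

/-- The functor `V ↦ 𝓕̂_V^{(e)}` from `ℜ̂_0^{(e)}(Λ)` to `ℭ_0^{(e)}(Λ)`, given that it takes values
in `ℭ_0^{(e)}(Λ)`. -/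
abbrev FhatToC0 {σ : Edge F} (xp : Vertex F) (hF : ∀ V : R0.{u, v, w} F Λ e σ,
    isC0.{u, v, w} F Λ e ((Fhat.{u, v, w} F Λ e xp).obj V.obj)) :
    R0.{u, v, w} F Λ e σ ⥤ C0.{u, v, w} F Λ e :=
  (isC0.{u, v, w} F Λ e).lift ((isR0.{u, v, w} F Λ e σ).ι ⋙ Fhat.{u, v, w} F Λ e xp) hF

/-- The morphism `φ : 𝓕 → 𝓕̂_{H_0(X, 𝓕)}` is the natural one: on `𝓕(x)` it is the natural map
`𝓕(x) → H_0(X, 𝓕)`, and on `𝓕(η)` it is the composite `𝓕(η) → 𝓕(x) → H_0(X, 𝓕)` for the vertex `x`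
of `η` in the `SL₂(F)`-orbit of `x₊`. -/
def IsNaturalUnit (xp : Vertex F) (S : C0.{u, v, w} F Λ e)
    (φ : S.obj ⟶ (Fhat.{u, v, w} F Λ e xp).obj ((H0functor.{u, v, w} F Λ e).obj S)) : Prop :=
  (∀ (x : Vertex F) (f : S.obj.V x),
    FhatInclV xp ((H0functor.{u, v, w} F Λ e).obj S) x (φ.onV x f) = S.obj.toH0 x f) ∧
  ∀ (η : Edge F) (x : Vertex F) (hx : x ∈ η.1), InSLOrbit xp x → ∀ f : S.obj.E η,
    FhatInclE xp ((H0functor.{u, v, w} F Λ e).obj S) η (φ.onE η f) =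
      S.obj.toH0 x (S.obj.r η x hx f)

/-- The morphism `ψ : H_0(X, 𝓕̂_V) → V` is the natural one: its composite with the natural map
`𝓕̂_V(x) → H_0(X, 𝓕̂_V)` is the inclusion `𝓕̂_V(x) ⊆ V`, for all vertices `x`. -/
def IsNaturalCounit (xp : Vertex F) (V : Rep.{max u w} Λ (hatG F e))
    (hV : isC0.{u, v, w} F Λ e ((Fhat.{u, v, w} F Λ e xp).obj V))
    (ψ : (H0functor.{u, v, w} F Λ e).obj ⟨(Fhat.{u, v, w} F Λ e xp).obj V, hV⟩ ⟶ V) : Prop :=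
  ∀ (x : Vertex F) (f : (FhatObj.{u, v, w} xp V).V x),
    ψ.hom ((FhatObj.{u, v, w} xp V).toH0 x f) = FhatInclV xp V x f

end Functors

end BruhatTits

end

/-! The group `Ĝ^{(e)}` contains automorphisms that `G` lacks: if `u ∈ G` fixes `Z^{(e)}(y)`
pointwise and `{y, z}` is an edge, then the automorphism equal to `u` on the half tree beyond `z`
and to the identity elsewhere lies in `Ĝ^{(e)}` (`exists_cutoff`). Such automorphisms act on one
outer term of a chain at a time.

Unit. The map `𝓕(x) → H_0(X, 𝓕)` is injective because the transition maps are injective and the tree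
has no circuits (`CoeffSystem.toH0_injective`). Conversely, let `v ∈ H_0` be fixed by all
automorphisms in `Ĝ^{(e)}` that fix `Z^{(e)}(x)`, and let it be represented by a chain on
`Z^{(n+1)}(x)`. Let `z` be a vertex at distance `n + 1` from `x`, and `y` its neighbour towards `x`.
The action of `U_y^{(e)}` on `Z^{(e)}(z)` is realised by matrices that fix both `Z^{(e)}(y)` and
`Z^{(e)}(x)` (`exists_mem_ballStab_inf`). Cut off at `{y, z}`, they fix `v` and every term of the
chain except possibly the one at `z`. So this term is `U_y^{(e)}`-invariant, hence comes from `𝓕({y,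
z})` and can be moved to `y`. By descent on `n`, `v` comes from `𝓕(x)`
(`exists_toH0_eq_of_invariant`). It follows that the `Û_η^{(e)}`-invariants of `H_0` are `𝓕(η)`, and
that their sum over the edges at `x` is `𝓕(x)` (`mem_edgeInv_H0_iff`, `vertexSum_H0`).

This uses that an element of `Ĝ^{(e)}` fixing `Z^{(e)}(x)` lies in `Û_η^{(e)}` for every edge `η` at
`x` (`mem_hatU_of_mem_ballStab`). The same fact shows that `Ĝ^{(e)}` acts on `𝓕̂_V(x)` through
restrictions to `Z^{(e)}(x)`, which yields the axioms for `𝓕̂_V` (`isC0_Fhat`).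

Counit. It is surjective because `V` is generated by its `Û_σ^{(e)}`-invariants. For injectivity,
`p` is nilpotent in `Λ` and `Û_σ^{(e)}` acts on finite balls through `p`-groups, so a nonzero kernel
would contain a nonzero `Û_σ^{(e)}`-invariant (`exists_invariant`). But the invariants of `H_0(X,
𝓕̂_V)` are `𝓕̂_V(σ)`, and this embeds into `V`. -/

noncomputable section

namespace BruhatTits

/-! ### Diagonal, unipotent and Weyl matrices. -/

section Matrices

variable {F : Type u} [Field F]

/-- Diagonal matrices. -/
def dg (a d : Fˣ) : GL (Fin 2) F where
  val := !![(a : F), 0; 0, (d : F)]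
  inv := !![((a⁻¹ : Fˣ) : F), 0; 0, ((d⁻¹ : Fˣ) : F)]
  val_inv := by ext i j; fin_cases i <;> fin_cases j <;> simp
  inv_val := by ext i j; fin_cases i <;> fin_cases j <;> simp

/-- Upper triangular unipotent matrices. -/
def up (c : F) : GL (Fin 2) F where
  val := !![1, c; 0, 1]
  inv := !![1, -c; 0, 1]
  val_inv := by ext i j; fin_cases i <;> fin_cases j <;> simp
  inv_val := by ext i j; fin_cases i <;> fin_cases j <;> simp

variable (F) in
/-- The Weyl element. -/
def weyl : GL (Fin 2) F where
  val := !![0, 1; 1, 0]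
  inv := !![0, 1; 1, 0]
  val_inv := by ext i j; fin_cases i <;> fin_cases j <;> simp
  inv_val := by ext i j; fin_cases i <;> fin_cases j <;> simp

theorem coe_dg (a d : Fˣ) : ((dg a d : GL (Fin 2) F) : Matrix _ _ F) = !![(a : F), 0; 0, (d : F)] :=
  rfl

theorem coe_up (c : F) : ((up c : GL (Fin 2) F) : Matrix _ _ F) = !![1, c; 0, 1] := rfl

theorem coe_weyl : ((weyl F : GL (Fin 2) F) : Matrix _ _ F) = !![0, 1; 1, 0] := rfl

theorem coe_sc (c : Fˣ) : ((sc c : GL (Fin 2) F) : Matrix _ _ F) = !![(c : F), 0; 0, (c : F)] := by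
  ext i j; fin_cases i <;> fin_cases j <;> simp [sc, Matrix.GeneralLinearGroup.scalar]

theorem dg_mul (a d a' d' : Fˣ) : dg a d * dg a' d' = dg (a * a') (d * d') := by
  ext i j; fin_cases i <;> fin_cases j <;> simp [coe_dg]

theorem dg_one : dg (1 : Fˣ) 1 = 1 := by
  ext i j; fin_cases i <;> fin_cases j <;> simp [coe_dg]

theorem dg_inv (a d : Fˣ) : (dg a d)⁻¹ = dg a⁻¹ d⁻¹ := by
  rw [inv_eq_iff_mul_eq_one, dg_mul, mul_inv_cancel, mul_inv_cancel, dg_one]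

theorem dg_zpow (a d : Fˣ) (n : ℤ) : dg a d ^ n = dg (a ^ n) (d ^ n) := by
  let f : Fˣ × Fˣ →* GL (Fin 2) F :=
    { toFun := fun x => dg x.1 x.2
      map_one' := dg_one
      map_mul' := fun x y => (dg_mul _ _ _ _).symm }
  exact (map_zpow f (a, d) n).symm

theorem sc_eq_dg (c : Fˣ) : sc c = dg c c := by
  apply Units.ext
  rw [coe_sc, coe_dg]

theorem dg_mul_up (a d : Fˣ) (c : F) : dg a d * up c = up (a * c * (d⁻¹ : Fˣ)) * dg a d := by
  ext i j; fin_cases i <;> fin_cases j <;> simp [coe_dg, coe_up]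

theorem up_mul (b c : F) : up b * up c = up (b + c) := by
  ext i j; fin_cases i <;> fin_cases j <;> simp [coe_up, add_comm]

theorem up_zero : up (0 : F) = 1 := by
  ext i j; fin_cases i <;> fin_cases j <;> simp [coe_up]

theorem up_inv (c : F) : (up c)⁻¹ = up (-c) := by
  rw [inv_eq_iff_mul_eq_one, up_mul, add_neg_cancel, up_zero]

end Matrices

/-! ### The standard lattice and its stabilizer. -/

section StdLattice

open ValuativeRel

variable {F : Type u} [Field F] [ValuativeRel F]

theorem mem_integers_iff {a : F} : a ∈ 𝒪[F] ↔ valuation F a ≤ 1 := Valuation.mem_integer_iff _ _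

variable (F) in
/-- The lattice `𝒪_F²`. -/
def stdLat : Lat F where
  toSub :=
    { carrier := {v | ∀ i, v i ∈ 𝒪[F]}
      add_mem' := fun hv hw i => add_mem (hv i) (hw i)
      zero_mem' := fun _ => zero_mem _
      smul_mem' := fun a v hv i => mul_mem a.2 (hv i) }
  isLattice := by
    have key : ({ carrier := {v | ∀ i, v i ∈ 𝒪[F]}
                  add_mem' := fun hv hw i => add_mem (hv i) (hw i)
                  zero_mem' := fun _ => zero_mem _
                  smul_mem' := fun a v hv i => mul_mem a.2 (hv i) } :
        Submodule 𝒪[F] (Fin 2 → F)) = Submodule.span 𝒪[F] {![1, 0], ![0, 1]} := by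
      ext v
      rw [Submodule.mem_span_pair]
      constructor
      · intro hv
        refine ⟨⟨v 0, hv 0⟩, ⟨v 1, hv 1⟩, ?_⟩
        ext i
        fin_cases i
        · change v 0 * 1 + v 1 * 0 = v 0
          ring
        · change v 0 * 0 + v 1 * 1 = v 1
          ring
      · rintro ⟨a, b, rfl⟩ i
        fin_cases i
        · change (a : F) * 1 + b * 0 ∈ 𝒪[F]
          rw [mul_one, mul_zero, add_zero]
          exact a.2
        · change (a : F) * 0 + b * 1 ∈ 𝒪[F]
          rw [mul_one, mul_zero, zero_add]
          exact b.2
    refine ⟨?_, ?_⟩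
    · rw [key]
      exact Submodule.fg_span (by simp)
    · rw [eq_top_iff]
      intro v _
      have h1 : v = v 0 • ![1, 0] + v 1 • ![0, 1] := by
        ext i
        fin_cases i <;> simp
      rw [h1]
      refine add_mem (Submodule.smul_mem _ _ (Submodule.subset_span ?_))
        (Submodule.smul_mem _ _ (Submodule.subset_span ?_))
      · intro i
        fin_cases i
        · exact one_mem _
        · exact zero_mem _
      · intro i
        fin_cases i
        · exact zero_mem _
        · exact one_mem _

theorem mem_stdLat {v : Fin 2 → F} : v ∈ (stdLat F).toSub ↔ ∀ i, v i ∈ 𝒪[F] := Iff.rfl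

variable (F) in
/-- The vertex represented by `𝒪_F²`. -/
def stdVertex : Vertex F := (stdLat F).cls

/-- Every lattice is the image of `𝒪_F²` under some `g ∈ GL₂(F)`. -/
theorem exists_act_stdLat [IsDomain 𝒪[F]] [IsPrincipalIdealRing 𝒪[F]] (L : Lat F) :
    ∃ g : GL (Fin 2) F, (stdLat F).act g = L := by
  have := L.isLattice
  have h1 : Module.finrank 𝒪[F] L.toSub = 2 := by
    rw [Submodule.IsLattice.finrank_of_pi (K := F)]
    simp
  let b : Module.Basis (Fin 2) 𝒪[F] L.toSub := Module.finBasisOfFinrankEq _ _ h1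
  let B : Module.Basis (Fin 2) F (Fin 2 → F) := b.extendOfIsLattice F
  have hB : ∀ i, B i = b i := fun i => Module.Basis.extendOfIsLattice_apply _ _ _
  -- The columns of `M` form an `𝒪_F`-basis of `L`, which is at the same time an `F`-basis of `F²`;
  -- `M` is the matrix sought.
  let M : Matrix (Fin 2) (Fin 2) F := Matrix.of fun i j => B j i
  have hM : ∀ w : Fin 2 → F, M *ᵥ w = w 0 • B 0 + w 1 • B 1 := by
    intro w
    ext i
    simp [M, Matrix.mulVec, dotProduct, Fin.sum_univ_two, mul_comm]
  have hMu : IsUnit M := by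
    have h2 := Module.Basis.isUnit_det (Pi.basisFun F (Fin 2)) B
    rw [Module.Basis.det_apply] at h2
    rw [Matrix.isUnit_iff_isUnit_det]
    convert h2 using 2
    ext i j
    simp [M, Module.Basis.toMatrix_apply]
  obtain ⟨g, hg⟩ := hMu
  refine ⟨g, Lat.ext' ?_⟩
  have hg' : ∀ w : Fin 2 → F, glMap g w = w 0 • B 0 + w 1 • B 1 := fun w => by
    rw [glMap_apply, hg, hM]
  ext v
  constructor
  · rintro ⟨w, hw, rfl⟩
    rw [hg', hB, hB]
    exact add_mem (coe_mem_smul (hw 0) (b 0).2) (coe_mem_smul (hw 1) (b 1).2)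
  · intro hv
    refine ⟨fun i => (b.repr ⟨v, hv⟩ i : F), fun i => (b.repr ⟨v, hv⟩ i).2, ?_⟩
    rw [hg', hB, hB]
    have h3 := congrArg Subtype.val (b.sum_repr ⟨v, hv⟩)
    rw [Fin.sum_univ_two] at h3
    exact h3

variable (F) in
/-- `GL₂(𝒪_F)`, as the stabilizer of `𝒪_F²`. -/
def intGL : Subgroup (GL (Fin 2) F) where
  carrier := {g | (stdLat F).act g = stdLat F}
  one_mem' := Lat.act_one _
  mul_mem' {g h} hg hh := by
    change (stdLat F).act _ = _
    rw [Lat.act_mul, hh, hg]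
  inv_mem' {g} hg := by
    change (stdLat F).act _ = _
    conv_lhs => rw [← show (stdLat F).act g = stdLat F from hg]
    rw [← Lat.act_mul, inv_mul_cancel, Lat.act_one]

theorem glMap_mem_stdLat {g : GL (Fin 2) F} (hg : ∀ i j, (g : Matrix (Fin 2) (Fin 2) F) i j ∈ 𝒪[F])
    {v : Fin 2 → F} (hv : v ∈ (stdLat F).toSub) : glMap g v ∈ (stdLat F).toSub := by
  intro i
  rw [glMap_apply, Matrix.mulVec, dotProduct]
  exact sum_mem fun j _ => mul_mem (hg i j) (hv j)

theorem entry_mem_of_act_le {g : GL (Fin 2) F}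
    (h : ∀ v ∈ (stdLat F).toSub, glMap g v ∈ (stdLat F).toSub) (i j : Fin 2) :
    (g : Matrix (Fin 2) (Fin 2) F) i j ∈ 𝒪[F] := by
  have h1 := h (Pi.single j 1) (fun i => by
    rw [Pi.single_apply]
    split_ifs
    · exact one_mem _
    · exact zero_mem _) i
  rwa [glMap_apply, Matrix.mulVec_single_one] at h1

/-- If `g` and `g⁻¹` are both integral, their determinants have valuations at most `1` with product
`1`. Conversely `g⁻¹` is the adjugate divided by a unit. -/
theorem mem_intGL_iff {g : GL (Fin 2) F} : g ∈ intGL F ↔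
    (∀ i j, (g : Matrix (Fin 2) (Fin 2) F) i j ∈ 𝒪[F]) ∧
      valuation F (g : Matrix (Fin 2) (Fin 2) F).det = 1 := by
  have hdet : ∀ h : GL (Fin 2) F, (∀ i j, (h : Matrix (Fin 2) (Fin 2) F) i j ∈ 𝒪[F]) →
      valuation F (h : Matrix (Fin 2) (Fin 2) F).det ≤ 1 := by
    intro h hh
    rw [← mem_integers_iff, Matrix.det_fin_two]
    exact sub_mem (mul_mem (hh _ _) (hh _ _)) (mul_mem (hh _ _) (hh _ _))
  constructor
  · intro hg
    have h1 : ∀ k ∈ intGL F, ∀ i j, (k : Matrix (Fin 2) (Fin 2) F) i j ∈ 𝒪[F] := by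
      intro k hk
      apply entry_mem_of_act_le
      intro v hv
      have : glMap k v ∈ ((stdLat F).act k).toSub := ⟨v, hv, rfl⟩
      rwa [show (stdLat F).act k = stdLat F from hk] at this
    refine ⟨h1 g hg, le_antisymm (hdet g (h1 g hg)) ?_⟩
    have h2 := hdet g⁻¹ (h1 _ (inv_mem hg))
    have h3 : (g : Matrix (Fin 2) (Fin 2) F).det * ((g⁻¹ : GL (Fin 2) F) : Matrix (Fin 2) (Fin 2) F).det = 1 := by
      rw [← Matrix.det_mul, ← Units.val_mul, mul_inv_cancel, Units.val_one, Matrix.det_one]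
    have h4 := congrArg (valuation F) h3
    rw [map_mul, map_one] at h4
    by_contra h5
    rw [not_le] at h5
    have h6 := mul_lt_mul'' h5 (h2.lt_or_eq.elim id fun h => by
      exfalso
      rw [h, mul_one] at h4
      exact h5.ne h4) zero_le zero_le
    rw [h4, one_mul] at h6
    exact lt_irrefl _ h6
  · rintro ⟨h1, h2⟩
    apply Lat.ext'
    apply le_antisymm
    · rintro _ ⟨v, hv, rfl⟩
      exact glMap_mem_stdLat h1 hv
    · intro v hv
      rw [Lat.mem_act]
      have hdi : ((g : Matrix (Fin 2) (Fin 2) F).det)⁻¹ ∈ 𝒪[F] := by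
        rw [mem_integers_iff, map_inv₀, h2, inv_one]
      refine glMap_mem_stdLat (fun i j => ?_) hv
      rw [Matrix.coe_units_inv, Matrix.inv_def, Matrix.smul_apply, Ring.inverse_eq_inv',
        smul_eq_mul]
      refine mul_mem hdi ?_
      rw [Matrix.adjugate_fin_two]
      fin_cases i <;> fin_cases j
      · exact h1 _ _
      · exact neg_mem (h1 _ _)
      · exact neg_mem (h1 _ _)
      · exact h1 _ _

/-- An element that preserves the homothety class multiplies the lattice by some scalar, and
dividing by that scalar leaves an element of `intGL F`. -/
theorem toAut_stdVertex {g : GL (Fin 2) F} :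
    toAut g (stdVertex F) = stdVertex F ↔ ∃ c : Fˣ, ∃ k ∈ intGL F, g = sc c * k := by
  constructor
  · intro h
    obtain ⟨c, hc⟩ := Lat.cls_eq.1 h
    refine ⟨c⁻¹, sc c * g, ?_, ?_⟩
    · apply Lat.ext'
      rw [hc]
      ext v
      rw [Lat.mem_act, mem_usmul, Lat.mem_act, mul_inv_rev, glMap_mul, ← map_inv, glMap_sc]
    · rw [← mul_assoc, ← map_mul, inv_mul_cancel, map_one, one_mul]
  · rintro ⟨c, k, hk, rfl⟩
    rw [map_mul, RelIso.mul_apply, toAut_sc]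
    exact congrArg Lat.cls hk

theorem up_mem_intGL {c : F} (hc : c ∈ 𝒪[F]) : up c ∈ intGL F := by
  rw [mem_intGL_iff]
  refine ⟨fun i j => ?_, by simp [coe_up]⟩
  fin_cases i <;> fin_cases j <;> simp [coe_up, hc, one_mem, zero_mem]

theorem weyl_mem_intGL : weyl F ∈ intGL F := by
  rw [mem_intGL_iff]
  refine ⟨fun i j => ?_, by simp [coe_weyl, Valuation.map_neg]⟩
  fin_cases i <;> fin_cases j <;> simp [coe_weyl, one_mem, zero_mem]

theorem dg_mem_intGL {a d : Fˣ} (ha : valuation F a = 1) (hd : valuation F d = 1) :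
    dg a d ∈ intGL F := by
  rw [mem_intGL_iff]
  refine ⟨fun i j => ?_, by simp [coe_dg, ha, hd]⟩
  fin_cases i <;> fin_cases j <;> simp [coe_dg, mem_integers_iff, ha, hd]

theorem toAut_intGL {k : GL (Fin 2) F} (hk : k ∈ intGL F) :
    toAut k (stdVertex F) = stdVertex F := congrArg Lat.cls hk

theorem exists_toAut_stdVertex [IsDomain 𝒪[F]] [IsPrincipalIdealRing 𝒪[F]] (x : Vertex F) :
    ∃ g : GL (Fin 2) F, toAut g (stdVertex F) = x := by
  obtain ⟨L, rfl⟩ := Lat.exists_cls x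
  obtain ⟨g, rfl⟩ := exists_act_stdLat L
  exact ⟨g, rfl⟩

end StdLattice

section Action

variable {F : Type u} [Field F] [ValuativeRel F]

theorem toAut_mul_apply (g h : GL (Fin 2) F) (x : Vertex F) :
    toAut (g * h) x = toAut g (toAut h x) := by rw [map_mul]; rfl

theorem toAut_inv_apply_self (g : GL (Fin 2) F) (x : Vertex F) :
    toAut g⁻¹ (toAut g x) = x := by rw [← toAut_mul_apply, inv_mul_cancel, map_one]; rfl

theorem toAut_apply_inv_self (g : GL (Fin 2) F) (x : Vertex F) :
    toAut g (toAut g⁻¹ x) = x := by rw [← toAut_mul_apply, mul_inv_cancel, map_one]; rfl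

theorem adj_toAut_iff (g : GL (Fin 2) F) {x y : Vertex F} :
    (tree F).Adj (toAut g x) (toAut g y) ↔ (tree F).Adj x y := (toAut g).map_rel_iff

end Action

/-! ### Neighbours of a vertex, and walks without backtracking. -/

section Neighbours

open ValuativeRel

variable {F : Type u} [Field F] [ValuativeRel F] [TopologicalSpace F]
  [IsNonarchimedeanLocalField F]

-- All four properties are stated for one and the same element, so that `unif` can be chosen once
-- and for all.
variable (F) in
theorem exists_unif : ∃ ϖ : Fˣ, valuation F ϖ < 1 ∧
    (∀ a : F, valuation F a < 1 → valuation F a ≤ valuation F ϖ) ∧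
    (∀ L : Submodule 𝒪[F] (Fin 2 → F), 𝓂[F] • L = ϖ • L) ∧
    ∀ c : Fˣ, ∃ n : ℤ, valuation F c = valuation F ϖ ^ n := by
  obtain ⟨p, hp⟩ := IsDiscreteValuationRing.exists_irreducible 𝒪[F]
  have hp0 : (p : F) ≠ 0 := fun h => hp.ne_zero (Subtype.ext h)
  have hunit : ∀ a : 𝒪[F], IsUnit a ↔ valuation F (a : F) = 1 := fun a =>
    (Valuation.integer.integers (valuation F)).isUnit_iff_valuation_eq_one
  have hint : ∀ a : 𝒪[F], a ≠ 0 → ∃ n : ℕ, valuation F (a : F) = valuation F (p : F) ^ n := by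
    intro a ha
    obtain ⟨n, u, hu⟩ := IsDiscreteValuationRing.eq_unit_mul_pow_irreducible ha hp
    refine ⟨n, ?_⟩
    rw [hu]
    push_cast
    rw [map_mul, map_pow, (hunit _).1 u.isUnit, one_mul]
  refine ⟨Units.mk0 (p : F) hp0, ?_, ?_, fun L => ?_, fun c => ?_⟩
  · exact lt_of_le_of_ne (mem_integers_iff.1 p.2) fun h => hp.not_isUnit ((hunit p).2 h)
  · intro a ha
    have ha1 : a ∈ 𝒪[F] := mem_integers_iff.2 ha.le
    have h2 : (⟨a, ha1⟩ : 𝒪[F]) ∈ 𝓂[F] := by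
      rw [IsLocalRing.mem_maximalIdeal, mem_nonunits_iff, hunit]
      exact ha.ne
    rw [hp.maximalIdeal_eq, Ideal.mem_span_singleton] at h2
    obtain ⟨b, hb⟩ := h2
    have hb' : a = (p : F) * b := congrArg Subtype.val hb
    rw [hb', map_mul]
    exact mul_le_of_le_one_right' (mem_integers_iff.1 b.2)
  · rw [hp.maximalIdeal_eq, Submodule.ideal_span_singleton_smul]
    rfl
  · rcases le_total (valuation F (c : F)) 1 with h | h
    · obtain ⟨n, hn⟩ := hint ⟨c, mem_integers_iff.2 h⟩ (fun h => c.ne_zero (congrArg Subtype.val h))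
      exact ⟨n, by rw [zpow_natCast]; exact hn⟩
    · have h' : ((c : F)⁻¹) ∈ 𝒪[F] := by
        rw [mem_integers_iff, map_inv₀]
        exact inv_le_one_of_one_le₀ h
      obtain ⟨n, hn⟩ := hint ⟨_, h'⟩ (fun h => inv_ne_zero c.ne_zero (congrArg Subtype.val h))
      refine ⟨-n, ?_⟩
      rw [zpow_neg, zpow_natCast]
      change _ = (valuation F (p : F) ^ n)⁻¹
      rw [← hn, map_inv₀, inv_inv]

variable (F) in
/-- A uniformizer. -/
def unif : Fˣ := (exists_unif F).choose

theorem unif_lt_one : valuation F (unif F) < 1 := (exists_unif F).choose_spec.1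

theorem le_unif {a : F} (ha : valuation F a < 1) : valuation F a ≤ valuation F (unif F) :=
  (exists_unif F).choose_spec.2.1 a ha

theorem maximalIdeal_smul (L : Submodule 𝒪[F] (Fin 2 → F)) : 𝓂[F] • L = unif F • L :=
  (exists_unif F).choose_spec.2.2.1 L

theorem exists_zpow_unif (c : Fˣ) : ∃ n : ℤ, valuation F c = valuation F (unif F) ^ n :=
  (exists_unif F).choose_spec.2.2.2 c

theorem unif_pos : 0 < valuation F (unif F : F) :=
  zero_lt_iff.2 ((valuation F).ne_zero_iff.2 (unif F).ne_zero)

theorem unif_mem : (unif F : F) ∈ 𝒪[F] := mem_integers_iff.2 unif_lt_one.le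

theorem div_unif_mem {a : F} (ha : valuation F a < 1) : ((unif F)⁻¹ : Fˣ) * a ∈ 𝒪[F] := by
  rw [mem_integers_iff, map_mul, Units.val_inv_eq_inv_val, map_inv₀]
  exact inv_mul_le_one_of_le₀ (le_unif ha) zero_le

theorem zpow_unif_le_one_iff {n : ℤ} : valuation F (unif F : F) ^ n ≤ 1 ↔ 0 ≤ n := by
  rw [← zpow_zero (valuation F (unif F : F))]
  exact zpow_le_zpow_iff_right_of_lt_one₀ unif_pos unif_lt_one

theorem zpow_unif_injective {m n : ℤ}
    (h : valuation F (unif F : F) ^ m = valuation F (unif F : F) ^ n) : m = n :=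
  zpow_right_injective₀ unif_pos unif_lt_one.ne h

variable (F) in
/-- The matrix `diag(ϖ^n, 1)`. -/
def dz (n : ℤ) : GL (Fin 2) F := dg (unif F ^ n) 1

theorem dz_add (m n : ℤ) : dz F (m + n) = dz F m * dz F n := by
  rw [dz, dz, dz, dg_mul, zpow_add, one_mul]

theorem dz_zero : dz F 0 = 1 := by rw [dz, zpow_zero, dg_one]

theorem dz_neg (n : ℤ) : dz F (-n) = (dz F n)⁻¹ := by
  rw [dz, dz, dg_inv, zpow_neg, inv_one]

theorem dz_mul_up (n : ℤ) (c : F) : dz F n * up c = up ((unif F ^ n : Fˣ) * c) * dz F n := by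
  rw [dz, dg_mul_up, inv_one, Units.val_one, mul_one]

variable (F) in
/-- The vertices of the standard half-line. -/
def stdLine (n : ℤ) : Vertex F := toAut (dz F n) (stdVertex F)

theorem stdLine_zero : stdLine F 0 = stdVertex F := by rw [stdLine, dz_zero, map_one]; rfl

theorem toAut_dz_stdLine (m n : ℤ) : toAut (dz F m) (stdLine F n) = stdLine F (m + n) := by
  rw [stdLine, stdLine, dz_add, toAut_mul_apply]

theorem weyl_mul_dz_one : weyl F * dz F 1 = sc (unif F) * dz F (-1) * weyl F := by
  ext i j
  fin_cases i <;> fin_cases j <;> simp [dz, coe_dg, coe_weyl, Fin.sum_univ_two, Matrix.mul_apply]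

/-- The Weyl element reflects the standard apartment about the standard vertex, up to a scalar,
which acts trivially on the tree. -/
theorem toAut_weyl_stdLine_one : toAut (weyl F) (stdLine F 1) = stdLine F (-1) := by
  rw [stdLine, ← toAut_mul_apply, weyl_mul_dz_one, toAut_mul_apply, toAut_intGL weyl_mem_intGL,
    toAut_mul_apply, toAut_sc]
  rfl

/-- For integral `c` the image of this lattice in the residue plane is the line spanned by `(c, 1)`;
the lattice of `mem_weyl_dz` gives the remaining line, spanned by `(1, 0)`. -/
theorem mem_up_dz {c : F} {w : Fin 2 → F} : w ∈ ((stdLat F).act (up c * dz F 1)).toSub ↔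
    ((unif F)⁻¹ : Fˣ) * (w 0 - c * w 1) ∈ 𝒪[F] ∧ w 1 ∈ 𝒪[F] := by
  rw [Lat.mem_act, mul_inv_rev, up_inv, ← dz_neg, mem_stdLat, Fin.forall_fin_two, glMap_mul,
    glMap_apply, glMap_apply, coe_up, dz, coe_dg]
  simp [Matrix.mulVec, dotProduct, Fin.sum_univ_two, sub_eq_add_neg]

theorem mem_weyl_dz {w : Fin 2 → F} : w ∈ ((stdLat F).act (weyl F * dz F 1)).toSub ↔
    ((unif F)⁻¹ : Fˣ) * w 1 ∈ 𝒪[F] ∧ w 0 ∈ 𝒪[F] := by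
  have hw : (weyl F)⁻¹ = weyl F := by
    rw [inv_eq_iff_mul_eq_one]
    ext i j
    fin_cases i <;> fin_cases j <;> simp [coe_weyl]
  rw [Lat.mem_act, mul_inv_rev, hw, ← dz_neg, mem_stdLat, Fin.forall_fin_two, glMap_mul,
    glMap_apply, glMap_apply, coe_weyl, dz, coe_dg]
  simp [Matrix.mulVec, dotProduct, Fin.sum_univ_two]

theorem mem_smul_stdLat {w : Fin 2 → F} : w ∈ 𝓂[F] • (stdLat F).toSub ↔
    ∀ i, ((unif F)⁻¹ : Fˣ) * w i ∈ 𝒪[F] := by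
  rw [maximalIdeal_smul, mem_usmul, mem_stdLat]
  rfl

/-- The sublattices of index `q` of `𝒪_F²`. -/
theorem lattice_between_stdLat {M : Lat F} (h1 : 𝓂[F] • (stdLat F).toSub < M.toSub)
    (h2 : M.toSub < (stdLat F).toSub) :
    (stdLat F).act (weyl F * dz F 1) = M ∨
      ∃ c ∈ 𝒪[F], (stdLat F).act (up c * dz F 1) = M := by
  have hdiv : ∀ {a : F}, ((unif F)⁻¹ : Fˣ) * a ∈ 𝒪[F] → a ∈ 𝒪[F] := by
    intro a ha
    have := mul_mem unif_mem ha
    rwa [Units.mul_inv_cancel_left] at this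
  have hbig : ![1, 0] ∈ M.toSub → ![0, 1] ∈ M.toSub → False := by
    intro h3 h4
    refine h2.not_ge fun w hw => ?_
    have : w = w 0 • ![1, 0] + w 1 • ![0, 1] := by
      ext i
      fin_cases i <;> simp
    rw [this]
    exact add_mem (coe_mem_smul (hw 0) h3) (coe_mem_smul (hw 1) h4)
  -- The image of `M` in the residue plane is a line: either some vector can be scaled to `(c, 1)`,
  -- or all second coordinates lie in `𝔭_F`.
  by_cases hcase : ∃ v ∈ M.toSub, valuation F (v 1) = 1
  · right
    obtain ⟨v, hv, hv1⟩ := hcase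
    have hv0 : v 1 ≠ 0 := fun h => by simp [h] at hv1
    have hi : (v 1)⁻¹ ∈ 𝒪[F] := by rw [mem_integers_iff, map_inv₀, hv1, inv_one]
    have hc : ![(v 1)⁻¹ * v 0, 1] ∈ M.toSub := by
      have h3 : ![(v 1)⁻¹ * v 0, 1] = (v 1)⁻¹ • v := by
        ext i
        fin_cases i <;> simp [hv0]
      rw [h3]
      exact coe_mem_smul hi hv
    set c := (v 1)⁻¹ * v 0 with hcdef
    have hcO : c ∈ 𝒪[F] := h2.le hc 0
    refine ⟨c, hcO, Lat.ext' (le_antisymm (fun w hw => ?_) fun w hw => ?_)⟩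
    · rw [mem_up_dz] at hw
      have h3 : w = w 1 • ![c, 1] + ![w 0 - c * w 1, 0] := by
        ext i
        fin_cases i
        · simp
          ring
        · simp
      rw [h3]
      refine add_mem (coe_mem_smul hw.2 hc) (h1.le ?_)
      rw [mem_smul_stdLat, Fin.forall_fin_two]
      exact ⟨hw.1, by simp [zero_mem]⟩
    · have hwO := h2.le hw
      rw [mem_up_dz]
      refine ⟨div_unif_mem ?_, hwO 1⟩
      have h3 : w 0 - c * w 1 ∈ 𝒪[F] := sub_mem (hwO 0) (mul_mem hcO (hwO 1))
      -- Were this coordinate a unit, `M` would contain `![1, 0]`, then also `![0, 1]`, and so would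
      -- be all of `𝒪_F²`.
      refine lt_of_le_of_ne (mem_integers_iff.1 h3) fun h4 => ?_
      have h5 : w 0 - c * w 1 ≠ 0 := fun h => by simp [h] at h4
      have h6 : (w 0 - c * w 1)⁻¹ ∈ 𝒪[F] := by rw [mem_integers_iff, map_inv₀, h4, inv_one]
      have h7 : ![1, 0] ∈ M.toSub := by
        have h8 := coe_mem_smul h6 (sub_mem hw (coe_mem_smul (hwO 1) hc))
        convert h8 using 1
        ext i
        fin_cases i
        · change 1 = (w 0 - c * w 1)⁻¹ * (w 0 - w 1 * c)
          rw [mul_comm (w 1) c, inv_mul_cancel₀ h5]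
        · change 0 = (w 0 - c * w 1)⁻¹ * (w 1 - w 1 * 1)
          ring
      refine hbig h7 ?_
      have h8 := sub_mem hc (coe_mem_smul hcO h7)
      convert h8 using 1
      ext i
      fin_cases i <;> simp
  · left
    push Not at hcase
    have hlt : ∀ v ∈ M.toSub, valuation F (v 1) < 1 := fun v hv =>
      lt_of_le_of_ne (mem_integers_iff.1 (h2.le hv 1)) (hcase v hv)
    refine Lat.ext' (le_antisymm (fun w hw => ?_) fun w hw => ?_)
    · rw [mem_weyl_dz] at hw
      obtain ⟨v, hv, hv'⟩ := Set.exists_of_ssubset h1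
      have hv0 : valuation F (v 0) = 1 := by
        by_contra h3
        apply hv'
        have h4 : valuation F (v 0) < 1 :=
          lt_of_le_of_ne (mem_integers_iff.1 (h2.le hv 0)) h3
        change v ∈ 𝓂[F] • (stdLat F).toSub
        rw [mem_smul_stdLat, Fin.forall_fin_two]
        exact ⟨div_unif_mem h4, div_unif_mem (hlt v hv)⟩
      have hne : v 0 ≠ 0 := fun h => by simp [h] at hv0
      have hi : (v 0)⁻¹ ∈ 𝒪[F] := by rw [mem_integers_iff, map_inv₀, hv0, inv_one]
      have h5 : ∀ a : F, ((unif F)⁻¹ : Fˣ) * a ∈ 𝒪[F] → ![0, a] ∈ M.toSub := by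
        intro a ha
        apply h1.le
        rw [mem_smul_stdLat, Fin.forall_fin_two]
        exact ⟨by simp [zero_mem], ha⟩
      have h6 : w = (w 0 * (v 0)⁻¹) • (v - ![0, v 1]) + ![0, w 1] := by
        ext i
        fin_cases i
        · change w 0 = w 0 * (v 0)⁻¹ * (v 0 - 0) + 0
          rw [sub_zero, add_zero, inv_mul_cancel_right₀ hne]
        · change w 1 = w 0 * (v 0)⁻¹ * (v 1 - v 1) + w 1
          ring
      rw [h6]
      exact add_mem (coe_mem_smul (mul_mem hw.2 hi)
        (sub_mem hv (h5 _ (div_unif_mem (hlt v hv))))) (h5 _ hw.1)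
    · rw [mem_weyl_dz]
      exact ⟨div_unif_mem (hlt w hw), h2.le hw 0⟩

/-- The neighbours of the standard vertex. -/
theorem adj_stdVertex {y : Vertex F} (h : (tree F).Adj (stdVertex F) y) :
    y = stdLine F (-1) ∨ ∃ c ∈ 𝒪[F], y = toAut (up c) (stdLine F 1) := by
  obtain ⟨M, rfl, h1, h2⟩ := exists_lattices h
  rcases lattice_between_stdLat h1 h2 with h | ⟨c, hc, h⟩
  · left
    rw [← toAut_weyl_stdLine_one, stdLine, ← toAut_mul_apply, ← h]
    rfl
  · refine Or.inr ⟨c, hc, ?_⟩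
    rw [stdLine, ← toAut_mul_apply, ← h]
    rfl

theorem adj_stdVertex' {y : Vertex F} (h : (tree F).Adj (stdVertex F) y) :
    ∃ k ∈ intGL F, y = toAut k (stdLine F 1) := by
  rcases adj_stdVertex h with h | ⟨c, hc, h⟩
  · exact ⟨_, weyl_mem_intGL, by rw [h, toAut_weyl_stdLine_one]⟩
  · exact ⟨_, up_mem_intGL hc, h⟩

theorem stdVertex_adj_one : (tree F).Adj (stdVertex F) (stdLine F 1) := by
  have h0 : up (0 : F) * dz F 1 = dz F 1 := by rw [up_zero, one_mul]
  have hu : ((unif F)⁻¹ : Fˣ) * (1 : F) ∉ 𝒪[F] := by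
    rw [mul_one, mem_integers_iff, Units.val_inv_eq_inv_val, map_inv₀, not_le]
    exact (one_lt_inv₀ unif_pos).2 unif_lt_one
  have hint : ∀ {a : F}, ((unif F)⁻¹ : Fˣ) * a ∈ 𝒪[F] → a ∈ 𝒪[F] := by
    intro a ha
    have := mul_mem unif_mem ha
    rwa [Units.mul_inv_cancel_left] at this
  refine tree_adj_of_between (L := stdLat F) (M := (stdLat F).act (dz F 1)) ?_ ?_
  · refine lt_of_le_of_ne (fun w hw => ?_) fun h => ?_
    · rw [mem_smul_stdLat] at hw
      rw [← h0, mem_up_dz]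
      exact ⟨by simpa using hw 0, hint (hw 1)⟩
    · have h1 : ![0, 1] ∈ ((stdLat F).act (dz F 1)).toSub := by
        rw [← h0, mem_up_dz]
        simp [zero_mem, one_mem]
      rw [← h, mem_smul_stdLat] at h1
      exact hu (h1 1)
  · refine lt_of_le_of_ne (fun w hw => ?_) fun h => ?_
    · rw [← h0, mem_up_dz] at hw
      rw [mem_stdLat, Fin.forall_fin_two]
      exact ⟨hint (by simpa using hw.1), hw.2⟩
    · have h1 : ![1, 0] ∈ (stdLat F).toSub := by
        rw [mem_stdLat, Fin.forall_fin_two]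
        simp [zero_mem, one_mem]
      rw [← h, ← h0, mem_up_dz] at h1
      refine hu ?_
      simpa using h1.1

/-- Conjugation by `dz F n` turns `up c` into `up (ϖ ^ (-n) * c)`, which is integral under the
hypothesis. Thus a unipotent fixes a whole half-line of the standard apartment; this permits bending
the apartment beyond a point while keeping the part before it. -/
theorem toAut_up_stdLine {n : ℤ} {c : F} (hc : ((unif F ^ (-n) : Fˣ) : F) * c ∈ 𝒪[F]) :
    toAut (up c) (stdLine F n) = stdLine F n := by
  have h1 : up c * dz F n = dz F n * up (((unif F ^ (-n) : Fˣ) : F) * c) := by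
    rw [dz_mul_up, ← mul_assoc, ← Units.val_mul, ← zpow_add, add_neg_cancel, zpow_zero,
      Units.val_one, one_mul]
  rw [stdLine, ← toAut_mul_apply, h1, toAut_mul_apply, toAut_intGL (up_mem_intGL hc)]

/-- A walk without backtracking lies in an apartment. -/
theorem exists_adapted (n : ℕ) (v : ℕ → Vertex F) (h1 : ∀ i < n, (tree F).Adj (v i) (v (i + 1)))
    (h2 : ∀ i, i + 2 ≤ n → v i ≠ v (i + 2)) :
    ∃ g : GL (Fin 2) F, ∀ i ≤ n, v i = toAut g (stdLine F i) := by
  induction n with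
  | zero =>
    obtain ⟨g, hg⟩ := exists_toAut_stdVertex (v 0)
    refine ⟨g, fun i hi => ?_⟩
    obtain rfl : i = 0 := by omega
    rw [Nat.cast_zero, stdLine_zero, hg]
  | succ n ih =>
    obtain ⟨g, hg⟩ := ih (fun i hi => h1 i (by omega)) (fun i hi => h2 i (by omega))
    have h3 := h1 n (by omega)
    have h4 : (tree F).Adj (stdVertex F) (toAut (g * dz F n)⁻¹ (v (n + 1))) := by
      rw [← adj_toAut_iff (g * dz F n), toAut_apply_inv_self, toAut_mul_apply]
      rw [hg n le_rfl] at h3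
      exact h3
    have h5 : toAut (g * dz F n) (toAut (g * dz F n)⁻¹ (v (n + 1))) = v (n + 1) :=
      toAut_apply_inv_self _ _
    rcases Nat.eq_zero_or_pos n with rfl | hn
    -- For the first edge only the initial vertex has to stay in place, so every element of
    -- `GL₂(𝒪_F)` is available.
    · obtain ⟨k, hk, hk'⟩ := adj_stdVertex' h4
      rw [hk', Nat.cast_zero, dz_zero, mul_one] at h5
      refine ⟨g * k, fun i hi => ?_⟩
      obtain rfl | rfl : i = 0 ∨ i = 1 := by omega
      · rw [hg 0 le_rfl, toAut_mul_apply, Nat.cast_zero, stdLine_zero, toAut_intGL hk]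
      · rw [toAut_mul_apply]
        exact h5.symm
    -- Seen from vertex `n`, the neighbour `stdLine F (-1)` is the preceding vertex and would be
    -- backtracking. Any other neighbour is reached by an integral `up c`, whose conjugate by `dz F
    -- n` fixes the vertices `0, …, n` of the apartment.
    · rcases adj_stdVertex h4 with h6 | ⟨c, hc, h6⟩
      · exfalso
        rw [h6, toAut_mul_apply, toAut_dz_stdLine] at h5
        refine h2 (n - 1) (by omega) ?_
        rw [show n - 1 + 2 = n + 1 by omega, ← h5, hg (n - 1) (by omega), Nat.cast_sub hn]
        rfl
      · refine ⟨g * up ((unif F ^ (n : ℤ) : Fˣ) * c), fun i hi => ?_⟩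
        rcases Nat.lt_or_ge n i with h | h
        · obtain rfl : i = n + 1 := by omega
          rw [h6, toAut_mul_apply, ← toAut_mul_apply (dz F n), dz_mul_up, toAut_mul_apply,
            toAut_dz_stdLine] at h5
          rw [← h5, toAut_mul_apply]
          push_cast
          rfl
        · rw [hg i h, toAut_mul_apply, toAut_up_stdLine]
          rw [← mul_assoc, ← Units.val_mul, ← zpow_add]
          refine mul_mem ?_ hc
          rw [mem_integers_iff, Units.val_zpow_eq_zpow_val, map_zpow₀, zpow_unif_le_one_iff]
          omega

end Neighbours

/-! ### Connectedness of the tree. -/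

section Component

variable {F : Type u} [Field F] [ValuativeRel F]

variable (F) in
/-- The subgroup of `GL₂(F)` preserving the connected component of the standard vertex. -/
def componentStabilizer : Subgroup (GL (Fin 2) F) where
  carrier := {g | (tree F).Reachable (stdVertex F) (toAut g (stdVertex F))}
  one_mem' := by
    change (tree F).Reachable _ _
    rw [map_one]
    exact SimpleGraph.Reachable.refl _
  mul_mem' {g h} hg hh := by
    change (tree F).Reachable _ _
    rw [toAut_mul_apply]
    exact SimpleGraph.Reachable.trans hg (SimpleGraph.Reachable.map (toAut g).toHom hh)
  inv_mem' {g} hg := by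
    have := SimpleGraph.Reachable.map (toAut g⁻¹).toHom hg
    change (tree F).Reachable (toAut g⁻¹ _) (toAut g⁻¹ (toAut g _)) at this
    rw [toAut_inv_apply_self] at this
    exact this.symm

theorem intGL_le_componentStabilizer : intGL F ≤ componentStabilizer F := fun k hk => by
  change (tree F).Reachable _ _
  rw [toAut_intGL hk]

theorem dist_aut (g : AutTree F) (x y : Vertex F) :
    (tree F).dist (g x) (g y) = (tree F).dist x y := by
  refine congrArg ENat.toNat (le_antisymm (edist_aut_le g x y) ?_)
  have := edist_aut_le g⁻¹ (g x) (g y)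
  rwa [RelIso.inv_apply_self, RelIso.inv_apply_self] at this

end Component

/-! ### Distances, geodesics and the two types of vertices. -/

section Distance

open ValuativeRel

variable {F : Type u} [Field F] [ValuativeRel F] [TopologicalSpace F]
  [IsNonarchimedeanLocalField F]

theorem dz_mem_componentStabilizer (n : ℤ) : dz F n ∈ componentStabilizer F := by
  have h1 : dz F 1 ∈ componentStabilizer F := stdVertex_adj_one.reachable
  have h2 : dz F n = dz F 1 ^ n := by
    rw [dz, dz, dg_zpow, zpow_one, one_zpow]
  rw [h2]
  exact zpow_mem h1 n

theorem dg_mem_componentStabilizer (a d : Fˣ) : dg a d ∈ componentStabilizer F := by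
  obtain ⟨n, hn⟩ := exists_zpow_unif (a * d⁻¹)
  have h1 : dg a d = sc d * (dz F n * dg (unif F ^ (-n) * (a * d⁻¹)) 1) := by
    rw [sc_eq_dg, dz, dg_mul, dg_mul]
    congr 1
    · rw [← mul_assoc (unif F ^ n), ← zpow_add, add_neg_cancel, zpow_zero, one_mul,
        mul_comm, inv_mul_cancel_right]
    · rw [mul_one, mul_one]
  rw [h1]
  refine mul_mem ?_ (mul_mem (dz_mem_componentStabilizer n) (intGL_le_componentStabilizer
    (dg_mem_intGL ?_ (by simp))))
  · change (tree F).Reachable _ _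
    rw [toAut_sc]
  · rw [Units.val_mul, map_mul, hn, Units.val_zpow_eq_zpow_val, map_zpow₀, ← zpow_add₀ unif_pos.ne',
      neg_add_cancel, zpow_zero]

/-- Every unipotent is conjugate by a power of `dz F 1` to an integral one, and integral matrices
fix the standard vertex. -/
theorem up_mem_componentStabilizer (c : F) : up c ∈ componentStabilizer F := by
  by_cases hc : c = 0
  · rw [hc, up_zero]
    exact one_mem _
  obtain ⟨n, hn⟩ := exists_zpow_unif (Units.mk0 c hc)
  have h1 : up c = dz F n * up (((unif F ^ (-n) : Fˣ) : F) * c) * (dz F n)⁻¹ := by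
    rw [dz_mul_up, mul_inv_cancel_right, ← mul_assoc, ← Units.val_mul, ← zpow_add, add_neg_cancel,
      zpow_zero, Units.val_one, one_mul]
  rw [h1]
  refine mul_mem (mul_mem (dz_mem_componentStabilizer n) (intGL_le_componentStabilizer
    (up_mem_intGL ?_))) (inv_mem (dz_mem_componentStabilizer n))
  rw [Units.val_mk0] at hn
  rw [mem_integers_iff, map_mul, hn, Units.val_zpow_eq_zpow_val, map_zpow₀,
    ← zpow_add₀ unif_pos.ne', neg_add_cancel, zpow_zero]

-- `GL₂(F)` is generated by diagonal matrices and transvections. The lower triangular transvections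
-- are Weyl conjugates of the upper triangular ones.
variable (F) in
theorem componentStabilizer_eq_top : componentStabilizer F = ⊤ := by
  rw [eq_top_iff]
  rintro g -
  have key : ∃ h ∈ componentStabilizer F, (h : Matrix (Fin 2) (Fin 2) F) = g := by
    refine Matrix.diagonal_transvection_induction_of_det_ne_zero
      (fun M => ∃ h ∈ componentStabilizer F, (h : Matrix (Fin 2) (Fin 2) F) = M) g.1 ?_ ?_ ?_ ?_
    · exact Matrix.GeneralLinearGroup.det_ne_zero g
    · intro D hD
      rw [Matrix.det_diagonal, Fin.prod_univ_two, mul_ne_zero_iff] at hD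
      refine ⟨_, dg_mem_componentStabilizer (Units.mk0 _ hD.1) (Units.mk0 _ hD.2), ?_⟩
      ext i j
      fin_cases i <;> fin_cases j <;> simp [coe_dg]
    · rintro ⟨i, j, hij, c⟩
      have h1 : (i = 0 ∧ j = 1) ∨ (i = 1 ∧ j = 0) := by
        fin_cases i <;> fin_cases j <;> simp_all
      rcases h1 with ⟨rfl, rfl⟩ | ⟨rfl, rfl⟩
      · refine ⟨_, up_mem_componentStabilizer c, ?_⟩
        ext i j
        fin_cases i <;> fin_cases j <;>
          simp [coe_up, Matrix.TransvectionStruct.toMatrix, Matrix.transvection]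
      · refine ⟨weyl F * up c * weyl F, mul_mem (mul_mem (intGL_le_componentStabilizer
          weyl_mem_intGL) (up_mem_componentStabilizer c)) (intGL_le_componentStabilizer
          weyl_mem_intGL), ?_⟩
        ext i j
        fin_cases i <;> fin_cases j <;>
          simp [coe_up, coe_weyl, Matrix.TransvectionStruct.toMatrix, Matrix.transvection]
    · rintro A B - - ⟨g, hg, rfl⟩ ⟨h, hh, rfl⟩
      exact ⟨g * h, mul_mem hg hh, Units.val_mul _ _⟩
  obtain ⟨h, hh, hhg⟩ := key
  rwa [← Units.ext hhg]

variable (F) in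
theorem tree_connected : (tree F).Connected := by
  have h1 : ∀ x, (tree F).Reachable (stdVertex F) x := by
    intro x
    obtain ⟨g, rfl⟩ := exists_toAut_stdVertex x
    have : g ∈ componentStabilizer F := by
      rw [componentStabilizer_eq_top]
      trivial
    exact this
  have : Nonempty (Vertex F) := ⟨stdVertex F⟩
  exact ⟨fun x y => (h1 x).symm.trans (h1 y)⟩

/-- This is uniqueness in the Cartan decomposition. From `k * diag(ϖ^m, 1) = diag(ϖ^n, 1) * c * l`
with `c` of order `r`, the determinants give `m = n + 2r`. If `m < n`, comparing the first rows
shows that the whole first row of `k` lies in `𝔭_F`, which contradicts `k ∈ GL₂(𝒪_F)`. -/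
theorem eq_of_toAut_stdLine_le {m n : ℕ} {k : GL (Fin 2) F} (hk : k ∈ intGL F)
    (h : toAut k (stdLine F m) = stdLine F n) : n ≤ m := by
  by_contra hmn
  rw [not_le] at hmn
  have h1 : toAut ((dz F n)⁻¹ * k * dz F m) (stdVertex F) = stdVertex F := by
    rw [toAut_mul_apply, toAut_mul_apply]
    change toAut _ (toAut k (stdLine F m)) = _
    rw [h]
    exact toAut_inv_apply_self _ _
  obtain ⟨c, l, hl, hcl⟩ := toAut_stdVertex.1 h1
  have h2 : k * dz F m = dz F n * (sc c * l) := by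
    rw [← hcl]
    group
  have hk' := mem_intGL_iff.1 hk
  have hl' := mem_intGL_iff.1 hl
  have hdet : valuation F (unif F : F) ^ (m : ℤ) =
      valuation F (unif F : F) ^ (n : ℤ) * (valuation F (c : F) * valuation F (c : F)) := by
    have h3 := congrArg (fun g : GL (Fin 2) F =>
      valuation F (g : Matrix (Fin 2) (Fin 2) F).det) h2
    simp only [Units.val_mul, Matrix.det_mul, map_mul, hk'.2, hl'.2, dz, coe_dg, coe_sc,
      Matrix.det_fin_two_of] at h3
    simpa using h3
  obtain ⟨r, hr⟩ := exists_zpow_unif c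
  rw [hr, ← zpow_add₀ unif_pos.ne', ← zpow_add₀ unif_pos.ne'] at hdet
  have hmr := zpow_unif_injective hdet
  have h00 : k.1 0 0 * (unif F : F) ^ m = (unif F : F) ^ n * (c * l.1 0 0) := by
    have := congrArg (fun g : GL (Fin 2) F => g.1 0 0) h2
    simpa [dz, coe_dg, coe_sc, Matrix.mul_apply, Fin.sum_univ_two] using this
  have h01 : k.1 0 1 = (unif F : F) ^ n * (c * l.1 0 1) := by
    have := congrArg (fun g : GL (Fin 2) F => g.1 0 1) h2
    simpa [dz, coe_dg, coe_sc, Matrix.mul_apply, Fin.sum_univ_two] using this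
  have hlt : ∀ (a b : F) (s t : ℤ), b ∈ 𝒪[F] →
      valuation F a * valuation F (unif F : F) ^ s = valuation F (unif F : F) ^ t * valuation F b →
      s < t → valuation F a < 1 := by
    intro a b s t hb hab hst
    have h4 : valuation F a = valuation F (unif F : F) ^ (t - s) * valuation F b := by
      rw [zpow_sub₀ unif_pos.ne', div_mul_eq_mul_div, ← hab,
        mul_div_cancel_right₀ _ (zpow_pos unif_pos s).ne']
    rw [h4]
    calc _ ≤ valuation F (unif F : F) ^ (t - s) * 1 :=
          mul_le_mul_right (mem_integers_iff.1 hb) _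
      _ < 1 := by
          rw [mul_one, ← zpow_zero (valuation F (unif F : F))]
          exact zpow_lt_zpow_right_of_lt_one₀ unif_pos unif_lt_one (by omega)
  have e00 : valuation F (k.1 0 0) < 1 := by
    refine hlt _ (l.1 0 0) m (n + r) (hl'.1 0 0) ?_ (by omega)
    have := congrArg (valuation F) h00
    rw [map_mul, map_pow, map_mul, map_pow, map_mul, hr] at this
    rw [zpow_natCast, this, zpow_add₀ unif_pos.ne', zpow_natCast, mul_assoc]
  have e01 : valuation F (k.1 0 1) < 1 := by
    refine hlt _ (l.1 0 1) 0 (n + r) (hl'.1 0 1) ?_ (by omega)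
    have := congrArg (valuation F) h01
    rw [map_mul, map_pow, map_mul, hr] at this
    rw [zpow_zero, mul_one, this, zpow_add₀ unif_pos.ne', zpow_natCast, mul_assoc]
  have hd := hk'.2
  rw [Matrix.det_fin_two] at hd
  refine (lt_of_le_of_lt (Valuation.map_sub _ _ _) (max_lt ?_ ?_)).ne hd
  · rw [map_mul]
    exact mul_lt_one_of_lt_of_le e00 (mem_integers_iff.1 (hk'.1 1 1))
  · rw [map_mul]
    exact mul_lt_one_of_lt_of_le e01 (mem_integers_iff.1 (hk'.1 1 0))

theorem eq_of_toAut_stdLine {m n : ℕ} {g : GL (Fin 2) F}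
    (h0 : toAut g (stdVertex F) = stdVertex F)
    (h : toAut g (stdLine F m) = stdLine F n) : m = n := by
  obtain ⟨c, k, hk, rfl⟩ := toAut_stdVertex.1 h0
  rw [toAut_mul_apply, toAut_sc] at h
  refine le_antisymm (eq_of_toAut_stdLine_le (inv_mem hk) (m := n) ?_)
    (eq_of_toAut_stdLine_le hk h)
  rw [← h, toAut_inv_apply_self]

theorem exists_geodesic (x y : Vertex F) : ∃ v : ℕ → Vertex F, v 0 = x ∧
    v ((tree F).dist x y) = y ∧ (∀ i < (tree F).dist x y, (tree F).Adj (v i) (v (i + 1))) ∧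
    ∀ i ≤ (tree F).dist x y, (tree F).dist x (v i) = i := by
  obtain ⟨p, hp⟩ := (tree_connected F).exists_walk_length_eq_dist x y
  refine ⟨p.getVert, p.getVert_zero, by rw [← hp, p.getVert_length],
    fun i hi => p.adj_getVert_succ (by omega), fun i hi => ?_⟩
  have h1 : (tree F).dist x (p.getVert i) ≤ i :=
    (SimpleGraph.dist_le (p.take i)).trans (by rw [SimpleGraph.Walk.take_length]; exact min_le_left _ _)
  have h2 : (tree F).dist (p.getVert i) y ≤ (tree F).dist x y - i :=
    (SimpleGraph.dist_le (p.drop i)).trans (by rw [SimpleGraph.Walk.drop_length, hp])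
  have h3 := (tree_connected F).dist_triangle (u := x) (v := p.getVert i) (w := y)
  omega

/-- A shortest walk does not backtrack, so `exists_adapted` applies to it. This reduces questions
about a pair of vertices to the standard half-line. -/
theorem exists_adapted_dist (x y : Vertex F) : ∃ g : GL (Fin 2) F,
    x = toAut g (stdVertex F) ∧ y = toAut g (stdLine F ((tree F).dist x y)) := by
  obtain ⟨v, h0, h1, h2, h3⟩ := exists_geodesic x y
  obtain ⟨g, hg⟩ := exists_adapted _ v h2 (fun i hi h => by
    have e1 := h3 i (by omega)
    have e2 := h3 (i + 2) hi
    rw [h, e2] at e1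
    omega)
  refine ⟨g, ?_, ?_⟩
  · rw [← h0, hg 0 (Nat.zero_le _), Nat.cast_zero, stdLine_zero]
  · conv_lhs => rw [← h1, hg _ le_rfl]

/-- If the distance were `d`, adapting the pair to the standard half-line would give a matrix that
fixes the standard vertex and carries `stdLine F n` to `stdLine F d`; by `eq_of_toAut_stdLine` this
forces `n = d`. -/
theorem dist_stdLine (g : GL (Fin 2) F) (n : ℕ) :
    (tree F).dist (toAut g (stdVertex F)) (toAut g (stdLine F n)) = n := by
  obtain ⟨h, h1, h2⟩ := exists_adapted_dist (toAut g (stdVertex F)) (toAut g (stdLine F n))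
  refine (eq_of_toAut_stdLine (g := h⁻¹ * g) ?_ ?_).symm
  · rw [toAut_mul_apply, h1, toAut_inv_apply_self]
  · rw [toAut_mul_apply]
    conv_lhs => rw [h2, toAut_inv_apply_self]

/-- A walk without backtracking is a geodesic. -/
theorem dist_of_not_backtracking {n : ℕ} {v : ℕ → Vertex F}
    (h1 : ∀ i < n, (tree F).Adj (v i) (v (i + 1))) (h2 : ∀ i, i + 2 ≤ n → v i ≠ v (i + 2)) :
    (tree F).dist (v 0) (v n) = n := by
  obtain ⟨g, hg⟩ := exists_adapted n v h1 h2
  rw [hg 0 (Nat.zero_le _), hg n le_rfl, Nat.cast_zero, stdLine_zero, dist_stdLine]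

/-- A geodesic can be continued by every neighbour of its end point except the last vertex but
one. -/
theorem exists_extension {x y z : Vertex F} (h : (tree F).Adj y z)
    (hd : (tree F).dist x y ≤ (tree F).dist x z) :
    ∃ v : ℕ → Vertex F, v 0 = x ∧ v ((tree F).dist x y) = y ∧ v ((tree F).dist x y + 1) = z ∧
      (∀ i < (tree F).dist x y + 1, (tree F).Adj (v i) (v (i + 1))) ∧
      ∀ i, i + 2 ≤ (tree F).dist x y + 1 → v i ≠ v (i + 2) := by
  obtain ⟨v, h0, h1, h2, h3⟩ := exists_geodesic x y
  set n := (tree F).dist x y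
  refine ⟨fun i => if i ≤ n then v i else z, by simp [h0], by simp [h1], by simp, ?_, ?_⟩
  · intro i hi
    rcases Nat.lt_or_ge i n with h4 | h4
    · simp only [h4.le, Nat.succ_le_of_lt h4, if_true]
      exact h2 i h4
    · obtain rfl : i = n := by omega
      simpa [h1] using h
  · intro i hi he
    rcases Nat.lt_or_ge (i + 1) n with h4 | h4
    · simp only [show i ≤ n by omega, show i + 2 ≤ n by omega, if_true] at he
      have e1 := h3 i (by omega)
      have e2 := h3 (i + 2) (by omega)
      rw [he, e2] at e1
      omega
    -- Backtracking at the last step would put `z` at distance `n - 1` from `x`, against `hd`.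
    · simp only [show i ≤ n by omega, show ¬ i + 2 ≤ n by omega, if_true, if_false] at he
      have e1 := h3 i (by omega)
      rw [he] at e1
      omega

/-- The extended walk is a geodesic. In particular two adjacent vertices are never equidistant from
`x`. -/
theorem dist_succ_of_le {x y z : Vertex F} (h : (tree F).Adj y z)
    (hd : (tree F).dist x y ≤ (tree F).dist x z) :
    (tree F).dist x z = (tree F).dist x y + 1 := by
  obtain ⟨v, h0, -, h2, h3, h4⟩ := exists_extension h hd
  have := dist_of_not_backtracking h3 h4
  rwa [h0, h2] at this

theorem dist_adj (x : Vertex F) {y z : Vertex F} (h : (tree F).Adj y z) :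
    (tree F).dist x z = (tree F).dist x y + 1 ∨ (tree F).dist x y = (tree F).dist x z + 1 :=
  (le_total _ _).imp (dist_succ_of_le h) (dist_succ_of_le h.symm)

/-- The neighbour of `z` on the geodesic from `x` to `z` is unique. -/
theorem parent_unique {x y y' z : Vertex F} (h : (tree F).Adj y z) (h' : (tree F).Adj y' z)
    (hd : (tree F).dist x y ≤ (tree F).dist x z) (hd' : (tree F).dist x y' ≤ (tree F).dist x z) :
    y = y' := by
  by_contra hne
  have e := dist_succ_of_le h hd
  have e' := dist_succ_of_le h' hd'
  obtain ⟨v, h0, h1, h2, h3, h4⟩ := exists_extension h hd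
  set n := (tree F).dist x y
  -- Two distinct candidates would give a walk `x, …, y, z, y'` without backtracking, of length `n +
  -- 2`, although `y'` is at distance `n` from `x`.
  have h5 := dist_of_not_backtracking (n := n + 2)
    (v := fun i => if i ≤ n + 1 then v i else y') ?_ ?_
  · simp [h0] at h5
    omega
  · intro i hi
    rcases Nat.lt_or_ge i (n + 1) with h6 | h6
    · simp only [h6.le, Nat.succ_le_of_lt h6, if_true]
      exact h3 i h6
    · obtain rfl : i = n + 1 := by omega
      simpa [h2] using h'.symm
  · intro i hi
    rcases Nat.lt_or_ge i n with h6 | h6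
    · simp only [show i ≤ n + 1 by omega, show i + 2 ≤ n + 1 by omega, if_true]
      exact h4 i (by omega)
    · obtain rfl : i = n := by omega
      simpa [h1] using hne

theorem dist_pos_parent {x z : Vertex F} (h : z ≠ x) : ∃ y, (tree F).Adj y z ∧
    (tree F).dist x z = (tree F).dist x y + 1 := by
  obtain ⟨v, h0, h1, h2, h3⟩ := exists_geodesic x z
  have hpos : 0 < (tree F).dist x z := (tree_connected F).pos_dist_of_ne h.symm
  refine ⟨v ((tree F).dist x z - 1), ?_, ?_⟩
  · have := h2 _ (Nat.sub_lt hpos one_pos)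
    rwa [show (tree F).dist x z - 1 + 1 = (tree F).dist x z by omega, h1] at this
  · rw [h3 _ (Nat.sub_le _ _)]
    omega

theorem mem_ball_iff {e : ℕ} {x y : Vertex F} : y ∈ ball e x ↔ (tree F).dist x y ≤ e := by
  rw [ball, Set.mem_ofPred_eq, ← (tree_connected F x y).coe_dist_eq_edist]
  exact Nat.cast_le

/-- The tree is bipartite: by `dist_adj`, each step along an edge changes the distance from a given
vertex by exactly one. -/
theorem dist_parity (x y z : Vertex F) :
    Even ((tree F).dist x z) ↔ Even ((tree F).dist x y + (tree F).dist y z) := by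
  obtain ⟨n, hn⟩ : ∃ n, (tree F).dist y z = n := ⟨_, rfl⟩
  induction n generalizing z with
  | zero =>
    rw [(tree_connected F).dist_eq_zero_iff] at hn
    rw [hn, SimpleGraph.dist_self, add_zero]
  | succ n ih =>
    have hzy : z ≠ y := by
      rintro rfl
      rw [SimpleGraph.dist_self] at hn
      omega
    obtain ⟨w, hw, hd⟩ := dist_pos_parent hzy
    have h1 := ih w (by omega)
    rw [hd, ← add_assoc, Nat.even_add_one, ← h1]
    rcases dist_adj x hw with h | h <;> rw [h, Nat.even_add_one]
    rw [not_not]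

/-- A conjugate of `s` has determinant `1`, while `dz F n * (sc c * l)` has determinant of order `n
+ 2r`, where `r` is the order of `c`. -/
theorem exists_eq_two_mul_of_toAut_SL {s : SL(2, F)} {g : GL (Fin 2) F} {n : ℕ}
    (h : toAut (Matrix.SpecialLinearGroup.toGL s) (toAut g (stdVertex F)) =
      toAut g (stdLine F n)) : Even n := by
  have h1 : toAut ((dz F n)⁻¹ * (g⁻¹ * Matrix.SpecialLinearGroup.toGL s * g)) (stdVertex F) =
      stdVertex F := by
    rw [toAut_mul_apply, toAut_mul_apply, toAut_mul_apply, h, toAut_inv_apply_self]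
    exact toAut_inv_apply_self _ _
  obtain ⟨c, l, hl, hcl⟩ := toAut_stdVertex.1 h1
  have h2 : g⁻¹ * Matrix.SpecialLinearGroup.toGL s * g = dz F n * (sc c * l) := by
    rw [← hcl, mul_inv_cancel_left]
  have h3 := congrArg (fun g : GL (Fin 2) F => (Matrix.GeneralLinearGroup.det g : F)) h2
  have h4 : Matrix.GeneralLinearGroup.det (Matrix.SpecialLinearGroup.toGL s) = 1 := by
    ext
    simp
  simp only [map_mul, h4, mul_one, map_inv, inv_mul_cancel] at h3
  have h5 := congrArg (valuation F) h3
  simp only [Units.val_one, map_one, Units.val_mul, map_mul,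
    Matrix.GeneralLinearGroup.val_det_apply, (mem_intGL_iff.1 hl).2, dz, coe_dg, coe_sc,
    Matrix.det_fin_two_of] at h5
  obtain ⟨r, hr⟩ := exists_zpow_unif c
  have h6 : valuation F (unif F : F) ^ (0 : ℤ) = valuation F (unif F : F) ^ (n + (r + r)) := by
    rw [zpow_zero, zpow_add₀ unif_pos.ne', zpow_add₀ unif_pos.ne', ← hr]
    simpa using h5
  have h7 := zpow_unif_injective h6
  rw [← Int.even_coe_nat]
  exact ⟨-r, by omega⟩

theorem inSLOrbit_iff {x y : Vertex F} : InSLOrbit x y ↔ Even ((tree F).dist x y) := by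
  obtain ⟨g, hx, hy⟩ := exists_adapted_dist x y
  constructor
  · rintro ⟨s, hs⟩
    refine exists_eq_two_mul_of_toAut_SL (s := s) (g := g) ?_
    rw [← hx, ← hy, hs]
  · rintro ⟨n, hn⟩
    -- `diag(ϖ^n, ϖ^{-n})` has determinant `1` and equals `diag(ϖ^{2n}, 1)` up to a scalar, so it
    -- translates the standard apartment by `2n`.
    let a : GL (Fin 2) F := g * dg (unif F ^ n) (unif F ^ n)⁻¹ * g⁻¹
    have ha : Matrix.GeneralLinearGroup.det a = 1 := by
      rw [map_mul, map_mul, map_inv, mul_comm, inv_mul_cancel_left]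
      ext
      simp [coe_dg]
    have ha' : (a : Matrix (Fin 2) (Fin 2) F).det = 1 := congrArg Units.val ha
    refine ⟨⟨a, ha'⟩, ?_⟩
    have h1 : Matrix.SpecialLinearGroup.toGL ⟨(a : Matrix (Fin 2) (Fin 2) F), ha'⟩ = a :=
      Units.ext rfl
    have h2 : dg (unif F ^ n) (unif F ^ n)⁻¹ = sc (unif F ^ n)⁻¹ * dz F ((n + n : ℕ) : ℤ) := by
      rw [sc_eq_dg, dz, dg_mul, mul_one, zpow_natCast, pow_add, inv_mul_cancel_left]
    rw [h1, toAut_mul_apply, toAut_mul_apply, h2, toAut_mul_apply, toAut_sc]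
    conv_lhs => rw [hx, toAut_inv_apply_self]
    conv_rhs => rw [hy, hn]
    rfl

theorem vertexSign_eq (x y : Vertex F) : vertexSign x y = (-1) ^ (tree F).dist x y := by
  rw [vertexSign, inSLOrbit_iff]
  split_ifs with h
  · exact h.neg_one_pow.symm
  · exact (Nat.not_even_iff_odd.1 h).neg_one_pow.symm

theorem vertexSign_mul (x y z : Vertex F) :
    vertexSign x y * vertexSign y z = vertexSign x z := by
  rw [vertexSign_eq, vertexSign_eq, vertexSign_eq, ← pow_add]
  have h := dist_parity x y z
  rcases Nat.even_or_odd ((tree F).dist x z) with h1 | h1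
  · rw [h1.neg_one_pow, (h.1 h1).neg_one_pow]
  · rw [h1.neg_one_pow, (Nat.not_even_iff_odd.1 (fun h2 =>
      (Nat.not_even_iff_odd.2 h1) (h.2 h2))).neg_one_pow]

theorem vertexSign_aut (g : AutTree F) (x y : Vertex F) :
    vertexSign (g x) (g y) = vertexSign x y := by
  rw [vertexSign_eq, vertexSign_eq, dist_aut]

theorem vertexSign_adj {x y : Vertex F} (h : (tree F).Adj x y) : vertexSign x y = -1 := by
  rw [vertexSign_eq, SimpleGraph.dist_eq_one_iff_adj.2 h, pow_one]

end Distance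

/-! ### Pointwise stabilizers of balls as subgroups of `Aut(X)`. -/

section BallStabilizer

variable {F : Type u} [Field F] [ValuativeRel F]

/-- The pointwise stabilizer of the ball `Z^{(e)}(x)`. -/
def ballStab (e : ℕ) (x : Vertex F) : Subgroup (AutTree F) where
  carrier := {g | ∀ y ∈ ball e x, g y = y}
  one_mem' _ _ := rfl
  mul_mem' {g h} hg hh y hy := by rw [RelIso.mul_apply, hh y hy, hg y hy]
  inv_mem' {g} hg y hy := by
    conv_lhs => rw [← hg y hy]
    exact RelIso.inv_apply_self g y

theorem conj_mem_ballStab {e : ℕ} {x : Vertex F} {g : AutTree F} (h : AutTree F)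
    (hg : g ∈ ballStab e (h x)) : h⁻¹ * g * h ∈ ballStab e x := by
  intro y hy
  rw [RelIso.mul_apply, RelIso.mul_apply, hg _ (ball_aut h hy), RelIso.inv_apply_self]

theorem conj_mem_ballStab' {e : ℕ} {x : Vertex F} {g : AutTree F} (h : AutTree F)
    (hg : g ∈ ballStab e x) : h * g * h⁻¹ ∈ ballStab e (h x) := by
  have := conj_mem_ballStab (e := e) (x := h x) (g := g) h⁻¹ (by rwa [RelIso.inv_apply_self])
  rwa [inv_inv] at this

theorem ballStab_apply_self {e : ℕ} {x : Vertex F} {g : AutTree F} (hg : g ∈ ballStab e x) :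
    g x = x := hg x (self_mem_ball e x)

open ValuativeRel in
theorem valuation_matrix_mul_le {A B : Matrix (Fin 2) (Fin 2) F} {a b : ValueGroupWithZero F}
    (hA : ∀ i j, valuation F (A i j) ≤ a) (hB : ∀ i j, valuation F (B i j) ≤ b) (i j : Fin 2) :
    valuation F ((A * B) i j) ≤ a * b := by
  rw [Matrix.mul_apply]
  refine Valuation.map_sum_le _ fun k _ => ?_
  rw [map_mul]
  exact mul_le_mul' (hA i k) (hB k j)

end BallStabilizer

/-! ### Stabilizers of balls in `GL₂(F)` as congruence subgroups. -/

section Congruence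

open ValuativeRel

variable {F : Type u} [Field F] [ValuativeRel F] [TopologicalSpace F]
  [IsNonarchimedeanLocalField F]

/-- `k ∈ GL₂(𝒪_F)` is congruent to a scalar modulo `𝔭_F^e`. -/
def IsCong (e : ℕ) (k : GL (Fin 2) F) : Prop :=
  k ∈ intGL F ∧ ∃ d : F, ∀ i j, valuation F ((k.1 - d • (1 : Matrix (Fin 2) (Fin 2) F)) i j) ≤
    valuation F (unif F : F) ^ e

theorem isCong_of {e : ℕ} {k : GL (Fin 2) F} (hk : k ∈ intGL F)
    (h01 : valuation F (k.1 0 1) ≤ valuation F (unif F : F) ^ e)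
    (h10 : valuation F (k.1 1 0) ≤ valuation F (unif F : F) ^ e)
    (h00 : valuation F (k.1 0 0 - k.1 1 1) ≤ valuation F (unif F : F) ^ e) : IsCong e k := by
  refine ⟨hk, k.1 1 1, fun i j => ?_⟩
  fin_cases i <;> fin_cases j <;> simp <;> assumption

theorem IsCong.conj {e : ℕ} {k l : GL (Fin 2) F} (hk : IsCong e k) (hl : l ∈ intGL F) :
    IsCong e (l⁻¹ * k * l) := by
  obtain ⟨h1, d, h2⟩ := hk
  refine ⟨mul_mem (mul_mem (inv_mem hl) h1) hl, d, ?_⟩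
  have h3 : (l⁻¹ * k * l).1 - d • (1 : Matrix (Fin 2) (Fin 2) F) =
      (l⁻¹).1 * (k.1 - d • (1 : Matrix (Fin 2) (Fin 2) F)) * l.1 := by
    rw [mul_sub, sub_mul, mul_smul_comm, smul_mul_assoc, mul_one]
    congr 2
    exact l.inv_mul.symm
  intro i j
  rw [h3]
  have := valuation_matrix_mul_le (valuation_matrix_mul_le
    (fun i j => mem_integers_iff.1 ((mem_intGL_iff.1 (inv_mem hl)).1 i j)) h2)
    (fun i j => mem_integers_iff.1 ((mem_intGL_iff.1 hl).1 i j)) i j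
  rwa [one_mul, mul_one] at this

/-- The upper right entry is divided by `ϖ^n`. For `k ∈ GL₂(𝒪_F)` and `n ≥ 0`, fixing `stdLine F n`
therefore means that this one entry lies in `𝔭_F^n`. -/
theorem conj_dz (n : ℤ) (k : GL (Fin 2) F) : ((dz F n)⁻¹ * k * dz F n).1 =
    !![k.1 0 0, ((unif F ^ (-n) : Fˣ) : F) * k.1 0 1; ((unif F ^ n : Fˣ) : F) * k.1 1 0, k.1 1 1] := by
  rw [← dz_neg, Units.val_mul, Units.val_mul, dz, dz, coe_dg, coe_dg, Matrix.eta_fin_two k.1,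
    Matrix.mul_fin_two, Matrix.mul_fin_two]
  ext i j
  fin_cases i <;> fin_cases j <;> simp [mul_comm]
  exact mul_inv_cancel_left₀ (zpow_ne_zero n (unif F).ne_zero) _

theorem det_conj_dz (n : ℤ) (k : GL (Fin 2) F) :
    ((dz F n)⁻¹ * k * dz F n).1.det = k.1.det := by
  rw [Units.val_mul, Matrix.det_mul, mul_comm, ← Matrix.det_mul, ← Units.val_mul,
    mul_inv_cancel_left]

theorem valuation_zpow_unif (n : ℤ) :
    valuation F ((unif F ^ n : Fˣ) : F) = valuation F (unif F : F) ^ n := by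
  rw [Units.val_zpow_eq_zpow_val, map_zpow₀]

theorem valuation_neg_zpow_mul_le {n : ℕ} {a : F} :
    valuation F (((unif F ^ (-(n : ℤ)) : Fˣ) : F) * a) ≤ 1 ↔
      valuation F a ≤ valuation F (unif F : F) ^ n := by
  rw [map_mul, valuation_zpow_unif, zpow_neg, zpow_natCast, inv_mul_le_iff₀ (pow_pos unif_pos n),
    mul_one]

theorem IsCong.toAut_stdLine {e n : ℕ} (hn : n ≤ e) {k : GL (Fin 2) F} (hk : IsCong e k) :
    toAut k (stdLine F n) = stdLine F n := by
  obtain ⟨h1, d, h2⟩ := hk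
  have h3 := mem_intGL_iff.1 h1
  have h01 : valuation F (k.1 0 1) ≤ valuation F (unif F : F) ^ n := by
    have := h2 0 1
    simp only [Matrix.sub_apply, Matrix.smul_apply, Matrix.one_apply_ne zero_ne_one, smul_zero,
      sub_zero] at this
    exact this.trans (pow_le_pow_right_of_le_one' unif_lt_one.le hn)
  have h4 : (dz F n)⁻¹ * k * dz F n ∈ intGL F := by
    rw [mem_intGL_iff, det_conj_dz, conj_dz]
    refine ⟨fun i j => ?_, h3.2⟩
    fin_cases i <;> fin_cases j
    · exact h3.1 0 0
    · exact mem_integers_iff.2 (valuation_neg_zpow_mul_le.2 h01)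
    · refine mul_mem ?_ (h3.1 1 0)
      rw [mem_integers_iff, valuation_zpow_unif, zpow_unif_le_one_iff]
      omega
    · exact h3.1 1 1
  have h5 := toAut_intGL h4
  rw [mul_assoc, toAut_mul_apply, toAut_mul_apply] at h5
  have h6 := congrArg (toAut (dz F n)) h5
  rwa [toAut_apply_inv_self] at h6

/-- Being scalar modulo `𝔭_F^e` is stable under conjugation by `GL₂(𝒪_F)`, and `GL₂(𝒪_F)` carries
the standard half-line to a geodesic from the standard vertex to any given vertex. So it suffices to
treat the vertices of `stdLine F`. -/
theorem IsCong.mem_ballStab {e : ℕ} {k : GL (Fin 2) F} (hk : IsCong e k) :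
    toAut k ∈ ballStab e (stdVertex F) := by
  intro y hy
  rw [mem_ball_iff] at hy
  obtain ⟨g, h1, h2⟩ := exists_adapted_dist (stdVertex F) y
  obtain ⟨c, l, hl, rfl⟩ := toAut_stdVertex.1 h1.symm
  rw [toAut_mul_apply, toAut_sc] at h2
  have h3 := (hk.conj hl).toAut_stdLine hy
  rw [toAut_mul_apply, toAut_mul_apply, ← h2] at h3
  have h4 := congrArg (toAut l) h3
  rwa [toAut_apply_inv_self, ← h2] at h4

theorem valuation_entry_le_of_toAut_stdLine {e : ℕ} {k : GL (Fin 2) F} (hk : k ∈ intGL F)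
    (h : toAut k (stdLine F e) = stdLine F e) :
    valuation F (k.1 0 1) ≤ valuation F (unif F : F) ^ e := by
  have h1 : toAut ((dz F e)⁻¹ * k * dz F e) (stdVertex F) = stdVertex F := by
    rw [toAut_mul_apply, toAut_mul_apply]
    change toAut _ (toAut k (stdLine F e)) = _
    rw [h]
    exact toAut_inv_apply_self _ _
  obtain ⟨c, l, hl, hcl⟩ := toAut_stdVertex.1 h1
  have h2 := det_conj_dz (e : ℤ) k
  rw [hcl, Units.val_mul, Matrix.det_mul] at h2
  have h3 := congrArg (valuation F) h2
  rw [map_mul, (mem_intGL_iff.1 hl).2, (mem_intGL_iff.1 hk).2, coe_sc, Matrix.det_fin_two_of,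
    mul_zero, sub_zero, mul_one, map_mul] at h3
  -- The determinants of `k` and `l` are units, hence so is `c`; this makes the entry comparison
  -- below exact.
  have hc : valuation F (c : F) = 1 := by
    obtain ⟨r, hr⟩ := exists_zpow_unif c
    rw [hr, ← zpow_add₀ unif_pos.ne', ← zpow_zero (valuation F (unif F : F))] at h3
    have := zpow_unif_injective h3
    obtain rfl : r = 0 := by omega
    rw [hr, zpow_zero]
  rw [← valuation_neg_zpow_mul_le]
  have h4 := congrArg (fun g : GL (Fin 2) F => g.1 0 1) hcl
  simp only [conj_dz] at h4
  have h5 : (sc c * l).1 0 1 = c * l.1 0 1 := by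
    rw [Units.val_mul, coe_sc]
    simp [Matrix.mul_apply, Fin.sum_univ_two]
  rw [h5] at h4
  change ((unif F ^ (-(e : ℤ)) : Fˣ) : F) * k.1 0 1 = c * l.1 0 1 at h4
  rw [h4, map_mul, hc, one_mul]
  exact mem_integers_iff.1 ((mem_intGL_iff.1 hl).1 0 1)

/-- The pointwise stabilizer of `Z^{(e)}(x)` consists of the matrices which are congruent to a
scalar. -/
theorem exists_isCong {e : ℕ} {g : GL (Fin 2) F} (hg : toAut g ∈ ballStab e (stdVertex F)) :
    ∃ (c : Fˣ) (k : GL (Fin 2) F), g = sc c * k ∧ k ∈ intGL F ∧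
      valuation F (k.1 0 1) ≤ valuation F (unif F : F) ^ e ∧
      valuation F (k.1 1 0) ≤ valuation F (unif F : F) ^ e ∧
      valuation F (k.1 0 0 - k.1 1 1) ≤ valuation F (unif F : F) ^ e := by
  obtain ⟨c, k, hk, rfl⟩ := toAut_stdVertex.1 (ballStab_apply_self hg)
  have hk' : toAut k ∈ ballStab e (stdVertex F) := by
    intro y hy
    have := hg y hy
    rwa [toAut_mul_apply, toAut_sc] at this
  -- Each `l` tests the vertex `toAut l (stdLine F e)` of the sphere of radius `e`. The choices `1`,
  -- `weyl F` and `up 1` yield the three congruences.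
  have key : ∀ l ∈ intGL F,
      valuation F ((l⁻¹ * k * l).1 0 1) ≤ valuation F (unif F : F) ^ e := by
    intro l hl
    refine valuation_entry_le_of_toAut_stdLine (mul_mem (mul_mem (inv_mem hl) hk) hl) ?_
    have h1 := conj_mem_ballStab (toAut l) (x := stdVertex F) (g := toAut k) (e := e)
      (by rwa [toAut_intGL hl])
    rw [← map_inv, ← map_mul, ← map_mul] at h1
    refine h1 _ ?_
    rw [mem_ball_iff]
    have := dist_stdLine (1 : GL (Fin 2) F) e
    rw [map_one] at this
    exact this.le
  have h1 : valuation F (k.1 0 1) ≤ valuation F (unif F : F) ^ e := by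
    simpa using key 1 (one_mem _)
  have hw : (weyl F)⁻¹.1 = !![0, 1; 1, 0] := rfl
  have h2 : valuation F (k.1 1 0) ≤ valuation F (unif F : F) ^ e := by
    have := key _ weyl_mem_intGL
    rw [Units.val_mul, Units.val_mul, hw, coe_weyl, Matrix.eta_fin_two k.1, Matrix.mul_fin_two,
      Matrix.mul_fin_two] at this
    simpa using this
  refine ⟨c, k, rfl, hk, h1, h2, ?_⟩
  have h3 := key (up 1) (up_mem_intGL (one_mem _))
  rw [up_inv, Units.val_mul, Units.val_mul, coe_up, coe_up] at h3
  have h4 : (!![1, -1; 0, 1] * k.1 * !![1, 1; 0, 1] : Matrix (Fin 2) (Fin 2) F) 0 1 =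
      k.1 0 0 - k.1 1 0 + (k.1 0 1 - k.1 1 1) := by
    rw [Matrix.eta_fin_two k.1, Matrix.mul_fin_two, Matrix.mul_fin_two]
    simp [sub_eq_add_neg]
  rw [h4] at h3
  have h5 : k.1 0 0 - k.1 1 1 = k.1 0 0 - k.1 1 0 + (k.1 0 1 - k.1 1 1) + (k.1 1 0 - k.1 0 1) := by
    ring
  rw [h5]
  exact Valuation.map_add_le _ h3 (Valuation.map_sub_le _ h2 h1)

theorem isCong_up {e : ℕ} {c : F} (hc : valuation F c ≤ valuation F (unif F : F) ^ e) :
    IsCong e (up c) := by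
  have h1 : valuation F (unif F : F) ^ e ≤ 1 := pow_le_one' unif_lt_one.le e
  refine isCong_of (up_mem_intGL (mem_integers_iff.2 (hc.trans h1))) ?_ ?_ ?_ <;>
    simp [coe_up, hc]

/-- Seen from vertex `n`, the matrix `g` is, up to a scalar, some `k` that is scalar modulo `𝔭_F^e`.
Write `k = up β * b` with `b` lower triangular. Then `b` also fixes the ball of radius `e` around
the next vertex, so there `k` acts as `up β`. Carried back to the origin, `up β` becomes `up (ϖ^n *
β)`, which is even more congruent to `1` and so fixes the ball around vertex `0` as well. -/
theorem exists_mem_ballStab_std {e : ℕ} [NeZero e] (n : ℕ) {g : GL (Fin 2) F}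
    (hg : toAut g ∈ ballStab e (stdLine F n)) : ∃ g' : GL (Fin 2) F,
      toAut g' ∈ ballStab e (stdLine F n) ∧ toAut g' ∈ ballStab e (stdVertex F) ∧
      ∀ w ∈ ball e (stdLine F (n + 1)), toAut g' w = toAut g w := by
  have he : 1 ≤ e := NeZero.one_le
  have h1 : toAut ((dz F n)⁻¹ * g * dz F n) ∈ ballStab e (stdVertex F) := by
    rw [map_mul, map_mul, map_inv]
    exact conj_mem_ballStab _ hg
  obtain ⟨c, k, hck, hk, h01, h10, h00⟩ := exists_isCong h1
  have hk' := mem_intGL_iff.1 hk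
  have hϖe : valuation F (unif F : F) ^ e < 1 := pow_lt_one₀ zero_le unif_lt_one (by omega)
  have h11 : valuation F (k.1 1 1) = 1 := by
    refine le_antisymm (mem_integers_iff.1 (hk'.1 1 1)) ?_
    by_contra h11
    rw [not_le] at h11
    have h2 := hk'.2
    rw [Matrix.det_fin_two] at h2
    refine (lt_of_le_of_lt (Valuation.map_sub _ _ _) (max_lt ?_ ?_)).ne h2
    · rw [map_mul]
      rw [mul_comm]
      exact mul_lt_one_of_lt_of_le h11 (mem_integers_iff.1 (hk'.1 0 0))
    · rw [map_mul]
      exact mul_lt_one_of_lt_of_le (h01.trans_lt hϖe) (mem_integers_iff.1 (hk'.1 1 0))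
  have hne : k.1 1 1 ≠ 0 := fun h => by simp [h] at h11
  -- The choice for which `(up β)⁻¹ * k` has zero upper right entry.
  set β := k.1 0 1 * (k.1 1 1)⁻¹ with hβdef
  have hβ : valuation F β ≤ valuation F (unif F : F) ^ e := by
    rw [hβdef, map_mul, map_inv₀, h11, inv_one, mul_one]
    exact h01
  have hβ1 : valuation F β ≤ 1 := hβ.trans hϖe.le
  refine ⟨dz F n * up β * (dz F n)⁻¹, ?_, ?_, ?_⟩
  · rw [map_mul, map_mul, map_inv]
    exact conj_mem_ballStab' (toAut (dz F n)) (isCong_up hβ).mem_ballStab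
  · rw [dz_mul_up, mul_inv_cancel_right]
    refine (isCong_up ?_).mem_ballStab
    rw [map_mul, valuation_zpow_unif, zpow_natCast]
    exact (mul_le_of_le_one_left' (pow_le_one' unif_lt_one.le n)).trans hβ
  -- Passing to the next vertex would divide an upper right entry by `ϖ`, but here it vanishes; the
  -- lower left entry only gets smaller.
  · have h2 : IsCong e ((dz F 1)⁻¹ * ((up β)⁻¹ * k) * dz F 1) := by
      have h3 : ((up β)⁻¹ * k).1 =
          !![k.1 0 0 - β * k.1 1 0, 0; k.1 1 0, k.1 1 1] := by
        rw [up_inv, Units.val_mul, coe_up]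
        ext i j
        fin_cases i <;> fin_cases j <;>
          simp [Matrix.mul_apply, Fin.sum_univ_two, sub_eq_add_neg]
        rw [hβdef, inv_mul_cancel_right₀ hne, add_neg_cancel]
      have h4 : ((dz F 1)⁻¹ * ((up β)⁻¹ * k) * dz F 1).1 =
          !![k.1 0 0 - β * k.1 1 0, 0; unif F * k.1 1 0, k.1 1 1] := by
        rw [conj_dz, h3]
        simp
      have h5 : valuation F (β * k.1 1 0) ≤ valuation F (unif F : F) ^ e := by
        rw [map_mul]
        exact (mul_le_of_le_one_left' hβ1).trans h10
      have h6 : valuation F (unif F * k.1 1 0) ≤ valuation F (unif F : F) ^ e := by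
        rw [map_mul]
        exact (mul_le_of_le_one_left' unif_lt_one.le).trans h10
      refine isCong_of ?_ ?_ ?_ ?_
      · rw [mem_intGL_iff]
        constructor
        · rw [h4]
          intro i j
          fin_cases i <;> fin_cases j
          · exact sub_mem (hk'.1 0 0) (mem_integers_iff.2 (h5.trans hϖe.le))
          · exact zero_mem _
          · exact mem_integers_iff.2 (h6.trans hϖe.le)
          · exact hk'.1 1 1
        · rw [det_conj_dz]
          exact (mem_intGL_iff.1 (mul_mem (inv_mem (up_mem_intGL (mem_integers_iff.2 hβ1))) hk)).2
      · simp [h4]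
      · rw [h4]
        exact h6
      · rw [h4]
        change valuation F (k.1 0 0 - β * k.1 1 0 - k.1 1 1) ≤ _
        rw [sub_right_comm]
        exact Valuation.map_sub_le _ h00 h5
    intro w hw
    have hw1 : toAut (dz F (n + 1))⁻¹ w ∈ ball e (stdVertex F) := by
      have := ball_aut (toAut (dz F (n + 1))⁻¹) hw
      rwa [stdLine, toAut_inv_apply_self] at this
    have h3 := h2.mem_ballStab _ hw1
    have h4 : (dz F n)⁻¹ * g = sc c * k * (dz F n)⁻¹ := by rw [← hck]; group
    have h5 : toAut ((dz F n)⁻¹ * g) w = toAut (up β * (dz F n)⁻¹) w := by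
      rw [h4, toAut_mul_apply, toAut_mul_apply, toAut_sc, toAut_mul_apply]
      have h6 := congrArg (toAut (up β * dz F 1)) h3
      rw [← toAut_mul_apply, ← toAut_mul_apply, ← toAut_mul_apply] at h6
      have e1 : up β * dz F 1 * ((dz F 1)⁻¹ * ((up β)⁻¹ * k) * dz F 1) * (dz F (n + 1))⁻¹ =
          k * (dz F n)⁻¹ := by
        rw [dz_add]
        group
      have e2 : up β * dz F 1 * (dz F (n + 1))⁻¹ = up β * (dz F n)⁻¹ := by
        rw [dz_add]
        group
      rw [e1, e2, toAut_mul_apply, toAut_mul_apply] at h6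
      exact h6
    have h6 := congrArg (toAut (dz F n)) h5
    rw [← toAut_mul_apply, ← toAut_mul_apply, mul_inv_cancel_left, ← mul_assoc] at h6
    exact h6.symm

/-- The action of the stabilizer of `Z^{(e)}(y)` on `Z^{(e)}(z)`, for a neighbour `z` of `y`, is
realised by elements which also fix `Z^{(e)}(x)`, if `z` points away from `x`. -/
theorem exists_mem_ballStab_inf {e : ℕ} [NeZero e] {x y z : Vertex F} (hyz : (tree F).Adj y z)
    (hd : (tree F).dist x y ≤ (tree F).dist x z) {g : GL (Fin 2) F}
    (hg : toAut g ∈ ballStab e y) : ∃ g' : GL (Fin 2) F,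
      toAut g' ∈ ballStab e y ∧ toAut g' ∈ ballStab e x ∧
      ∀ w ∈ ball e z, toAut g' w = toAut g w := by
  obtain ⟨v, h0, h1, h2, h3, h4⟩ := exists_extension hyz hd
  obtain ⟨h, hh⟩ := exists_adapted _ v h3 h4
  set n := (tree F).dist x y
  have hx : x = toAut h (stdVertex F) := by
    rw [← h0, hh 0 (Nat.zero_le _), Nat.cast_zero, stdLine_zero]
  have hy : y = toAut h (stdLine F n) := by rw [← hh n (Nat.le_succ n), h1]
  have hz : z = toAut h (stdLine F (n + 1)) := by
    rw [← h2, hh (n + 1) le_rfl]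
    push_cast
    rfl
  have hg1 : toAut (h⁻¹ * g * h) ∈ ballStab e (stdLine F n) := by
    rw [map_mul, map_mul, map_inv]
    exact conj_mem_ballStab _ (hy ▸ hg)
  obtain ⟨g', e1, e2, e3⟩ := exists_mem_ballStab_std n hg1
  refine ⟨h * g' * h⁻¹, ?_, ?_, ?_⟩
  · rw [map_mul, map_mul, map_inv, hy]
    exact conj_mem_ballStab' _ e1
  · rw [map_mul, map_mul, map_inv, hx]
    exact conj_mem_ballStab' _ e2
  · intro w hw
    have hw1 : toAut h⁻¹ w ∈ ball e (stdLine F (n + 1)) := by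
      have := ball_aut (toAut h⁻¹) hw
      rwa [hz, toAut_inv_apply_self] at this
    have h5 := congrArg (toAut h) (e3 _ hw1)
    simp only [← toAut_mul_apply] at h5
    have h6 : h * (h⁻¹ * g * h * h⁻¹) = g := by group
    rw [h6, ← mul_assoc] at h5
    exact h5

end Congruence

/-! ### Half trees, and cutting automorphisms off at an edge. -/

section HalfTree

variable {F : Type u} [Field F] [ValuativeRel F]

/-- The vertices closer to `z` than to `y`. -/
def halfTree (y z : Vertex F) : Set (Vertex F) := {w | (tree F).dist z w < (tree F).dist y w}

theorem mem_halfTree {y z w : Vertex F} :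
    w ∈ halfTree y z ↔ (tree F).dist z w < (tree F).dist y w := Iff.rfl

theorem toAut_of_mem_vertexK {u : GL (Fin 2) F} {y : Vertex F} (hu : u ∈ vertexK y) :
    toAut u y = y := by
  obtain ⟨L, rfl⟩ := Lat.exists_cls y
  rw [toAut_cls, hu L rfl]

theorem vertexU_le_edgeU {e : ℕ} {x : Vertex F} {η : Edge F} (hx : x ∈ η.1) : vertexU e x ≤ edgeU e η :=
  le_iSup₂_of_le (f := fun x (_ : x ∈ η.1) => vertexU e x) x hx le_rfl

theorem edge_adj {η : Edge F} {x y : Vertex F} (hx : x ∈ η.1) (hy : y ∈ η.1) (hne : x ≠ y) :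
    (tree F).Adj x y := by
  have := η.2
  rwa [(Sym2.mem_and_mem_iff hne).1 ⟨hx, hy⟩] at this

theorem toHatG_mem_hatU {e : ℕ} {η : Edge F} {u : GL (Fin 2) F} (hu : u ∈ edgeU e η) :
    (toHatG F e u : AutTree F) ∈ hatU e η := fun _ => ⟨u, hu, fun _ _ => rfl⟩

theorem right_mem_halfTree {y z : Vertex F} (h : (tree F).Adj y z) : z ∈ halfTree y z := by
  rw [mem_halfTree, SimpleGraph.dist_self, SimpleGraph.dist_eq_one_iff_adj.2 h]
  exact one_pos

theorem aut_mem_halfTree_iff {g : AutTree F} {y z w : Vertex F} (hy : g y = y) (hz : g z = z) :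
    g w ∈ halfTree y z ↔ w ∈ halfTree y z := by
  rw [mem_halfTree, mem_halfTree]
  conv_lhs => rw [← hy, ← hz, dist_aut, dist_aut]

variable [TopologicalSpace F] [IsNonarchimedeanLocalField F]

/-- The only edge that joins the half tree to its complement is `{y, z}`. -/
theorem eq_of_adj_of_mem_halfTree {y z w w' : Vertex F} (hyz : (tree F).Adj y z)
    (hww : (tree F).Adj w w') (hw : w ∈ halfTree y z) (hw' : w' ∉ halfTree y z) :
    w = z ∧ w' = y := by
  rw [mem_halfTree] at hw hw'
  have h1 : ∀ t, (tree F).dist t y = (tree F).dist t z + 1 ∨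
      (tree F).dist t z = (tree F).dist t y + 1 := fun t => dist_adj t hyz.symm
  have h2 := h1 w
  have h3 := h1 w'
  rw [SimpleGraph.dist_comm (u := w) (v := y), SimpleGraph.dist_comm (u := w) (v := z)] at h2
  rw [SimpleGraph.dist_comm (u := w') (v := y), SimpleGraph.dist_comm (u := w') (v := z)] at h3
  have h4 := dist_adj y hww
  have h5 := dist_adj z hww
  -- Otherwise the neighbour `t` of `w` towards `z` and the vertex `w'` are both closer to `y` than
  -- `w` is, so they coincide; but their distances to `z` differ.
  have h6 : (tree F).dist z w = 0 := by
    by_contra h6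
    obtain ⟨t, ht, ht'⟩ := dist_pos_parent (x := z) (z := w) (by
      rintro rfl
      rw [SimpleGraph.dist_self] at h6
      exact h6 rfl)
    have h7 := (tree_connected F).dist_triangle (u := y) (v := z) (w := t)
    rw [SimpleGraph.dist_eq_one_iff_adj.2 hyz] at h7
    have h8 := parent_unique (x := y) ht hww.symm (by omega) (by omega)
    subst h8
    omega
  have h7 := ((tree_connected F).dist_eq_zero_iff).1 h6
  refine ⟨h7.symm, ?_⟩
  have h8 : (tree F).dist y w' = 0 := by omega
  exact (((tree_connected F).dist_eq_zero_iff).1 h8).symm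

/-- A walk between the complement and the half tree has to use the edge `{y, z}`. This bound and the
next two follow by locating that crossing by induction on a shortest walk. -/
theorem dist_le_of_crossing {y z n p : Vertex F} (hyz : (tree F).Adj y z)
    (hn : n ∉ halfTree y z) (hp : p ∈ halfTree y z) :
    (tree F).dist y p ≤ (tree F).dist n p := by
  obtain ⟨q, hq⟩ := (tree_connected F).exists_walk_length_eq_dist n p
  rw [← hq]
  clear hq
  induction q with
  | nil => exact absurd hp hn
  | @cons a b c hab q ih =>
    by_cases hb : b ∈ halfTree y z
    · obtain ⟨-, rfl⟩ := eq_of_adj_of_mem_halfTree hyz hab.symm hb hn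
      exact SimpleGraph.dist_le _
    · refine (ih hb hp).trans ?_
      rw [SimpleGraph.Walk.length_cons]
      exact Nat.le_succ _

theorem dist_add_le_of_crossing {y z n p : Vertex F} (hyz : (tree F).Adj y z)
    (hn : n ∉ halfTree y z) (hp : p ∈ halfTree y z) :
    (tree F).dist n y + 1 + (tree F).dist z p ≤ (tree F).dist n p := by
  obtain ⟨q, hq⟩ := (tree_connected F).exists_walk_length_eq_dist n p
  rw [← hq]
  clear hq
  induction q with
  | nil => exact absurd hp hn
  | @cons a b c hab q ih =>
    rw [SimpleGraph.Walk.length_cons]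
    by_cases hb : b ∈ halfTree y z
    · obtain ⟨rfl, rfl⟩ := eq_of_adj_of_mem_halfTree hyz hab.symm hb hn
      have := SimpleGraph.dist_le q
      rw [SimpleGraph.dist_self]
      omega
    · have h1 := ih hb hp
      have h2 := (tree_connected F).dist_triangle (u := a) (v := b) (w := y)
      rw [SimpleGraph.dist_eq_one_iff_adj.2 hab] at h2
      omega

theorem dist_succ_le_of_crossing {y z n p : Vertex F} (hyz : (tree F).Adj y z)
    (hn : n ∈ halfTree y z) (hp : p ∉ halfTree y z) :
    (tree F).dist y p + 1 ≤ (tree F).dist n p := by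
  obtain ⟨q, hq⟩ := (tree_connected F).exists_walk_length_eq_dist n p
  rw [← hq]
  clear hq
  induction q with
  | nil => exact absurd hn hp
  | @cons a b c hab q ih =>
    rw [SimpleGraph.Walk.length_cons]
    by_cases hb : b ∈ halfTree y z
    · exact (ih hb hp).trans (Nat.le_succ _)
    · obtain ⟨-, rfl⟩ := eq_of_adj_of_mem_halfTree hyz hab hn hb
      exact Nat.succ_le_succ (SimpleGraph.dist_le _)

-- Adjacency could fail only across the boundary of the half tree; the sole edge there is `{y, z}`,
-- whose end points are fixed by `u`.
open Classical in
theorem adj_glue {y z : Vertex F} (hyz : (tree F).Adj y z) (u : AutTree F) (hy : u y = y)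
    (hz : u z = z) {w w' : Vertex F} (h : (tree F).Adj w w') :
    (tree F).Adj (if w ∈ halfTree y z then u w else w)
      (if w' ∈ halfTree y z then u w' else w') := by
  split_ifs with h1 h2 h2
  · exact u.map_rel_iff.2 h
  · obtain ⟨rfl, rfl⟩ := eq_of_adj_of_mem_halfTree hyz h h1 h2
    rw [hz]
    exact h
  · obtain ⟨rfl, rfl⟩ := eq_of_adj_of_mem_halfTree hyz h.symm h2 h1
    rw [hz]
    exact h
  · exact h

open Classical in
/-- The automorphism that is `u` on the half tree and the identity on its complement. -/
def glue {y z : Vertex F} (hyz : (tree F).Adj y z) (u : AutTree F) (hy : u y = y)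
    (hz : u z = z) : AutTree F where
  toFun w := if w ∈ halfTree y z then u w else w
  invFun w := if w ∈ halfTree y z then u⁻¹ w else w
  left_inv w := by
    by_cases h : w ∈ halfTree y z
    · simp only [h, if_true, (aut_mem_halfTree_iff hy hz).2 h, RelIso.inv_apply_self]
    · simp only [h, if_false]
  right_inv w := by
    have hy' : u⁻¹ y = y := by conv_lhs => rw [← hy, RelIso.inv_apply_self]
    have hz' : u⁻¹ z = z := by conv_lhs => rw [← hz, RelIso.inv_apply_self]
    by_cases h : w ∈ halfTree y z
    · simp only [h, if_true, (aut_mem_halfTree_iff hy' hz').2 h, RelIso.apply_inv_self]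
    · simp only [h, if_false]
  map_rel_iff' := by
    intro w w'
    refine ⟨fun h => ?_, adj_glue hyz u hy hz⟩
    have hy' : u⁻¹ y = y := by conv_lhs => rw [← hy, RelIso.inv_apply_self]
    have hz' : u⁻¹ z = z := by conv_lhs => rw [← hz, RelIso.inv_apply_self]
    have h1 := adj_glue hyz u⁻¹ hy' hz' h
    have key : ∀ t, (if (if t ∈ halfTree y z then u t else t) ∈ halfTree y z then
        u⁻¹ (if t ∈ halfTree y z then u t else t) else
          (if t ∈ halfTree y z then u t else t)) = t := by
      intro t
      by_cases h : t ∈ halfTree y z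
      · simp only [h, if_true, (aut_mem_halfTree_iff hy hz).2 h, RelIso.inv_apply_self]
      · simp only [h, if_false]
    simp only [Equiv.coe_fn_mk, key] at h1
    exact h1

theorem glue_of_mem {y z : Vertex F} (hyz : (tree F).Adj y z) (u : AutTree F) (hy : u y = y)
    (hz : u z = z) {w : Vertex F} (hw : w ∈ halfTree y z) : glue hyz u hy hz w = u w :=
  if_pos hw

theorem glue_of_notMem {y z : Vertex F} (hyz : (tree F).Adj y z) (u : AutTree F) (hy : u y = y)
    (hz : u z = z) {w : Vertex F} (hw : w ∉ halfTree y z) : glue hyz u hy hz w = w :=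
  if_neg hw

theorem adj_mem_ball {e : ℕ} [NeZero e] {x y : Vertex F} (h : (tree F).Adj x y) : y ∈ ball e x := by
  rw [mem_ball_iff, SimpleGraph.dist_eq_one_iff_adj.2 h]
  exact NeZero.one_le

/-- An element that fixes `Z^{(e)}(y)` can be cut off at the edge `{y, z}`. -/
theorem exists_cutoff {e : ℕ} [NeZero e] {y z : Vertex F} (hyz : (tree F).Adj y z)
    {u : GL (Fin 2) F} (hu : toAut u ∈ ballStab e y) : ∃ g : hatG F e,
      (∀ w ∈ halfTree y z, (g : AutTree F) w = toAut u w) ∧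
      (∀ w ∉ halfTree y z, (g : AutTree F) w = w) ∧
      (∀ n ∈ halfTree y z, ∀ w ∈ ball e n, (g : AutTree F) w = toAut u w) ∧
      ∀ n ∉ halfTree y z, ∀ w ∈ ball e n, (g : AutTree F) w = w := by
  have hy : toAut u y = y := ballStab_apply_self hu
  have hz : toAut u z = z := hu z (adj_mem_ball hyz)
  set g := glue hyz (toAut u) hy hz
  have h1 : ∀ w ∈ halfTree y z, g w = toAut u w := fun w => glue_of_mem hyz _ hy hz
  have h2 : ∀ w ∉ halfTree y z, g w = w := fun w => glue_of_notMem hyz _ hy hz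
  -- The two descriptions of `g` agree on `Z^{(e)}(y)`, where `u` is the identity; balls of radius
  -- `e` that straddle the boundary are handled by this overlap.
  have h0 : ∀ w ∉ halfTree y z, (tree F).dist y w ≤ e → g w = toAut u w := by
    intro w hw hd
    rw [h2 w hw, hu w (mem_ball_iff.2 hd)]
  have h3 : ∀ n ∈ halfTree y z, ∀ w ∈ ball e n, g w = toAut u w := by
    intro n hn w hw
    by_cases h : w ∈ halfTree y z
    · exact h1 w h
    · refine h0 w h ?_
      have e1 := dist_succ_le_of_crossing hyz hn h
      have e2 := mem_ball_iff.1 hw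
      omega
  have h4 : ∀ n ∉ halfTree y z, ∀ w ∈ ball e n, g w = w := by
    intro n hn w hw
    by_cases h : w ∈ halfTree y z
    · rw [h1 w h]
      exact hu w (mem_ball_iff.2 ((dist_le_of_crossing hyz hn h).trans (mem_ball_iff.1 hw)))
    · exact h2 w h
  -- On `Z^{(e)}(μ)` the automorphism is given by `u` if `μ` meets the half tree, and by `1`
  -- otherwise. If only one end point lies in it, then `μ = {y, z}`.
  refine ⟨⟨g, fun μ => ?_⟩, h1, h2, h3, h4⟩
  by_cases hμ : ∃ n ∈ μ.1, n ∈ halfTree y z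
  · obtain ⟨n, hn, hn'⟩ := hμ
    refine ⟨u, fun w hw => ?_⟩
    obtain ⟨m, hm, hw⟩ := hw
    by_cases hm' : m ∈ halfTree y z
    · exact h3 m hm' w hw
    · have hne : n ≠ m := fun h => hm' (h ▸ hn')
      have hadj : (tree F).Adj n m := by
        have := μ.2
        rwa [(Sym2.mem_and_mem_iff hne).1 ⟨hn, hm⟩] at this
      obtain ⟨rfl, rfl⟩ := eq_of_adj_of_mem_halfTree hyz hadj hn' hm'
      by_cases h : w ∈ halfTree m n
      · exact h1 w h
      · exact h0 w h (mem_ball_iff.1 hw)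
  · push Not at hμ
    refine ⟨1, fun w hw => ?_⟩
    obtain ⟨m, hm, hw⟩ := hw
    rw [map_one]
    exact h4 m (hμ m hm) w hw

end HalfTree

/-! ### The groups `U_η^{(e)}` and `Û_η^{(e)}` in terms of stabilizers of balls. -/

section HatU

variable {F : Type u} [Field F] [ValuativeRel F] [TopologicalSpace F]
  [IsNonarchimedeanLocalField F]

/-- An element that is trivial on `L / 𝔭_F L` preserves every lattice between `𝔭_F L` and `L`. -/
theorem toAut_of_mem_vertexU1 {u : GL (Fin 2) F} {y z : Vertex F} (hu : u ∈ vertexU1 y)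
    (hz : (tree F).Adj y z) : toAut u z = z := by
  obtain ⟨L, rfl⟩ := Lat.exists_cls y
  obtain ⟨M, rfl, h1, h2⟩ := exists_lattices hz
  have key : ∀ g ∈ vertexU1 L.cls, ∀ v ∈ M.toSub, glMap g v ∈ M.toSub := by
    intro g hg v hv
    have h3 := add_mem (h1.le (hg.2 L rfl v (h2.le hv))) hv
    rwa [sub_add_cancel] at h3
  rw [toAut_cls]
  congr 1
  apply Lat.ext'
  apply le_antisymm
  · rintro _ ⟨v, hv, rfl⟩
    exact key u hu v hv
  · intro v hv
    rw [Lat.mem_act]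
    exact key _ (inv_mem hu) v hv

theorem exists_agree_of_mem_hatU {e : ℕ} {η : Edge F} {g : AutTree F} (hg : g ∈ hatU e η) (x : Vertex F) :
    ∃ u ∈ edgeU e η, ∀ y ∈ ball e x, g y = toAut u y := by
  obtain ⟨μ, hμ⟩ := exists_edge x
  obtain ⟨u, hu, h⟩ := hg μ
  exact ⟨u, hu, fun y hy => h y (ball_subset_edgeBall hμ hy)⟩

variable {e : ℕ} [NeZero e]

/-- Each `U_y^{(1)}` fixes the neighbours of `y` too, so the intersection over the radius `e - 1`
fixes the ball of radius `e`. -/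
theorem toAut_mem_ballStab {u : GL (Fin 2) F} {x : Vertex F} (hu : u ∈ vertexU e x) :
    toAut u ∈ ballStab e x := by
  have he : 1 ≤ e := NeZero.one_le
  rw [vertexU] at hu
  have hu' : ∀ y, (tree F).dist x y ≤ e - 1 → u ∈ vertexU1 y := fun y hy =>
    Subgroup.mem_iInf.1 (Subgroup.mem_iInf.1 hu y) (mem_ball_iff.2 hy)
  intro w hw
  rw [mem_ball_iff] at hw
  by_cases h : w = x
  · subst h
    exact toAut_of_mem_vertexK (hu' w (by simp)).1
  · obtain ⟨y, hy, hd⟩ := dist_pos_parent h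
    exact toAut_of_mem_vertexU1 (hu' y (by omega)) hy

/-- Together with `toAut_mem_ballStab` this identifies, in `Aut(X)`, the image of `U_x^{(e)}` with
that of the stabilizer of `Z^{(e)}(x)` in `GL₂(F)`. -/
theorem exists_mem_vertexU {g : GL (Fin 2) F} {x : Vertex F} (hg : toAut g ∈ ballStab e x) :
    ∃ z ∈ Subgroup.center (GL (Fin 2) F), ∃ u ∈ vertexU e x, g = z * u ∧ toAut u = toAut g := by
  obtain ⟨z, hz, u, hu, rfl⟩ := exists_scalar_mul hg
  refine ⟨z, hz, u, hu, rfl, ?_⟩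
  rw [Matrix.GeneralLinearGroup.center_eq_range_scalar] at hz
  obtain ⟨c, rfl⟩ := hz
  ext y
  rw [toAut_mul_apply]
  exact (toAut_sc c _).symm

theorem toAut_of_mem_edgeU {η : Edge F} {u : GL (Fin 2) F} (hu : u ∈ edgeU e η) {x : Vertex F}
    (hx : x ∈ η.1) : toAut u x = x := by
  have key : edgeU e η ≤ (MulAction.stabilizer (AutTree F) x).comap toAut := by
    refine iSup₂_le fun y hy u hu => ?_
    change toAut u x = x
    have h1 := toAut_mem_ballStab hu
    by_cases h : y = x
    · subst h
      exact ballStab_apply_self h1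
    · exact h1 x (adj_mem_ball (edge_adj hy hx h))
  exact key hu

/-- An automorphism in `Ĝ^{(e)}` that fixes `Z^{(e)}(x)` is given on each `Z^{(e)}(z)` by an
element of `GL₂(F)` that fixes `Z^{(e)}(x)`. -/
theorem exists_agree_mem_ballStab (g : hatG F e) {x : Vertex F}
    (hg : (g : AutTree F) ∈ ballStab e x) (z : Vertex F) : ∃ h : GL (Fin 2) F,
      toAut h ∈ ballStab e x ∧ (∀ w ∈ ball e z, (g : AutTree F) w = toAut h w) ∧
      ∀ y, (tree F).Adj y z → (tree F).dist x y ≤ (tree F).dist x z →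
        ∀ w ∈ ball e y, (g : AutTree F) w = toAut h w := by
  obtain ⟨n, hn⟩ : ∃ n, (tree F).dist x z = n := ⟨_, rfl⟩
  induction n generalizing z with
  | zero =>
    obtain rfl := ((tree_connected F).dist_eq_zero_iff).1 hn
    refine ⟨1, by rw [map_one]; exact one_mem _, fun w hw => by rw [map_one]; exact hg w hw, ?_⟩
    intro y hy hd
    have := dist_succ_of_le hy hd
    omega
  | succ n ih =>
    obtain ⟨m, hm, hd⟩ := dist_pos_parent (x := x) (z := z) (by
      rintro rfl
      rw [SimpleGraph.dist_self] at hn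
      omega)
    -- If `h1` serves at the neighbour `m` towards `x`, then `h1⁻¹ g` fixes `Z^{(e)}(m)` and is a
    -- matrix `h2` near `{m, z}`. Replacing `h2` by a matrix `h3` that also fixes `Z^{(e)}(x)` gives
    -- `h1 * h3`. It still agrees with `g` on `Z^{(e)}(m)`, which is the last clause: one matrix
    -- serves the whole edge.
    obtain ⟨h1, e1, e2, -⟩ := ih m (by omega)
    obtain ⟨h2, e3⟩ := ((toHatG F e h1)⁻¹ * g).2 ⟨s(m, z), hm⟩
    have e4 : ∀ w, (((toHatG F e h1)⁻¹ * g : hatG F e) : AutTree F) w =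
        toAut h1⁻¹ ((g : AutTree F) w) := fun w => by
      rw [map_inv]
      rfl
    have e5 : toAut h2 ∈ ballStab e m := by
      intro w hw
      rw [← e3 w ⟨m, Sym2.mem_mk_left _ _, hw⟩, e4, e2 w hw, toAut_inv_apply_self]
    obtain ⟨h3, e6, e7, e8⟩ := exists_mem_ballStab_inf (x := x) hm (by omega) e5
    have e9 : ∀ w ∈ ball e m, (g : AutTree F) w = toAut (h1 * h3) w := by
      intro w hw
      rw [toAut_mul_apply, e6 w hw, e2 w hw]
    refine ⟨h1 * h3, ?_, ?_, ?_⟩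
    · rw [map_mul]
      exact mul_mem e1 e7
    · intro w hw
      rw [toAut_mul_apply, e8 w hw, ← e3 w ⟨z, Sym2.mem_mk_right _ _, hw⟩, e4,
        toAut_apply_inv_self]
    · intro y hy hd'
      obtain rfl := parent_unique hy hm hd' (by omega)
      exact e9

/-- Allows every edge to be oriented away from `x`. -/
theorem edge_ind {P : Edge F → Prop} (x : Vertex F)
    (h : ∀ (y z : Vertex F) (hyz : (tree F).Adj y z), (tree F).dist x z = (tree F).dist x y + 1 →
      P ⟨s(y, z), hyz⟩) (η : Edge F) : P η := by
  obtain ⟨η, hη⟩ := η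
  induction η using Sym2.ind with
  | _ a b =>
    rcases dist_adj x hη with h1 | h1
    · exact h a b hη h1
    · have e1 : (⟨s(a, b), hη⟩ : Edge F) = ⟨s(b, a), (show (tree F).Adj a b from hη).symm⟩ :=
        Subtype.ext Sym2.eq_swap
      rw [e1]
      exact h b a _ h1

/-- The element of `U_η^{(e)}` required in the definition of `Û_η^{(e)}` may vary with `μ`. By
`exists_agree_mem_ballStab` it can be taken, for each `μ`, to fix `Z^{(e)}(x)`, and then, up to the
centre, in `U_x^{(e)}`. -/
theorem mem_hatU_of_mem_ballStab (g : hatG F e) {x : Vertex F} {η : Edge F} (hx : x ∈ η.1)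
    (hg : (g : AutTree F) ∈ ballStab e x) : (g : AutTree F) ∈ hatU e η := by
  intro μ
  induction μ using edge_ind x with
  | _ y z hyz hd =>
    obtain ⟨h, h1, h2, h3⟩ := exists_agree_mem_ballStab g hg z
    obtain ⟨-, -, u, hu, -, hu'⟩ := exists_mem_vertexU h1
    refine ⟨u, vertexU_le_edgeU hx hu, ?_⟩
    rintro w ⟨t, ht, hw⟩
    rw [hu']
    rcases Sym2.mem_iff.1 ht with rfl | rfl
    · exact h3 t hyz (by omega) w hw
    · exact h2 w hw

end HatU

/-! ### The maps `𝓕(x) → H_0(X, 𝓕)`. -/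

section Homology

variable {F : Type u} [Field F] [ValuativeRel F]
variable {Λ : Type v} [CommRing Λ]

/-- The submodule of `H_0(X, 𝓕)` generated by the chains supported on `Z^{(n)}(x)`. -/
def ballSpan (S : GSystem.{u, v, w} F Λ) (n : ℕ) (x : Vertex F) : Submodule Λ S.H0 :=
  ⨆ z : {z : Vertex F // (tree F).dist x z ≤ n}, LinearMap.range (S.toH0 z.1)

theorem range_toH0_le_ballSpan (S : GSystem.{u, v, w} F Λ) {n : ℕ} {x z : Vertex F}
    (h : (tree F).dist x z ≤ n) : LinearMap.range (S.toH0 z) ≤ ballSpan S n x :=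
  le_iSup (fun z : {z : Vertex F // (tree F).dist x z ≤ n} => LinearMap.range (S.toH0 z.1)) ⟨z, h⟩

theorem sum_toFinset_attach {M : Type*} [AddCommMonoid M] {x y : Vertex F} {η : Edge F}
    (hx : x ∈ η.1) (hy : y ∈ η.1) (hne : x ≠ y) (f : {z // z ∈ η.1.toFinset} → M) :
    ∑ z ∈ η.1.toFinset.attach, f z =
      f ⟨x, Sym2.mem_toFinset.2 hx⟩ + f ⟨y, Sym2.mem_toFinset.2 hy⟩ := by
  have h1 : η.1.toFinset.attach =
      {⟨x, Sym2.mem_toFinset.2 hx⟩, ⟨y, Sym2.mem_toFinset.2 hy⟩} := by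
    ext ⟨w, hw⟩
    rw [Sym2.mem_toFinset, (Sym2.mem_and_mem_iff hne).1 ⟨hx, hy⟩] at hw
    simpa using hw
  rw [h1, Finset.sum_pair (fun h => hne (congrArg Subtype.val h))]

namespace CoeffSystem

variable (S : CoeffSystem.{u, v, w} F Λ)

theorem boundary_lof_apply_of_mem (η : Edge F) (f : S.E η) {z : Vertex F} (hz : z ∈ η.1) :
    S.boundary (DirectSum.lof Λ (Edge F) (fun η => S.E η) η f) z = S.r η z hz f := by
  rw [boundary_lof, DFinsupp.finsetSum_apply,
    Finset.sum_eq_single ⟨z, Sym2.mem_toFinset.2 hz⟩]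
  · exact DirectSum.of_eq_same _ _
  · intro y _ hy
    refine DirectSum.of_eq_of_ne _ _ _ fun h => hy ?_
    exact Subtype.ext h.symm
  · intro h
    exact absurd (Finset.mem_attach _ _) h

theorem boundary_lof_apply_of_notMem (η : Edge F) (f : S.E η) {z : Vertex F} (hz : z ∉ η.1) :
    S.boundary (DirectSum.lof Λ (Edge F) (fun η => S.E η) η f) z = 0 := by
  rw [boundary_lof, DFinsupp.finsetSum_apply]
  refine Finset.sum_eq_zero fun y _ => ?_
  refine DirectSum.of_eq_of_ne _ _ _ fun h => hz ?_
  rw [h]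
  exact Sym2.mem_toFinset.1 y.2

theorem toH0_r_add {y z : Vertex F} (η : Edge F) (hy : y ∈ η.1) (hz : z ∈ η.1) (hne : y ≠ z)
    (f : S.E η) : S.toH0 y (S.r η y hy f) + S.toH0 z (S.r η z hz f) = 0 := by
  rw [← S.sum_toH0 η f, sum_toFinset_attach hy hz hne]

theorem iSup_range_toH0 : ⨆ x, LinearMap.range (S.toH0 x) = ⊤ := by
  rw [eq_top_iff]
  rintro v -
  obtain ⟨c, rfl⟩ := Submodule.mkQ_surjective _ v
  induction c using DirectSum.induction_on with
  | zero => rw [map_zero]; exact zero_mem _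
  | of x f =>
    exact Submodule.mem_iSup_of_mem (p := fun x => LinearMap.range (S.toH0 x)) x ⟨f, rfl⟩
  | add a b ha hb => rw [map_add]; exact add_mem ha hb

end CoeffSystem

theorem exists_mem_ballSpan (S : GSystem.{u, v, w} F Λ) (x : Vertex F) (v : S.H0) :
    ∃ n, v ∈ ballSpan S n x := by
  have hv : v ∈ ⨆ x, LinearMap.range (S.toH0 x) := by
    rw [CoeffSystem.iSup_range_toH0]
    trivial
  rw [Submodule.mem_iSup_iff_exists_finsupp] at hv
  obtain ⟨f, hf, rfl⟩ := hv
  refine ⟨f.support.sup ((tree F).dist x), sum_mem fun z hz => ?_⟩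
  exact range_toH0_le_ballSpan S (Finset.le_sup hz) (hf z)

/-- By the generation axiom, an inclusion for `𝓕(x)` can be tested on translates of the image of
`𝓕(η)`. -/
theorem range_toH0_le {e : ℕ} {S : GSystem.{u, v, w} F Λ} (hS : S.IsLevel e) {η : Edge F} {x : Vertex F} (hx : x ∈ η.1)
    {M : Submodule Λ S.H0} (h : ∀ (k : GL (Fin 2) F) (hk : toAut k x = x) (f : S.E η),
      S.toH0 x (S.actV k x x hk (S.r η x hx f)) ∈ M) : LinearMap.range (S.toH0 x) ≤ M := by
  rintro _ ⟨f, rfl⟩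
  have h1 : ⊤ ≤ M.comap (S.toH0 x) := by
    rw [← hS.generates η x hx, Submodule.span_le]
    rintro _ ⟨k, -, hk, _, ⟨f, rfl⟩, rfl⟩
    exact h k hk f
  exact h1 trivial

/-- The vertex of `η` that is further away from `x`, and the one that is closer to `x`. -/
theorem exists_far [TopologicalSpace F] [IsNonarchimedeanLocalField F] (x : Vertex F)
    (η : Edge F) : ∃ z : Vertex F, z ∈ η.1 ∧ ∃ y, (tree F).Adj y z ∧ η.1 = s(y, z) ∧
      (tree F).dist x z = (tree F).dist x y + 1 := by
  induction η using edge_ind x with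
  | _ y z hyz hd => exact ⟨z, Sym2.mem_mk_right _ _, y, hyz, rfl, hd⟩

-- Let `f` at `x` be the boundary of `b ≠ 0`. Take an edge in the support of `b` whose far vertex
-- has maximal distance from `x`. No other edge of the support contains this vertex, so the boundary
-- is nonzero there by injectivity of `r`; but the far vertex is not `x`. Hence `b = 0` and `f = 0`.
open Classical in
theorem CoeffSystem.toH0_injective [TopologicalSpace F] [IsNonarchimedeanLocalField F]
    (S : CoeffSystem.{u, v, w} F Λ)
    (hS : ∀ (η : Edge F) (z : Vertex F) (hz : z ∈ η.1), Function.Injective (S.r η z hz))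
    (x : Vertex F) : Function.Injective (S.toH0 x) := by
  rw [← LinearMap.ker_eq_bot, LinearMap.ker_eq_bot']
  intro f hf
  obtain ⟨b, hb⟩ : DirectSum.lof Λ (Vertex F) (fun x => S.V x) x f ∈ LinearMap.range S.boundary :=
    (Submodule.Quotient.mk_eq_zero _).1 hf
  have hb0 : b = 0 := by
    by_contra hne
    have hsupp : (DFinsupp.support b).Nonempty := by
      rw [Finset.nonempty_iff_ne_empty]
      exact fun h => hne (DFinsupp.support_eq_empty.1 h)
    choose far hfar par hpar heq hdist using exists_far (F := F) x
    obtain ⟨η, hη, hmax⟩ :=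
      Finset.exists_max_image (DFinsupp.support b) (fun η => (tree F).dist x (far η)) hsupp
    rw [DFinsupp.mem_support_iff] at hη
    have h1 : S.boundary b (far η) = S.r η (far η) (hfar η) (b η) := by
      conv_lhs => rw [← DirectSum.sum_support_of b, map_sum, DFinsupp.finsetSum_apply]
      rw [Finset.sum_eq_single η]
      · exact S.boundary_lof_apply_of_mem η (b η) (hfar η)
      · intro θ hθ hne'
        refine S.boundary_lof_apply_of_notMem θ (b θ) fun hmem => hne' ?_
        rw [heq θ, Sym2.mem_iff] at hmem
        rcases hmem with hmem | hmem
        · have h2 := hmax θ hθ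
          rw [hdist θ, ← hmem] at h2
          omega
        · have h2 := parent_unique (x := x) (hpar η) (hmem ▸ hpar θ)
            (by rw [hdist η]; omega) (by rw [hmem, hdist θ]; omega)
          refine Subtype.ext ?_
          rw [heq η, heq θ, h2, hmem]
      · intro h
        rw [DFinsupp.notMem_support_iff] at h
        exact absurd h hη
    rw [hb] at h1
    have h2 : DirectSum.lof Λ (Vertex F) (fun x => S.V x) x f (far η) = 0 := by
      refine DirectSum.of_eq_of_ne _ _ _ fun h => ?_
      have := hdist η
      rw [h, SimpleGraph.dist_self] at this
      omega
    rw [h2] at h1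
    exact hη (hS η _ (hfar η) (by rw [← h1, map_zero]))
  rw [hb0, map_zero] at hb
  have h1 := congrArg (fun c => c x) hb
  have h2 : DirectSum.lof Λ (Vertex F) (fun x => S.V x) x f x = f := DirectSum.of_eq_same _ _
  exact (h2.symm.trans h1.symm)

end Homology

/-! ### Invariants in `H_0(X, 𝓕)`. -/

section Invariants

variable {F : Type u} [Field F] [ValuativeRel F] [TopologicalSpace F]
  [IsNonarchimedeanLocalField F]
variable {Λ : Type v} [CommRing Λ] {e : ℕ} {S : GSystem.{u, v, w} F Λ}

theorem isC0.toH0_injective (hS : isC0 F Λ e S) (x : Vertex F) :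
    Function.Injective (S.toH0 x) :=
  S.toCoeffSystem.toH0_injective hS.2.1.injective x

variable [NeZero e]

theorem H0ρ_toH0 (hS : isC0 F Λ e S) (g : hatG F e) (x y : Vertex F) (g' : GL (Fin 2) F)
    (h : ∀ z ∈ ball e x, (g : AutTree F) z = toAut g' z)
    (hx : toAut g' x = y) (f : S.V x) :
    H0ρ hS g (S.toH0 x f) = S.toH0 y (S.actV g' x y hx f) := H0act_toH0_eq hS g x y g' h hx f

theorem H0ρ_toH0_of_fix (hS : isC0 F Λ e S) (g : hatG F e) (x : Vertex F)
    (h : (g : AutTree F) ∈ ballStab e x) (f : S.V x) :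
    H0ρ hS g (S.toH0 x f) = S.toH0 x f := by
  rw [H0ρ_toH0 hS g x x 1 (fun z hz => by rw [map_one]; exact h z hz) (by rw [map_one]; rfl),
    hS.1.oneV]

/-- The stabilizer in `GL₂(F)` of an element of `𝓕(z)`. -/
def stabV (hS : S.IsEquivariant) (z : Vertex F) (f : S.V z) : Subgroup (GL (Fin 2) F) where
  carrier := {u | ∃ h : toAut u z = z, S.actV u z z h f = f}
  one_mem' := ⟨by rw [map_one]; rfl, hS.oneV z _ f⟩
  mul_mem' := by
    rintro g h ⟨hg, hg'⟩ ⟨hh, hh'⟩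
    refine ⟨by rw [toAut_mul_apply, hh, hg], ?_⟩
    rw [← hS.mulV g h z z z hh hg, hh', hg']
  inv_mem' := by
    rintro g ⟨hg, hg'⟩
    have h1 : toAut g⁻¹ z = z := by conv_lhs => rw [← hg, toAut_inv_apply_self]
    refine ⟨h1, ?_⟩
    conv_lhs => rw [← hg']
    have h2 : toAut (g⁻¹ * g) z = z := by rw [inv_mul_cancel, map_one]; rfl
    rw [hS.mulV g⁻¹ g z z z hg h1 h2]
    have h3 : ∀ (k : GL (Fin 2) F) (hk : toAut k z = z), k = 1 → S.actV k z z hk f = f := by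
      rintro _ hk rfl
      exact hS.oneV z hk f
    exact h3 _ _ (inv_mul_cancel g)

/-- To lie in the image of `𝓕(η)`, for `η = {y, z}`, it suffices to be invariant under
`U_y^{(e)}`. -/
theorem mem_range_r_of_vertexU (hS : isC0 F Λ e S) {y z : Vertex F} (hyz : (tree F).Adj y z)
    (f : S.V z) (hf : ∀ u ∈ vertexU e y, ∀ h : toAut u z = z, S.actV u z z h f = f) :
    f ∈ LinearMap.range (S.r ⟨s(y, z), hyz⟩ z (Sym2.mem_mk_right _ _)) := by
  rw [hS.2.1.range]
  have key : edgeU e ⟨s(y, z), hyz⟩ ≤ stabV hS.1 z f := by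
    refine iSup₂_le fun t ht u hu => ?_
    have huz : toAut u z = z := toAut_of_mem_edgeU (vertexU_le_edgeU ht hu) (Sym2.mem_mk_right _ _)
    refine ⟨huz, ?_⟩
    rcases Sym2.mem_iff.1 ht with rfl | rfl
    · exact hf u hu huz
    · exact hS.2.1.trivialV _ u hu huz f
  intro u hu h
  exact (key hu).2

theorem ballSpan_zero (S : GSystem.{u, v, w} F Λ) (x : Vertex F) :
    ballSpan S 0 x = LinearMap.range (S.toH0 x) := by
  refine le_antisymm (iSup_le fun z => ?_) (range_toH0_le_ballSpan S (by simp))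
  obtain ⟨z, hz⟩ := z
  obtain rfl := ((tree_connected F).dist_eq_zero_iff).1 (Nat.le_zero.1 hz)
  exact le_rfl

/-- The descent step behind the bijectivity of the unit. An outermost term at `z` is shown to be
invariant under `U_y^{(e)}`, for the neighbour `y` of `z` towards `x`, by means of cut-off
automorphisms that leave all other terms alone. It then comes from the edge `{y, z}`, and modulo
boundaries it can be moved to `y`. -/
theorem mem_ballSpan_of_invariant (hS : isC0 F Λ e S) (x : Vertex F) (n : ℕ) (v : S.H0)
    (hinv : ∀ g : hatG F e, (g : AutTree F) ∈ ballStab e x → H0ρ hS g v = v)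
    (hv : v ∈ ballSpan S (n + 1) x) : v ∈ ballSpan S n x := by
  rw [ballSpan, Submodule.mem_iSup_iff_exists_finsupp] at hv
  obtain ⟨c, hc, hcv⟩ := hv
  choose f hf using hc
  have hsum : v = ∑ t ∈ c.support, S.toH0 t.1 (f t) := by
    rw [← hcv, Finsupp.sum]
    exact Finset.sum_congr rfl fun t _ => (hf t).symm
  rw [hsum]
  refine sum_mem fun z hz => ?_
  rcases Nat.lt_or_ge ((tree F).dist x z.1) (n + 1) with hlt | hge
  · exact range_toH0_le_ballSpan S (Nat.le_of_lt_succ hlt) ⟨_, rfl⟩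
  have hzd : (tree F).dist x z.1 = n + 1 := le_antisymm z.2 hge
  obtain ⟨y, hy, hd⟩ := dist_pos_parent (x := x) (z := z.1) (by
    intro h
    rw [h, SimpleGraph.dist_self] at hzd
    omega)
  have hx : x ∉ halfTree y z.1 := by
    rw [mem_halfTree, SimpleGraph.dist_comm, SimpleGraph.dist_comm (u := y)]
    omega
  have hmem : f z ∈ LinearMap.range (S.r ⟨s(y, z.1), hy⟩ z.1 (Sym2.mem_mk_right _ _)) := by
    refine mem_range_r_of_vertexU hS hy _ fun u hu huz => ?_
    -- Here `u'` acts on `Z^{(e)}(z)` as `u` does, so it has the same effect on `𝓕(z)`. That it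
    -- fixes `Z^{(e)}(y)` permits cutting it off at `{y, z}`; the result `g` fixes `Z^{(e)}(x)`
    -- because `x` lies outside the half tree.
    obtain ⟨u', h1, h2, h3⟩ :=
      exists_mem_ballStab_inf (x := x) hy (by omega) (toAut_mem_ballStab hu)
    obtain ⟨g, g1, g2, g3, g4⟩ := exists_cutoff hy h1
    have hu'z : toAut u' z.1 = z.1 := by rw [h3 _ (self_mem_ball e _), huz]
    have hgx : (g : AutTree F) ∈ ballStab e x := g4 x hx
    have hgz : H0ρ hS g (S.toH0 z.1 (f z)) = S.toH0 z.1 (S.actV u' z.1 z.1 hu'z (f z)) :=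
      H0ρ_toH0 hS g z.1 z.1 u' (g3 z.1 (right_mem_halfTree hy)) hu'z (f z)
    -- Since `d(x, z) = n + 1`, the vertex `z` is the only one of `Z^{(n+1)}(x)` in the half tree
    -- beyond `y`.
    have hgt : ∀ t ∈ c.support, t ≠ z → H0ρ hS g (S.toH0 t.1 (f t)) = S.toH0 t.1 (f t) := by
      intro t _ ht
      refine H0ρ_toH0_of_fix hS g t.1 (g4 t.1 fun ht' => ht ?_) _
      have h5 := dist_add_le_of_crossing hy hx ht'
      have h6 := t.2
      have h7 : (tree F).dist z.1 t.1 = 0 := by omega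
      exact Subtype.ext (((tree_connected F).dist_eq_zero_iff).1 h7).symm
    have h4 := hinv g hgx
    rw [hsum, map_sum, ← Finset.add_sum_erase _ _ hz, ← Finset.add_sum_erase _ _ hz,
      Finset.sum_congr rfl (fun t ht => hgt t (Finset.mem_of_mem_erase ht)
        (Finset.ne_of_mem_erase ht)), add_left_inj, hgz] at h4
    rw [actV_congr hS (fun w hw => (h3 w hw).symm) huz hu'z]
    exact hS.toH0_injective z.1 h4
  obtain ⟨b, hb⟩ := hmem
  -- The boundary of `b` says that the class of `f z` is the negative of a class supported at `y`.
  have h1 := S.toH0_r_add ⟨s(y, z.1), hy⟩ (Sym2.mem_mk_left _ _) (Sym2.mem_mk_right _ _) hy.ne b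
  rw [hb] at h1
  rw [eq_neg_of_add_eq_zero_right h1]
  exact neg_mem (range_toH0_le_ballSpan S (by omega) ⟨_, rfl⟩)

/-- The elements of `H_0(X, 𝓕)` that are invariant under the automorphisms fixing `Z^{(e)}(x)` come
from `𝓕(x)`. -/
theorem exists_toH0_eq_of_invariant (hS : isC0 F Λ e S) (x : Vertex F) (v : S.H0)
    (hinv : ∀ g : hatG F e, (g : AutTree F) ∈ ballStab e x → H0ρ hS g v = v) :
    ∃ f, S.toH0 x f = v := by
  obtain ⟨n, hn⟩ := exists_mem_ballSpan S x v
  induction n with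
  | zero =>
    rw [ballSpan_zero] at hn
    exact hn
  | succ n ih => exact ih (mem_ballSpan_of_invariant hS x n v hinv hn)

/-- Invariance under the automorphisms fixing `Z^{(e)}(x)` yields a vector of `𝓕(x)`. Invariance
under `U_η^{(e)}` then places it in the image of `𝓕(η)`, by the axiom on that image and the
injectivity of `𝓕(x) → H_0`. -/
theorem mem_edgeInv_H0_iff (hS : isC0 F Λ e S) {η : Edge F} {x : Vertex F} (hx : x ∈ η.1)
    (v : S.H0) : v ∈ edgeInv.{u, v, w} (Rep.of (H0ρ hS)) η ↔
      ∃ f, S.toH0 x (S.r η x hx f) = v := by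
  constructor
  · intro hv
    obtain ⟨f, rfl⟩ := exists_toH0_eq_of_invariant hS x v fun g hg =>
      hv g (mem_hatU_of_mem_ballStab g hx hg)
    have hf : f ∈ LinearMap.range (S.r η x hx) := by
      rw [hS.2.1.range]
      intro u hu h
      have h1 : H0ρ hS (toHatG F e u) (S.toH0 x f) = S.toH0 x f := hv _ (toHatG_mem_hatU hu)
      rw [H0ρ_toH0 hS (toHatG F e u) x x u (fun _ _ => rfl) h] at h1
      exact hS.toH0_injective x h1
    obtain ⟨f', rfl⟩ := hf
    exact ⟨f', rfl⟩
  · rintro ⟨f, rfl⟩ g hg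
    obtain ⟨u, hu, h⟩ := exists_agree_of_mem_hatU hg x
    have hux : toAut u x = x := toAut_of_mem_edgeU hu hx
    change H0ρ hS g _ = _
    rw [H0ρ_toH0 hS g x x u h hux]
    congr 1
    exact (hS.2.1.range η x hx _).1 ⟨f, rfl⟩ u hu hux

/-- For `k` fixing `x`, the `k`-translate of `𝓕(η)` consists of invariants for the edge `kη`, which
again contains `x`; such translates generate `𝓕(x)`. -/
theorem vertexSum_H0 (hS : isC0 F Λ e S) (x : Vertex F) :
    vertexSum.{u, v, w} (Rep.of (H0ρ hS)) x = LinearMap.range (S.toH0 x) := by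
  apply le_antisymm
  · refine iSup₂_le fun η hη v hv => ?_
    obtain ⟨f, rfl⟩ := (mem_edgeInv_H0_iff hS hη v).1 hv
    exact ⟨_, rfl⟩
  · obtain ⟨η, hη⟩ := exists_edge x
    refine range_toH0_le hS.2.1 hη fun k hkx f => ?_
    have h1 : S.toH0 x (S.actV k x x hkx (S.r η x hη f)) =
        H0ρ hS (toHatG F e k) (S.toH0 x (S.r η x hη f)) :=
      (H0ρ_toH0 hS (toHatG F e k) x x k (fun _ _ => rfl) hkx _).symm
    rw [h1]
    refine edgeInv_le_vertexSum.{u, v, w} (Rep.of (H0ρ hS)) (η := (toAut k).mapEdgeSet η)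
      (Sym2.mem_map.2 ⟨x, hη, hkx⟩) ?_
    exact edgeInv_act (Rep.of (H0ρ hS)) k rfl ((mem_edgeInv_H0_iff hS hη _).2 ⟨f, rfl⟩)

theorem exists_toAut_eq (x y : Vertex F) : ∃ g : GL (Fin 2) F, toAut g x = y := by
  obtain ⟨g, rfl⟩ := exists_toAut_stdVertex x
  obtain ⟨h, rfl⟩ := exists_toAut_stdVertex y
  exact ⟨h * g⁻¹, by rw [toAut_mul_apply, toAut_inv_apply_self]⟩

/-- Generation holds because `GL₂(F)` is transitive on vertices, so every vertex lies on a translate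
of `σ`. Smoothness holds because each class is supported on finitely many vertices. -/
theorem isR0_H0 (hS : isC0 F Λ e S) (σ : Edge F) :
    isR0.{u, v, w} F Λ e σ (Rep.of (H0ρ hS)) := by
  constructor
  · rw [eq_top_iff]
    rintro v -
    have hv : v ∈ ⨆ x, LinearMap.range (S.toH0 x) := by
      rw [CoeffSystem.iSup_range_toH0]
      trivial
    refine (iSup_le fun x => ?_ : ⨆ x, LinearMap.range (S.toH0 x) ≤ _) hv
    obtain ⟨y, hy, -⟩ := exists_far (F := F) x σ
    obtain ⟨g, hg⟩ := exists_toAut_eq y x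
    have hxη : x ∈ ((toAut g).mapEdgeSet σ).1 := Sym2.mem_map.2 ⟨y, hy, hg⟩
    refine range_toH0_le hS.2.1 hxη fun k hkx f => ?_
    have h1 : S.toH0 x (S.actV k x x hkx (S.r _ x hxη f)) =
        H0ρ hS (toHatG F e k) (S.toH0 x (S.r _ x hxη f)) :=
      (H0ρ_toH0 hS (toHatG F e k) x x k (fun _ _ => rfl) hkx _).symm
    apply Submodule.subset_span
    have h2 : S.toH0 x (S.r _ x hxη f) ∈
        edgeInv.{u, v, w} (Rep.of (H0ρ hS)) ((toAut g).mapEdgeSet σ) :=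
      (mem_edgeInv_H0_iff hS hxη _).2 ⟨f, rfl⟩
    have h3 : (toAut g⁻¹).mapEdgeSet ((toAut g).mapEdgeSet σ) = σ := by
      rw [← mapEdgeSet_mul, ← map_mul, inv_mul_cancel, map_one, mapEdgeSet_one]
    refine ⟨toHatG F e (k * g), _, edgeInv_act (Rep.of (H0ρ hS)) g⁻¹ h3 h2, ?_⟩
    rw [← Module.End.mul_apply, ← map_mul, ← map_mul, mul_inv_cancel_right]
    exact h1.symm
  · intro v
    have hv : v ∈ ⨆ x, LinearMap.range (S.toH0 x) := by
      rw [CoeffSystem.iSup_range_toH0]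
      trivial
    rw [Submodule.mem_iSup_iff_exists_finsupp] at hv
    obtain ⟨c, hc, rfl⟩ := hv
    obtain ⟨y, hy, -⟩ := exists_far (F := F) (stdVertex F) σ
    -- The radius is such that `g` fixes `Z^{(e)}(x)`, and not merely `x`, for every `x` in the
    -- support.
    refine ⟨c.support.sup ((tree F).dist y) + e, fun g _ hg => ?_⟩
    change H0ρ hS g _ = _
    rw [Finsupp.sum, map_sum]
    refine Finset.sum_congr rfl fun x hx => ?_
    obtain ⟨f, hf⟩ := hc x
    rw [← hf]
    refine H0ρ_toH0_of_fix hS g x (fun w hw => hg w ⟨y, hy, ?_⟩) f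
    rw [mem_ball_iff] at hw ⊢
    exact ((tree_connected F).dist_triangle (v := x)).trans
      (add_le_add (Finset.le_sup (f := (tree F).dist y) hx) hw)

end Invariants

/-! ### Transitivity on the edges at a vertex, and local finiteness. -/

section TransitiveAction

open ValuativeRel

variable {F : Type u} [Field F] [ValuativeRel F]

theorem intGL_le_vertexK : intGL F ≤ vertexK (stdVertex F) := by
  intro k hk L hL
  obtain ⟨c, hc⟩ := Lat.cls_eq.1 hL.symm
  apply Lat.ext'
  simp only [Lat.act, hc, map_usmul]
  congr 1
  exact congrArg Lat.toSub hk

theorem toAut_center {z : GL (Fin 2) F} (hz : z ∈ Subgroup.center (GL (Fin 2) F)) :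
    toAut z = 1 := by
  rw [Matrix.GeneralLinearGroup.center_eq_range_scalar] at hz
  obtain ⟨c, rfl⟩ := hz
  ext x
  exact toAut_sc c x

theorem exists_edge_eq {x : Vertex F} {η : Edge F} (hx : x ∈ η.1) :
    ∃ y, ∃ hxy : (tree F).Adj x y, η = ⟨s(x, y), hxy⟩ := by
  obtain ⟨η, hη⟩ := η
  obtain ⟨y, rfl⟩ := Sym2.mem_iff_exists.1 hx
  exact ⟨y, hη, rfl⟩

variable [TopologicalSpace F] [IsNonarchimedeanLocalField F]

/-- `K_x` acts transitively on the edges at `x`. -/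
theorem exists_mem_vertexK_edge {x : Vertex F} {η θ : Edge F} (hη : x ∈ η.1) (hθ : x ∈ θ.1) :
    ∃ k ∈ vertexK x, (toAut k).mapEdgeSet η = θ := by
  obtain ⟨g, rfl⟩ := exists_toAut_stdVertex x
  obtain ⟨y, hy, rfl⟩ := exists_edge_eq hη
  obtain ⟨z, hz, rfl⟩ := exists_edge_eq hθ
  have key : ∀ y, (tree F).Adj (toAut g (stdVertex F)) y → ∃ k ∈ intGL F,
      y = toAut (g * k) (stdLine F 1) := by
    intro y hy
    rw [← toAut_apply_inv_self g y, adj_toAut_iff] at hy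
    obtain ⟨k, hk, hk'⟩ := adj_stdVertex' hy
    exact ⟨k, hk, by rw [toAut_mul_apply, ← hk', toAut_apply_inv_self]⟩
  obtain ⟨k, hk, rfl⟩ := key y hy
  obtain ⟨l, hl, rfl⟩ := key z hz
  have h1 : g * (l * k⁻¹) * g⁻¹ ∈ vertexK (toAut g (stdVertex F)) := by
    have := vertexK_conj (g := g⁻¹) (u := l * k⁻¹) (x := toAut g (stdVertex F))
      (by rw [toAut_inv_apply_self]; exact intGL_le_vertexK (mul_mem hl (inv_mem hk)))
    rwa [inv_inv] at this
  refine ⟨_, h1, Subtype.ext ?_⟩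
  change s(toAut _ _, toAut _ _) = _
  congr 1
  · exact toAut_of_mem_vertexK h1
  · rw [← toAut_mul_apply]
    congr 2
    group

/-- The neighbour attached to `c` depends only on `c` modulo `𝔭_F`, and the residue field is finite.
-/
theorem finite_neighbours (x : Vertex F) : {y | (tree F).Adj x y}.Finite := by
  obtain ⟨g, rfl⟩ := exists_toAut_stdVertex x
  have h1 : {y | (tree F).Adj (stdVertex F) y}.Finite := by
    have hsub : {y | (tree F).Adj (stdVertex F) y} ⊆ insert (stdLine F (-1))
        (Set.range fun a : 𝓀[F] => toAut (up
          ((Function.surjInv IsLocalRing.residue_surjective a : 𝒪[F]) : F)) (stdLine F 1)) := by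
      intro y hy
      rcases adj_stdVertex hy with h | ⟨c, hc, h⟩
      · exact Or.inl h
      · refine Or.inr ⟨IsLocalRing.residue 𝒪[F] ⟨c, hc⟩, ?_⟩
        set c' : 𝒪[F] := Function.surjInv IsLocalRing.residue_surjective
          (IsLocalRing.residue 𝒪[F] ⟨c, hc⟩)
        have h2 : IsLocalRing.residue 𝒪[F] c' = IsLocalRing.residue 𝒪[F] ⟨c, hc⟩ :=
          Function.surjInv_eq _ _
        have h3 : valuation F (c - c' : F) < 1 := by
          have h4 : (⟨c, hc⟩ - c' : 𝒪[F]) ∈ 𝓂[F] := by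
            rw [← IsLocalRing.residue_eq_zero_iff, map_sub, h2, sub_self]
          rw [IsLocalRing.mem_maximalIdeal, mem_nonunits_iff,
            (Valuation.integer.integers (valuation F)).isUnit_iff_valuation_eq_one] at h4
          exact lt_of_le_of_ne (mem_integers_iff.1 (sub_mem hc c'.2)) h4
        have h5 : up c = up (c' : F) * up (c - c') := by rw [up_mul, add_sub_cancel]
        rw [h, h5, toAut_mul_apply, toAut_up_stdLine]
        simpa using div_unif_mem h3
    exact ((Set.finite_range _).insert _).subset hsub
  refine (h1.image (toAut g)).subset fun y hy => ⟨toAut g⁻¹ y, ?_, toAut_apply_inv_self g y⟩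
  change (tree F).Adj _ _
  rw [← adj_toAut_iff g, toAut_apply_inv_self]
  exact hy

theorem finite_ball (n : ℕ) (x : Vertex F) : (ball n x).Finite := by
  induction n with
  | zero =>
    refine (Set.finite_singleton x).subset fun y hy => ?_
    rw [mem_ball_iff, Nat.le_zero, (tree_connected F).dist_eq_zero_iff] at hy
    exact hy.symm
  | succ n ih =>
    refine (ih.union (ih.biUnion fun y _ => finite_neighbours y)).subset fun z hz => ?_
    rw [mem_ball_iff] at hz
    by_cases h : z = x
    · exact Or.inl (h ▸ self_mem_ball n z)
    · obtain ⟨y, hy, hd⟩ := dist_pos_parent h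
      refine Or.inr (Set.mem_biUnion (mem_ball_iff.2 ?_ : y ∈ ball n x) hy)
      omega

theorem finite_edgeBall (n : ℕ) (η : Edge F) : (edgeBall n η).Finite := by
  have h1 : edgeBall n η = ⋃ x ∈ η.1.toFinset, ball n x := by
    ext y
    simp [edgeBall]
  rw [h1]
  exact Set.Finite.biUnion (Finset.finite_toSet _) fun x _ => finite_ball n x

end TransitiveAction

/-! ### The coefficient system `𝓕̂_V` belongs to `ℭ_0^{(e)}(Λ)`. -/

section Center

variable {F : Type u} [Field F] [ValuativeRel F] {Λ : Type v} [CommRing Λ] {e : ℕ}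

theorem ρ_center (V : Rep.{max u w} Λ (hatG F e)) {z : GL (Fin 2) F}
    (hz : z ∈ Subgroup.center (GL (Fin 2) F)) (v : V.V) : V.ρ (toHatG F e z) v = v := by
  have h1 : toHatG F e z = 1 := Subtype.ext (toAut_center hz)
  rw [h1, map_one]
  rfl

end Center

section FhatC0

variable {F : Type u} [Field F] [ValuativeRel F] [TopologicalSpace F]
  [IsNonarchimedeanLocalField F]
variable {Λ : Type v} [CommRing Λ] {e : ℕ} [NeZero e]

/-- The stabilizer of `Z^{(e)}(x)` in `Ĝ^{(e)}` lies in `Û_η^{(e)}` for every edge `η` at `x`, so it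
fixes each summand. Hence, as `ρ_toHatG_eq` records, elements of `Ĝ^{(e)}` may be replaced on
`𝓕̂_V(x)` by matrices. -/
theorem ρ_eq_of_mem_vertexSum (V : Rep.{max u w} Λ (hatG F e)) {x : Vertex F} {g : hatG F e}
    (hg : (g : AutTree F) ∈ ballStab e x) {v : V.V} (hv : v ∈ vertexSum.{u, v, w} V x) :
    V.ρ g v = v := by
  have h1 : vertexSum.{u, v, w} V x ≤ LinearMap.eqLocus (V.ρ g) LinearMap.id :=
    iSup₂_le fun η hη v hv => hv g (mem_hatU_of_mem_ballStab g hη hg)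
  exact h1 hv

theorem ρ_toHatG_eq (V : Rep.{max u w} Λ (hatG F e)) {x : Vertex F} {g : hatG F e}
    {h : GL (Fin 2) F} (hg : ∀ y ∈ ball e x, (g : AutTree F) y = toAut h y) {v : V.V}
    (hv : v ∈ vertexSum.{u, v, w} V x) : V.ρ (toHatG F e h) v = V.ρ g v := by
  have h1 : (((toHatG F e h)⁻¹ * g : hatG F e) : AutTree F) ∈ ballStab e x := by
    intro y hy
    change (toAut h)⁻¹ ((g : AutTree F) y) = y
    rw [hg y hy, RelIso.inv_apply_self]
  conv_lhs => rw [← ρ_eq_of_mem_vertexSum V h1 hv]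
  rw [← Module.End.mul_apply, ← map_mul, mul_inv_cancel_left]

theorem vertexSign_sq (x y : Vertex F) : vertexSign x y * vertexSign x y = 1 := by
  rw [vertexSign_eq, ← mul_pow, neg_mul_neg, one_mul, one_pow]

theorem vertexSign_toAut_mul (xp : Vertex F) (g : GL (Fin 2) F) (x : Vertex F) :
    vertexSign xp (toAut g x) = vertexSign xp (toAut g xp) * vertexSign xp x := by
  rw [← vertexSign_mul xp (toAut g xp) (toAut g x), vertexSign_aut]

theorem vertexSign_toAut_of_fix (xp : Vertex F) {g : GL (Fin 2) F} {x : Vertex F}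
    (hx : toAut g x = x) : vertexSign xp (toAut g xp) = 1 := by
  have h1 := vertexSign_toAut_mul xp g x
  rw [hx] at h1
  have h2 := congrArg (· * vertexSign xp x) h1
  simp only [mul_assoc, vertexSign_sq, mul_one] at h2
  exact h2.symm

/-- On a vector of `𝓕̂_V(x)` an element of `Û_η^{(e)}` acts like a single element of `U_η^{(e)}`. -/
theorem mem_edgeInv_of_edgeU (V : Rep.{max u w} Λ (hatG F e)) {η : Edge F} {x : Vertex F}
    {v : V.V} (hv : v ∈ vertexSum.{u, v, w} V x)
    (h : ∀ u ∈ edgeU e η, V.ρ (toHatG F e u) v = v) : v ∈ edgeInv.{u, v, w} V η := by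
  intro g hg
  obtain ⟨u, hu, hgu⟩ := exists_agree_of_mem_hatU hg x
  rw [← ρ_toHatG_eq V hgu hv, h u hu]

theorem isC0_Fhat (xp : Vertex F) (V : Rep.{max u w} Λ (hatG F e)) :
    isC0.{u, v, w} F Λ e (FhatObj xp V) := by
  refine ⟨⟨?_, ?_, ?_, ?_, ?_⟩, ⟨?_, ?_, ?_, ?_, ?_⟩, ⟨?_, ?_⟩⟩
  · intro g h x y z hxy hyz hxz f
    apply Subtype.ext
    change V.ρ (toHatG F e g) (V.ρ (toHatG F e h) f.1) = V.ρ (toHatG F e (g * h)) f.1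
    rw [map_mul, map_mul, Module.End.mul_apply]
  · rintro g h x y z hxy hyz hxz ⟨f, hf⟩
    apply Subtype.ext
    change vertexSign xp (toAut g xp) • V.ρ (toHatG F e g)
      (vertexSign xp (toAut h xp) • V.ρ (toHatG F e h) f) =
        vertexSign xp (toAut (g * h) xp) • V.ρ (toHatG F e (g * h)) f
    rw [map_zsmul, smul_smul, toAut_mul_apply, map_mul, map_mul, Module.End.mul_apply,
      vertexSign_toAut_mul xp g (toAut h xp)]
  · intro x h f
    apply Subtype.ext
    change V.ρ (toHatG F e 1) f.1 = f.1
    rw [map_one, map_one]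
    rfl
  · intro η h f
    apply Subtype.ext
    change vertexSign xp (toAut 1 xp) • V.ρ (toHatG F e 1) f.1 = f.1
    rw [vertexSign_toAut_of_fix xp (x := xp) (by rw [map_one]; rfl), map_one, map_one, one_smul]
    rfl
  -- The sign in `actE` is exactly the discrepancy between the signs of `r` at `x` and at `g x`.
  · intro g η θ x y hη hx hxη hyθ f
    apply Subtype.ext
    change vertexSign xp y • (vertexSign xp (toAut g xp) • V.ρ (toHatG F e g) f.1) =
      V.ρ (toHatG F e g) (vertexSign xp x • f.1)
    rw [map_zsmul, smul_smul, ← hx, vertexSign_toAut_mul xp g x, mul_right_comm, vertexSign_sq,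
      one_mul]
  · intro x u hu h f
    apply Subtype.ext
    exact ρ_eq_of_mem_vertexSum V (g := toHatG F e u) (toAut_mem_ballStab hu) f.2
  · intro η u hu h f
    apply Subtype.ext
    change vertexSign xp (toAut u xp) • V.ρ (toHatG F e u) f.1 = f.1
    obtain ⟨x, hx, -⟩ := exists_far (F := F) xp η
    rw [vertexSign_toAut_of_fix xp (toAut_of_mem_edgeU hu hx), one_smul]
    exact f.2 _ (toHatG_mem_hatU hu)
  · intro η z hz f f' h
    apply Subtype.ext
    have h1 : vertexSign xp z • f.1 = vertexSign xp z • f'.1 := congrArg Subtype.val h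
    have h2 := congrArg (vertexSign xp z • ·) h1
    simpa only [smul_smul, vertexSign_sq, one_smul] using h2
  · intro η z hz f
    constructor
    · rintro ⟨f, rfl⟩ u hu h
      apply Subtype.ext
      change V.ρ (toHatG F e u) (vertexSign xp z • f.1) = vertexSign xp z • f.1
      rw [map_zsmul, f.2 _ (toHatG_mem_hatU hu)]
    · intro h
      have h1 : f.1 ∈ edgeInv.{u, v, w} V η := mem_edgeInv_of_edgeU V f.2 fun u hu =>
        congrArg Subtype.val (h u hu (toAut_of_mem_edgeU hu hz))
      refine ⟨vertexSign xp z • (⟨f.1, h1⟩ : edgeInv.{u, v, w} V η), Subtype.ext ?_⟩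
      change vertexSign xp z • vertexSign xp z • f.1 = f.1
      rw [smul_smul, vertexSign_sq, one_smul]
  -- `K_z` permutes the edges at `z` transitively, so every summand of `𝓕̂_V(z)` is a
  -- `K_z`-translate of the one for `η`.
  · intro η z hz
    rw [eq_top_iff]
    have key : vertexSum.{u, v, w} V z ≤ (Submodule.span Λ
        {f : (FhatObj.{u, v, w} xp V).V z | ∃ k ∈ vertexK z, ∃ h : toAut k z = z,
          ∃ f' ∈ LinearMap.range ((FhatObj.{u, v, w} xp V).r η z hz),
            (FhatObj.{u, v, w} xp V).actV k z z h f' = f}).map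
          (FhatInclV.{u, v, w} xp V z) := by
      refine iSup₂_le fun θ hθ v hv => ?_
      obtain ⟨k, hk, hkθ⟩ := exists_mem_vertexK_edge hz hθ
      have hk' : (toAut k⁻¹).mapEdgeSet θ = η := by
        rw [← hkθ, ← mapEdgeSet_mul, ← map_mul, inv_mul_cancel, map_one, mapEdgeSet_one]
      have h1 := edgeInv_act V k⁻¹ hk' hv
      refine ⟨⟨v, edgeInv_le_vertexSum V hθ hv⟩, Submodule.subset_span ⟨k, hk,
        toAut_of_mem_vertexK hk, _, ⟨vertexSign xp z • (⟨_, h1⟩ : edgeInv.{u, v, w} V η), rfl⟩,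
          Subtype.ext ?_⟩, rfl⟩
      change V.ρ (toHatG F e k) (vertexSign xp z • vertexSign xp z • V.ρ (toHatG F e k⁻¹) v) = v
      rw [smul_smul, vertexSign_sq, one_smul, ← Module.End.mul_apply, ← map_mul, ← map_mul,
        mul_inv_cancel, map_one, map_one]
      rfl
    rintro f -
    obtain ⟨f', hf', hff⟩ := key f.2
    rw [← Subtype.ext hff]
    exact hf'
  · intro x z hz h f
    exact Subtype.ext (ρ_center V hz f.1)
  · intro η z hz h f
    apply Subtype.ext
    change vertexSign xp (toAut z xp) • V.ρ (toHatG F e z) f.1 = f.1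
    rw [vertexSign_toAut_of_fix xp (x := xp) (by rw [toAut_center hz]; rfl), one_smul,
      ρ_center V hz]

end FhatC0

/-! ### Elements of `U_η^{(e)}` are topologically of `p`-power order. -/

section Unipotent

open ValuativeRel

variable {F : Type u} [Field F] [ValuativeRel F] [TopologicalSpace F]
  [IsNonarchimedeanLocalField F]

/-- The filtration `L ⊇ M ⊇ 𝔭_F L ⊇ 𝔭_F M ⊇ …`. -/
def latFil (L M : Submodule 𝒪[F] (Fin 2 → F)) : ℕ → Submodule 𝒪[F] (Fin 2 → F)
  | 0 => L
  | 1 => M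
  | n + 2 => unif F • latFil L M n

variable {L M : Submodule 𝒪[F] (Fin 2 → F)}

theorem latFil_antitone (h1 : 𝓂[F] • L ≤ M) (h2 : M ≤ L) : Antitone (latFil L M) := by
  refine antitone_nat_of_succ_le fun n => ?_
  induction n using Nat.twoStepInduction with
  | zero => exact h2
  | one =>
    rw [maximalIdeal_smul] at h1
    exact h1
  | more n ih1 ih2 =>
    intro v hv
    change v ∈ unif F • latFil L M (n + 1) at hv
    change v ∈ unif F • latFil L M n
    rw [mem_usmul] at hv ⊢
    exact ih1 hv

theorem latFil_two_mul (n : ℕ) : latFil L M (2 * n) = unif F ^ n • L := by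
  induction n with
  | zero => rw [pow_zero, one_smul]; rfl
  | succ n ih =>
    rw [pow_succ', ← smul_smul, ← ih]
    rfl

/-- `g` acts trivially on the `k`-step quotients of the filtration. -/
def StepTrivial (L M : Submodule 𝒪[F] (Fin 2 → F)) (k : ℕ) (g : GL (Fin 2) F) : Prop :=
  ∀ i, ∀ v ∈ latFil L M i, glMap g v - v ∈ latFil L M (i + k)

/-- The filtration has period two up to multiplication by `ϖ`, so its first two members determine
everything. -/
theorem stepTrivial_of {k : ℕ} {g : GL (Fin 2) F}
    (h0 : ∀ v ∈ L, glMap g v - v ∈ latFil L M k)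
    (h1 : ∀ v ∈ M, glMap g v - v ∈ latFil L M (1 + k)) : StepTrivial L M k g := by
  intro i
  induction i using Nat.twoStepInduction with
  | zero =>
    rw [zero_add]
    exact h0
  | one => exact h1
  | more i ih1 ih2 =>
    intro v hv
    change v ∈ unif F • latFil L M i at hv
    rw [show i + 2 + k = i + k + 2 by omega]
    change _ ∈ unif F • latFil L M (i + k)
    rw [mem_usmul] at hv ⊢
    rw [smul_sub, ← glMap_usmul]
    exact ih1 _ hv

theorem StepTrivial.one (k : ℕ) : StepTrivial L M k 1 := fun i v _ => by
  rw [glMap_one, sub_self]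
  exact zero_mem _

theorem StepTrivial.mul (h1 : 𝓂[F] • L ≤ M) (h2 : M ≤ L) {k : ℕ} {g h : GL (Fin 2) F}
    (hg : StepTrivial L M k g) (hh : StepTrivial L M k h) : StepTrivial L M k (g * h) := by
  intro i v hv
  have e1 : glMap (g * h) v - v =
      (glMap g (glMap h v - v) - (glMap h v - v)) + (glMap g v - v) + (glMap h v - v) := by
    rw [glMap_mul, map_sub]
    abel
  rw [e1]
  exact add_mem (add_mem (latFil_antitone h1 h2 (Nat.le_add_right _ _) (hg _ _ (hh i v hv)))
    (hg i v hv)) (hh i v hv)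

theorem StepTrivial.pow (h1 : 𝓂[F] • L ≤ M) (h2 : M ≤ L) {k : ℕ} {g : GL (Fin 2) F}
    (hg : StepTrivial L M k g) (n : ℕ) : StepTrivial L M k (g ^ n) := by
  induction n with
  | zero => rw [pow_zero]; exact StepTrivial.one k
  | succ n ih => rw [pow_succ]; exact ih.mul h1 h2 hg

theorem natCast_mem_maximalIdeal (p : ℕ) [CharP 𝓀[F] p] : (p : 𝒪[F]) ∈ 𝓂[F] := by
  rw [← IsLocalRing.residue_eq_zero_iff, map_natCast, CharP.cast_eq_zero]

/-- With `N = g - 1`, which raises the filtration by `k ≥ 1`, one has `g^j ≡ 1 + j N` modulo a shift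
by `k + 1`. For `j = p` the term `p N` is shifted by at least `k + 2`, since `p ∈ 𝔭_F` and `𝔭_F`
shifts by two. -/
theorem StepTrivial.pow_char (p : ℕ) [CharP 𝓀[F] p] (h1 : 𝓂[F] • L ≤ M) (h2 : M ≤ L) {k : ℕ}
    (hk : 1 ≤ k) {g : GL (Fin 2) F} (hg : StepTrivial L M k g) :
    StepTrivial L M (k + 1) (g ^ p) := by
  intro i v hv
  have hanti := latFil_antitone h1 h2
  set w := glMap g v - v with hw
  have hwm : w ∈ latFil L M (i + k) := hg i v hv
  have key : ∀ j : ℕ, glMap (g ^ j) v - v - (j : 𝒪[F]) • w ∈ latFil L M (i + (k + 1)) := by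
    intro j
    induction j with
    | zero =>
      rw [pow_zero, glMap_one, sub_self, Nat.cast_zero, zero_smul, sub_zero]
      exact zero_mem _
    | succ j ih =>
      have e1 : glMap (g ^ (j + 1)) v - v - ((j + 1 : ℕ) : 𝒪[F]) • w =
          (glMap (g ^ j) v - v - (j : 𝒪[F]) • w) + (glMap (g ^ j) w - w) := by
        rw [pow_succ, glMap_mul, Nat.cast_succ, add_smul, one_smul, hw, map_sub]
        abel
      rw [e1]
      exact add_mem ih (hanti (by omega) (hg.pow h1 h2 j _ _ hwm))
  have h3 : (p : 𝒪[F]) • w ∈ latFil L M (i + (k + 1)) := by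
    have h4 : (p : 𝒪[F]) • w ∈ 𝓂[F] • latFil L M (i + k) :=
      Submodule.smul_mem_smul (natCast_mem_maximalIdeal p) hwm
    rw [maximalIdeal_smul] at h4
    exact hanti (by omega : i + (k + 1) ≤ i + k + 2) h4
  have h5 := add_mem (key p) h3
  rwa [sub_add_cancel] at h5

theorem StepTrivial.pow_char_pow (p : ℕ) [CharP 𝓀[F] p] (h1 : 𝓂[F] • L ≤ M) (h2 : M ≤ L)
    {g : GL (Fin 2) F} (hg : StepTrivial L M 1 g) (n : ℕ) :
    StepTrivial L M (n + 1) (g ^ p ^ n) := by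
  induction n with
  | zero => rwa [pow_zero, pow_one]
  | succ n ih =>
    rw [pow_succ, pow_mul]
    exact ih.pow_char p h1 h2 (Nat.le_add_left 1 n)

/-- Both `U_{x₁}^{(1)}` and `U_{x₂}^{(1)}` lie in the pro-unipotent radical of the Iwahori subgroup
of the edge, the group acting trivially on the one-step quotients. -/
theorem stepTrivial_of_mem_edgeU {e : ℕ} {L M : Lat F} (h1 : 𝓂[F] • L.toSub < M.toSub)
    (h2 : M.toSub < L.toSub) (hadj : (tree F).Adj L.cls M.cls) {u : GL (Fin 2) F}
    (hu : u ∈ edgeU e ⟨s(L.cls, M.cls), hadj⟩) : StepTrivial L.toSub M.toSub 1 u := by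
  have h1' : unif F • L.toSub ≤ M.toSub := by
    rw [← maximalIdeal_smul]
    exact h1.le
  have key : ∀ x ∈ (s(L.cls, M.cls) : Sym2 (Vertex F)), ∀ u ∈ vertexU e x,
      StepTrivial L.toSub M.toSub 1 u := by
    intro x hx u hu
    have hu1 : u ∈ vertexU1 x :=
      Subgroup.mem_iInf.1 (Subgroup.mem_iInf.1 hu x) (self_mem_ball _ x)
    rcases Sym2.mem_iff.1 hx with rfl | rfl
    · have h3 := hu1.2 L rfl
      refine stepTrivial_of (fun v hv => h1.le (h3 v hv)) fun v hv => ?_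
      have := h3 v (h2.le hv)
      rwa [maximalIdeal_smul] at this
    · have h3 := hu1.2 M rfl
      refine stepTrivial_of (fun v hv => ?_) fun v hv => ?_
      · have h4 := h3 (unif F • v) (h1' (smul_mem_usmul hv))
        rw [maximalIdeal_smul, mem_usmul, glMap_usmul, ← smul_sub, inv_smul_smul] at h4
        exact h4
      · have h4 := h3 v hv
        rw [maximalIdeal_smul, mem_usmul] at h4
        change _ ∈ unif F • L.toSub
        rw [mem_usmul]
        exact h2.le h4
  let G : Subgroup (GL (Fin 2) F) :=
    { carrier := {u | StepTrivial L.toSub M.toSub 1 u ∧ StepTrivial L.toSub M.toSub 1 u⁻¹}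
      one_mem' := ⟨StepTrivial.one 1, by rw [inv_one]; exact StepTrivial.one 1⟩
      mul_mem' := fun hg hh => ⟨hg.1.mul h1.le h2.le hh.1, by
        rw [mul_inv_rev]
        exact hh.2.mul h1.le h2.le hg.2⟩
      inv_mem' := fun hg => ⟨hg.2, by rw [inv_inv]; exact hg.1⟩ }
  have hle : edgeU e ⟨s(L.cls, M.cls), hadj⟩ ≤ G :=
    iSup₂_le fun x hx u hu => ⟨key x hx u hu, key x hx _ (inv_mem hu)⟩
  exact (hle hu).1

/-- With `L = g 𝒪_F²`, the vertex in question is represented by a lattice between `ϖ^n L` and `L`,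
and such lattices are preserved by elements acting trivially on `L / ϖ^n L`. -/
theorem toAut_of_sub_mem {g h : GL (Fin 2) F} {n : ℕ}
    (hh : ∀ v ∈ ((stdLat F).act g).toSub,
      glMap h v - v ∈ unif F ^ n • ((stdLat F).act g).toSub)
    (hh' : ∀ v ∈ ((stdLat F).act g).toSub,
      glMap h⁻¹ v - v ∈ unif F ^ n • ((stdLat F).act g).toSub) :
    toAut h (toAut g (stdLine F n)) = toAut g (stdLine F n) := by
  set M := (stdLat F).act (g * dz F n)
  have hM : toAut g (stdLine F n) = M.cls := by
    rw [stdLine, ← toAut_mul_apply]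
    rfl
  have hn : ((unif F ^ n : Fˣ) : F) ∈ 𝒪[F] := by
    rw [Units.val_pow_eq_pow_val]
    exact pow_mem unif_mem n
  have h1 : M.toSub ≤ ((stdLat F).act g).toSub := by
    intro v hv
    rw [Lat.mem_act] at hv ⊢
    rw [mul_inv_rev, glMap_mul] at hv
    rw [← glMap_apply_inv (dz F n) (glMap g⁻¹ v)]
    refine glMap_mem_stdLat (fun i j => ?_) hv
    rw [dz, coe_dg, zpow_natCast]
    fin_cases i <;> fin_cases j
    · exact hn
    · exact zero_mem _
    · exact zero_mem _
    · exact one_mem _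
  have h2 : unif F ^ n • ((stdLat F).act g).toSub ≤ M.toSub := by
    intro v hv
    rw [mem_usmul, Lat.mem_act] at hv
    rw [Lat.mem_act, mul_inv_rev, glMap_mul]
    have e1 : (dz F n)⁻¹ = dg 1 (unif F ^ n) * (sc (unif F ^ n))⁻¹ := by
      rw [dz, sc_eq_dg, dg_inv, dg_inv, dg_mul, zpow_natCast, one_mul, mul_inv_cancel, inv_one]
    rw [e1, glMap_mul, ← map_inv, glMap_sc, ← glMap_usmul]
    refine glMap_mem_stdLat (fun i j => ?_) hv
    rw [coe_dg]
    fin_cases i <;> fin_cases j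
    · exact one_mem _
    · exact zero_mem _
    · exact zero_mem _
    · exact hn
  have key : ∀ k : GL (Fin 2) F, (∀ v ∈ ((stdLat F).act g).toSub,
      glMap k v - v ∈ unif F ^ n • ((stdLat F).act g).toSub) → ∀ v ∈ M.toSub,
        glMap k v ∈ M.toSub := by
    intro k hk v hv
    have := add_mem (h2 (hk v (h1 hv))) hv
    rwa [sub_add_cancel] at this
  rw [hM, toAut_cls]
  congr 1
  apply Lat.ext'
  apply le_antisymm
  · rintro _ ⟨v, hv, rfl⟩
    exact key h hh v hv
  · intro v hv
    rw [Lat.mem_act]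
    exact key _ hh' v hv

/-- The group `U_η^{(e)}` acts on the vertices through pro-`p` groups. -/
theorem exists_pow_fix_of_mem_edgeU (p : ℕ) [CharP 𝓀[F] p] {e : ℕ} {η : Edge F}
    {u : GL (Fin 2) F} (hu : u ∈ edgeU e η) (y : Vertex F) :
    ∃ n, toAut (u ^ p ^ n) y = y := by
  obtain ⟨x, hx, -⟩ := exists_far (F := F) y η
  obtain ⟨z, hxz, rfl⟩ := exists_edge_eq hx
  obtain ⟨g, hg, hy⟩ := exists_adapted_dist x y
  set n := (tree F).dist x y
  obtain rfl : x = ((stdLat F).act g).cls := hg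
  obtain ⟨M, rfl, h1, h2⟩ := exists_lattices hxz
  -- Two steps of the filtration amount to one factor `ϖ`, so `2 * n` steps reach `ϖ^n L`.
  have key : ∀ u ∈ edgeU e (⟨s(((stdLat F).act g).cls, M.cls), hxz⟩ : Edge F), ∀ v ∈ ((stdLat F).act g).toSub,
      glMap (u ^ p ^ (2 * n)) v - v ∈ unif F ^ n • ((stdLat F).act g).toSub := by
    intro u hu v hv
    have h3 := (stepTrivial_of_mem_edgeU h1 h2 hxz hu).pow_char_pow p h1.le h2.le (2 * n) 0 v hv
    rw [zero_add] at h3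
    have h4 := latFil_antitone h1.le h2.le (Nat.le_succ (2 * n)) h3
    rwa [latFil_two_mul] at h4
  refine ⟨2 * n, ?_⟩
  rw [hy]
  refine toAut_of_sub_mem (key u hu) ?_
  rw [← inv_pow]
  exact key _ (inv_mem hu)

end Unipotent

/-! ### Invariants of `Û_σ^{(e)}` in smooth representations. -/

section ProP

variable {F : Type u} [Field F] [ValuativeRel F]

theorem exists_pow_fix_finite {p : ℕ} {g : AutTree F} {s : Set (Vertex F)} (hs : s.Finite)
    (h : ∀ y ∈ s, ∃ n, (g ^ p ^ n) y = y) : ∃ n, ∀ y ∈ s, (g ^ p ^ n) y = y := by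
  choose! f hf using h
  refine ⟨hs.toFinset.sup f, fun y hy => ?_⟩
  obtain ⟨k, hk⟩ := Nat.exists_eq_add_of_le (Finset.le_sup (f := f) (hs.mem_toFinset.2 hy))
  have h1 : g ^ p ^ f y ∈ MulAction.stabilizer (AutTree F) y := hf y hy
  rw [hk, pow_add, pow_mul]
  exact pow_mem h1 _

variable [TopologicalSpace F] [IsNonarchimedeanLocalField F]

variable {e : ℕ} [NeZero e]

theorem apply_of_mem_hatU {σ : Edge F} {g : AutTree F} (hg : g ∈ hatU e σ) {x : Vertex F}
    (hx : x ∈ σ.1) : g x = x := by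
  obtain ⟨u, hu, h⟩ := exists_agree_of_mem_hatU hg x
  rw [h x (self_mem_ball e x), toAut_of_mem_edgeU hu hx]

theorem apply_mem_edgeBall {σ : Edge F} {g : AutTree F} (hg : g ∈ hatU e σ) {m : ℕ}
    {y : Vertex F} (hy : y ∈ edgeBall m σ) : g y ∈ edgeBall m σ := by
  obtain ⟨x, hx, hy⟩ := hy
  refine ⟨x, hx, ?_⟩
  have := ball_aut g hy
  rwa [apply_of_mem_hatU hg hx] at this

/-- The group `Û_σ^{(e)}` acts on `Z^{(m)}(σ)` through a `p`-group. -/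
theorem exists_pow_fix_of_mem_hatU (p : ℕ) [CharP 𝓀[F] p] {σ : Edge F} {g : AutTree F}
    (hg : g ∈ hatU e σ) (m : ℕ) : ∃ n, ∀ y ∈ edgeBall m σ, (g ^ p ^ n) y = y := by
  induction m with
  | zero =>
    refine ⟨0, ?_⟩
    rintro y ⟨x, hx, hy⟩
    rw [mem_ball_iff, Nat.le_zero, (tree_connected F).dist_eq_zero_iff] at hy
    rw [pow_zero, pow_one, ← hy, apply_of_mem_hatU hg hx]
  | succ m ih =>
    obtain ⟨n, hn⟩ := ih
    refine exists_pow_fix_finite (finite_edgeBall (m + 1) σ) fun y hy => ?_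
    obtain ⟨x, hx, hy⟩ := hy
    rw [mem_ball_iff] at hy
    by_cases hyx : y = x
    · exact ⟨n, hn y ⟨x, hx, by rw [hyx]; exact self_mem_ball m x⟩⟩
    · obtain ⟨z, hz, hd⟩ := dist_pos_parent hyx
      -- The matrix that describes an automorphism depends on the place, so iterates compare only
      -- while staying in one ball. As `w` fixes `z`, its iterates on `y` stay in `Z^{(e)}(z)` and
      -- agree with those of a single `u ∈ U_σ^{(e)}`.
      set w := g ^ p ^ n with hw
      have hwz : w z = z := hn z ⟨x, hx, mem_ball_iff.2 (by omega)⟩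
      obtain ⟨u, hu, huw⟩ := exists_agree_of_mem_hatU (pow_mem hg (p ^ n) : w ∈ hatU e σ) z
      have huz : toAut u z = z := by rw [← huw z (self_mem_ball e z), hwz]
      obtain ⟨k, hk⟩ := exists_pow_fix_of_mem_edgeU p hu y
      have key : ∀ j : ℕ, (w ^ j) y = toAut (u ^ j) y ∧ toAut (u ^ j) y ∈ ball e z := by
        intro j
        induction j with
        | zero =>
          rw [pow_zero, pow_zero, map_one]
          exact ⟨rfl, adj_mem_ball hz⟩
        | succ j ihj =>
          have h1 := ball_aut (toAut u) ihj.2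
          rw [huz] at h1
          rw [pow_succ', pow_succ', RelIso.mul_apply, toAut_mul_apply, ihj.1, huw _ ihj.2]
          exact ⟨rfl, h1⟩
      refine ⟨n + k, ?_⟩
      rw [pow_add, pow_mul, ← hw, (key _).1, hk]

variable {Λ : Type v} [CommRing Λ]

/-- A nonzero vector which is fixed by a congruence subgroup generates, under the pro-`p` group
`Û_σ^{(e)}`, a nonzero invariant vector. -/
theorem exists_invariant (p : ℕ) [Fact p.Prime] [CharP 𝓀[F] p] (hp : ∃ n, (p : Λ) ^ n = 0)
    (V : Rep.{max u w} Λ (hatG F e)) (σ : Edge F) {v : V.V} (hv : v ≠ 0) {m : ℕ}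
    (hm : ∀ u : hatG F e, (u : AutTree F) ∈ hatU e σ →
      (∀ y ∈ edgeBall m σ, (u : AutTree F) y = y) → V.ρ u v = v) :
    ∃ x ∈ edgeInv.{u, v, w} V σ, x ≠ 0 ∧
      x ∈ AddSubgroup.closure {y | ∃ u : hatG F e, (u : AutTree F) ∈ hatU e σ ∧ V.ρ u v = y} := by
  set O : Set V.V := {y | ∃ u : hatG F e, (u : AutTree F) ∈ hatU e σ ∧ V.ρ u v = y} with hO
  set A := AddSubgroup.closure O with hA
  set G := (hatU e σ).subgroupOf (hatG F e) with hG
  have hvO : v ∈ O := ⟨1, one_mem _, by rw [map_one]; rfl⟩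
  -- By smoothness the vector `u v` depends only on the action of `u` on the finite set
  -- `Z^{(m)}(σ)`.
  have hOfin : O.Finite := by
    have : Finite (edgeBall m σ) := (finite_edgeBall m σ).to_subtype
    choose f hf1 hf2 using fun y : O => y.2
    let Φ : O → (edgeBall m σ → edgeBall m σ) := fun y z =>
      ⟨(f y : AutTree F) z.1, apply_mem_edgeBall (hf1 y) z.2⟩
    have hΦ : Function.Injective Φ := by
      intro y y' h
      have h1 : V.ρ ((f y)⁻¹ * f y') v = v := by
        refine hm _ (mul_mem (inv_mem (hf1 y)) (hf1 y')) fun z hz => ?_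
        have h2 := congrArg Subtype.val (congrFun h ⟨z, hz⟩)
        change (f y : AutTree F)⁻¹ ((f y' : AutTree F) z) = z
        rw [← show (f y : AutTree F) z = (f y' : AutTree F) z from h2, RelIso.inv_apply_self]
      have h2 := congrArg (V.ρ (f y)) h1
      rw [← Module.End.mul_apply, ← map_mul, mul_inv_cancel_left, hf2, hf2] at h2
      exact Subtype.ext h2.symm
    have : Finite O := Finite.of_injective Φ hΦ
    exact Set.toFinite O
  have hstab : ∀ u ∈ G, ∀ a ∈ A, V.ρ u a ∈ A := by
    intro u hu a ha
    have h1 : A ≤ A.comap (V.ρ u).toAddMonoidHom := by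
      rw [hA, AddSubgroup.closure_le]
      rintro _ ⟨u', hu', rfl⟩
      refine AddSubgroup.subset_closure ⟨u * u', mul_mem hu hu', ?_⟩
      rw [map_mul]
      rfl
    exact h1 ha
  obtain ⟨n, hn⟩ := hp
  have htors : ∀ a : V.V, p ^ n • a = 0 := by
    intro a
    rw [← Nat.cast_smul_eq_nsmul Λ, Nat.cast_pow, hn, zero_smul]
  -- A finitely generated abelian group killed by a power of `p`.
  have hAfin : Finite A := by
    have h1 : AddGroup.FG A := by
      rw [AddGroup.fg_iff_addSubgroup_fg]
      exact ⟨hOfin.toFinset, by rw [Set.Finite.coe_toFinset]⟩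
    refine AddCommGroup.finite_of_fg_isAddTorsion A fun a => ?_
    rw [isOfFinAddOrder_iff_nsmul_eq_zero]
    exact ⟨p ^ n, pow_pos (Fact.out (p := p.Prime)).pos n, Subtype.ext (htors a.1)⟩
  let _ : MulAction G A :=
    { smul := fun u a => ⟨V.ρ u.1 a.1, hstab u.1 u.2 a.1 a.2⟩
      one_smul := fun a => Subtype.ext (by
        change V.ρ 1 a.1 = a.1
        rw [map_one]
        rfl)
      mul_smul := fun u u' a => Subtype.ext (by
        change V.ρ (u.1 * u'.1) a.1 = V.ρ u.1 (V.ρ u'.1 a.1)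
        rw [map_mul]
        rfl) }
  -- The fixed point count needs a `p`-group; the image in the permutations of `A` is one, because a
  -- suitable `p`-power of each `u` fixes `Z^{(m)}(σ)` and therefore acts trivially on `A`.
  let Q : Subgroup (Equiv.Perm A) := (MulAction.toPermHom G A).range
  have hQ : IsPGroup p Q := by
    rintro ⟨_, u, rfl⟩
    obtain ⟨k, hk⟩ := exists_pow_fix_of_mem_hatU p u.2 m
    have hk' : ∀ y ∈ edgeBall m σ, ((u.1 : AutTree F) ^ p ^ k) y = y := hk
    refine ⟨k, Subtype.ext ?_⟩
    change (MulAction.toPermHom G A u) ^ p ^ k = 1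
    rw [← map_pow]
    ext a
    change V.ρ (u ^ p ^ k : G).1 a.1 = a.1
    have h1 : A ≤ (LinearMap.eqLocus (V.ρ (u ^ p ^ k : G).1) LinearMap.id).toAddSubgroup := by
      rw [hA, AddSubgroup.closure_le]
      rintro _ ⟨u', hu', rfl⟩
      change V.ρ (u ^ p ^ k : G).1 (V.ρ u' v) = V.ρ u' v
      have h2 : V.ρ (u'⁻¹ * (u ^ p ^ k : G).1 * u') v = v := by
        refine hm _ (mul_mem (mul_mem (inv_mem hu') (u ^ p ^ k : G).2) hu') fun z hz => ?_
        change (u' : AutTree F)⁻¹ (((u.1 : AutTree F) ^ p ^ k) ((u' : AutTree F) z)) = z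
        rw [hk' _ (apply_mem_edgeBall hu' hz), RelIso.inv_apply_self]
      have h3 := congrArg (V.ρ u') h2
      rw [← Module.End.mul_apply, ← map_mul] at h3
      rw [← Module.End.mul_apply, ← map_mul]
      rw [← h3]
      congr 2
      group
    exact h1 a.2
  have hcard : p ∣ Nat.card A := by
    have h1 : addOrderOf (⟨v, AddSubgroup.subset_closure hvO⟩ : A) ∣ p ^ n :=
      addOrderOf_dvd_of_nsmul_eq_zero (Subtype.ext (htors v))
    have h2 : addOrderOf (⟨v, AddSubgroup.subset_closure hvO⟩ : A) ≠ 1 := by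
      rw [Ne, AddMonoid.addOrderOf_eq_one_iff]
      exact fun h => hv (congrArg Subtype.val h)
    obtain ⟨k, -, hk⟩ := (Nat.dvd_prime_pow Fact.out).1 h1
    refine dvd_trans ?_ (addOrderOf_dvd_natCard (⟨v, AddSubgroup.subset_closure hvO⟩ : A))
    rw [hk]
    refine dvd_pow_self p fun h => h2 ?_
    rw [hk, h, pow_zero]
  have h0 : (0 : A) ∈ MulAction.fixedPoints Q A := by
    rintro ⟨_, u, rfl⟩
    exact Subtype.ext (map_zero (V.ρ u.1))
  -- The number of fixed points is divisible by `p`, and `0` is one of them, so there is another.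
  obtain ⟨b, hb, hb0⟩ := hQ.exists_fixed_point_of_prime_dvd_card_of_fixed_point A hcard h0
  refine ⟨b.1, fun u hu => ?_, fun h => hb0 (Subtype.ext h.symm), b.2⟩
  exact congrArg Subtype.val (hb ⟨_, ⟨u, hu⟩, rfl⟩)

end ProP

/-! ### The counit. -/

section Counit

variable {F : Type u} [Field F] [ValuativeRel F]

theorem Edge.exists_eq (η : Edge F) : ∃ x y, ∃ hxy : (tree F).Adj x y, η = ⟨s(x, y), hxy⟩ := by
  obtain ⟨η, hη⟩ := η
  induction η with
  | _ x y => exact ⟨x, y, hη, rfl⟩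

variable [TopologicalSpace F] [IsNonarchimedeanLocalField F]
variable {Λ : Type v} [CommRing Λ] {e : ℕ}

theorem vertexSign_of_adj (xp : Vertex F) {x y : Vertex F} (h : (tree F).Adj x y) :
    vertexSign xp y = -vertexSign xp x := by
  rw [← vertexSign_mul xp x y, vertexSign_adj h, mul_neg_one]

/-- The natural map `H_0(X, 𝓕̂_V) → V`, as a linear map. -/
def counitMap (xp : Vertex F) (V : Rep.{max u w} Λ (hatG F e)) :
    (FhatObj.{u, v, w} xp V).H0 →ₗ[Λ] V.V :=
  (FhatObj.{u, v, w} xp V).H0lift (FhatInclV xp V) (fun η f => by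
    obtain ⟨x, y, hxy, rfl⟩ := η.exists_eq
    rw [sum_toFinset_attach (Sym2.mem_mk_left x y) (Sym2.mem_mk_right x y) hxy.ne]
    change vertexSign xp x • f.1 + vertexSign xp y • f.1 = 0
    rw [vertexSign_of_adj xp hxy, neg_smul, add_neg_cancel])

theorem counitMap_toH0 (xp : Vertex F) (V : Rep.{max u w} Λ (hatG F e)) (x : Vertex F)
    (f : (FhatObj.{u, v, w} xp V).V x) :
    counitMap xp V ((FhatObj.{u, v, w} xp V).toH0 x f) = FhatInclV xp V x f :=
  (FhatObj.{u, v, w} xp V).H0lift_toH0 _ _ x f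

theorem counitMap_naturality (xp : Vertex F) {V W : Rep.{max u w} Λ (hatG F e)} (φ : V ⟶ W)
    (φ' : FhatObj.{u, v, w} xp V ⟶ FhatObj.{u, v, w} xp W)
    (h : ∀ x f, FhatInclV xp W x (φ'.onV x f) = φ.hom (FhatInclV xp V x f)) :
    (counitMap xp W).comp (H0map φ') = φ.hom.toLinearMap.comp (counitMap xp V) := by
  apply CoeffSystem.H0_hom_ext
  intro x f
  rw [LinearMap.comp_apply, LinearMap.comp_apply, H0map_toH0, counitMap_toH0, counitMap_toH0]
  exact h x f

variable [NeZero e]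

theorem counitMap_H0ρ (xp : Vertex F) (V : Rep.{max u w} Λ (hatG F e))
    (hV : isC0.{u, v, w} F Λ e (FhatObj.{u, v, w} xp V)) (g : hatG F e) :
    (counitMap xp V).comp (H0ρ hV g) = (V.ρ g).comp (counitMap xp V) := by
  apply CoeffSystem.H0_hom_ext
  intro x f
  obtain ⟨g', hg'⟩ := exists_agree g x
  rw [LinearMap.comp_apply, LinearMap.comp_apply, H0ρ_toH0 hV g x _ g' hg' rfl, counitMap_toH0,
    counitMap_toH0]
  exact ρ_toHatG_eq V hg' f.2

/-- The natural map `H_0(X, 𝓕̂_V) → V`. -/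
def counitHom (xp : Vertex F) (V : Rep.{max u w} Λ (hatG F e))
    (hV : isC0.{u, v, w} F Λ e ((Fhat.{u, v, w} F Λ e xp).obj V)) :
    (H0functor.{u, v, w} F Λ e).obj ⟨(Fhat.{u, v, w} F Λ e xp).obj V, hV⟩ ⟶ V :=
  Rep.ofHom
    { toLinearMap := counitMap xp V
      isIntertwining' := counitMap_H0ρ xp V hV }

theorem isNaturalCounit_counitHom (xp : Vertex F) (V : Rep.{max u w} Λ (hatG F e))
    (hV : isC0.{u, v, w} F Λ e ((Fhat.{u, v, w} F Λ e xp).obj V)) :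
    IsNaturalCounit.{u, v, w} xp V hV (counitHom xp V hV) :=
  counitMap_toH0 xp V

/-- A translate `g v` of a `σ`-invariant `v` is also a translate by a matrix `g'` that agrees with
`g` near a vertex `x` of `σ`, so it lies in `𝓕̂_V(g' x)`. -/
theorem counitMap_surjective {σ : Edge F} (xp : Vertex F) (V : Rep.{max u w} Λ (hatG F e))
    (hV : isR0.{u, v, w} F Λ e σ V) : Function.Surjective (counitMap xp V) := by
  rw [← LinearMap.range_eq_top, eq_top_iff, ← hV.1, Submodule.span_le]
  rintro _ ⟨g, v, hv, rfl⟩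
  obtain ⟨x, y, hxy, rfl⟩ := σ.exists_eq
  obtain ⟨g', hg'⟩ := exists_agree g x
  have hx : x ∈ (⟨s(x, y), hxy⟩ : Edge F).1 := Sym2.mem_mk_left x y
  have hv' := edgeInv_le_vertexSum V hx hv
  rw [← ρ_toHatG_eq V hg' hv']
  exact ⟨_, counitMap_toH0 xp V (toAut g' x) ⟨_, vertexSum_act V g' rfl hv'⟩⟩

/-- A nonzero kernel would contain a nonzero `Û_σ^{(e)}`-invariant. But the invariants of `H_0(X,
𝓕̂_V)` come from `𝓕̂_V(σ)`, on which the counit is an inclusion up to sign. -/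
theorem counitMap_injective {σ : Edge F} (p : ℕ) [Fact p.Prime] [CharP 𝓀[F] p]
    (hp : ∃ n, (p : Λ) ^ n = 0) (xp : Vertex F) (hx : xp ∈ σ.1)
    (V : Rep.{max u w} Λ (hatG F e)) : Function.Injective (counitMap xp V) := by
  have hS := isC0_Fhat xp V
  rw [← LinearMap.ker_eq_bot, eq_bot_iff]
  intro v hv
  by_contra hv0
  obtain ⟨m, hm⟩ := (isR0_H0 hS σ).2 v
  obtain ⟨a, ha, ha0, hav⟩ :=
    exists_invariant p hp (Rep.of (H0ρ hS)) σ (fun h => hv0 ((Submodule.mem_bot Λ).2 h)) hm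
  have hker : counitMap xp V a = 0 := by
    have h1 : AddSubgroup.closure {y | ∃ u : hatG F e, (u : AutTree F) ∈ hatU e σ ∧
        (Rep.of (H0ρ hS)).ρ u v = y} ≤ (LinearMap.ker (counitMap xp V)).toAddSubgroup := by
      rw [AddSubgroup.closure_le]
      rintro _ ⟨u, hu, rfl⟩
      have h2 : counitMap xp V (H0ρ hS u v) = V.ρ u (counitMap xp V v) :=
        Rep.hom_comm_apply (counitHom xp V hS) u v
      rw [LinearMap.mem_ker.1 hv, map_zero] at h2
      exact h2
    exact h1 hav
  obtain ⟨f, rfl⟩ := (mem_edgeInv_H0_iff hS hx a).1 ha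
  rw [counitMap_toH0] at hker
  apply ha0
  have h3 : (FhatObj.{u, v, w} xp V).r σ xp hx f = 0 := Subtype.ext hker
  rw [h3, map_zero]

end Counit

/-! ### The unit. -/

section Unit

variable {F : Type u} [Field F] [ValuativeRel F] [TopologicalSpace F]
  [IsNonarchimedeanLocalField F]
variable {Λ : Type v} [CommRing Λ] {e : ℕ} {S T : GSystem.{u, v, w} F Λ}

/-- The linear map `𝓕(η) → H_0(X, 𝓕)`, up to sign the composite of a transition map with the
natural map. -/
def edgeToH0 (xp : Vertex F) (S : GSystem.{u, v, w} F Λ) (η : Edge F) : S.E η →ₗ[Λ] S.H0 :=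
  vertexSign xp (Quot.out η.1).1 • (S.toH0 _).comp (S.r η _ (Sym2.out_fst_mem η.1))

/-- The choice of end point does not matter: the classes of the two images of `f` are opposite in
`H_0`, and so are the two signs. -/
theorem edgeToH0_apply (xp : Vertex F) {η : Edge F} {x : Vertex F} (hx : x ∈ η.1) (f : S.E η) :
    edgeToH0 xp S η f = vertexSign xp x • S.toH0 x (S.r η x hx f) := by
  have key : ∀ (y : Vertex F) (hy : y ∈ η.1), vertexSign xp y • S.toH0 y (S.r η y hy f) =
      vertexSign xp x • S.toH0 x (S.r η x hx f) := by
    intro y hy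
    by_cases h : y = x
    · subst h
      rfl
    · rw [vertexSign_of_adj xp (edge_adj hy hx h), neg_smul, ← smul_neg,
        eq_neg_of_add_eq_zero_left (S.toCoeffSystem.toH0_r_add η hy hx h f)]
  exact key _ (Sym2.out_fst_mem η.1)

theorem counitMap_edgeToH0 (xp : Vertex F) (V : Rep.{max u w} Λ (hatG F e)) (η : Edge F)
    (f : (FhatObj.{u, v, w} xp V).E η) :
    counitMap xp V (edgeToH0 xp (FhatObj.{u, v, w} xp V) η f) = FhatInclE xp V η f := by
  obtain ⟨x, hx, -⟩ := exists_far (F := F) xp η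
  rw [edgeToH0_apply xp hx, map_zsmul, counitMap_toH0]
  change vertexSign xp x • vertexSign xp x • f.1 = f.1
  rw [smul_smul, vertexSign_sq, one_smul]

theorem edgeToH0_mem [NeZero e] (hS : isC0 F Λ e S) (xp : Vertex F) (η : Edge F) (f : S.E η) :
    edgeToH0 xp S η f ∈ edgeInv.{u, v, w} (Rep.of (H0ρ hS)) η := by
  obtain ⟨x, hx, -⟩ := exists_far (F := F) xp η
  rw [edgeToH0_apply xp hx]
  exact zsmul_mem ((mem_edgeInv_H0_iff hS hx _).2 ⟨f, rfl⟩) _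

theorem toH0_mem [NeZero e] (hS : isC0 F Λ e S) (x : Vertex F) (f : S.V x) :
    S.toH0 x f ∈ vertexSum.{u, v, w} (Rep.of (H0ρ hS)) x := by
  rw [vertexSum_H0]
  exact ⟨f, rfl⟩

/-- The natural morphism `𝓕 → 𝓕̂_{H_0(X, 𝓕)}`. -/
def unitHom [NeZero e] (xp : Vertex F) (hS : isC0 F Λ e S) :
    S ⟶ (Fhat.{u, v, w} F Λ e xp).obj (Rep.of (H0ρ hS)) where
  onV x := (S.toH0 x).codRestrict (vertexSum.{u, v, w} (Rep.of (H0ρ hS)) x) (toH0_mem hS x)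
  onE η := (edgeToH0 xp S η).codRestrict (edgeInv.{u, v, w} (Rep.of (H0ρ hS)) η)
    (edgeToH0_mem hS xp η)
  comm_r η x hx f := by
    apply Subtype.ext
    change S.toH0 x (S.r η x hx f) = vertexSign xp x • edgeToH0 xp S η f
    rw [edgeToH0_apply xp hx, smul_smul, vertexSign_sq, one_smul]
  comm_actV g x y h f := by
    apply Subtype.ext
    exact (H0ρ_toH0 hS (toHatG F e g) x y g (fun _ _ => rfl) h f).symm
  comm_actE g η θ h f := by
    apply Subtype.ext
    change edgeToH0 xp S θ (S.actE g η θ h f) =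
      vertexSign xp (toAut g xp) • H0ρ hS (toHatG F e g) (edgeToH0 xp S η f)
    obtain ⟨x, hx, -⟩ := exists_far (F := F) xp η
    have hy : toAut g x ∈ θ.1 := by
      rw [← h]
      exact Sym2.mem_map.2 ⟨x, hx, rfl⟩
    rw [edgeToH0_apply xp hx, edgeToH0_apply xp hy, map_zsmul,
      H0ρ_toH0 hS (toHatG F e g) x _ g (fun _ _ => rfl) rfl, smul_smul, ← vertexSign_toAut_mul,
      hS.1.comm g η θ x _ h rfl hx hy]

theorem isNaturalUnit_unitHom [NeZero e] (xp : Vertex F) (S : C0.{u, v, w} F Λ e) :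
    IsNaturalUnit.{u, v, w} xp S (unitHom xp S.property) := by
  refine ⟨fun x f => rfl, fun η x hx h f => ?_⟩
  change edgeToH0 xp S.obj η f = _
  rw [edgeToH0_apply xp hx, vertexSign, if_pos h, one_smul]

theorem unitHom_onV_bijective [NeZero e] (xp : Vertex F) (hS : isC0 F Λ e S) (x : Vertex F) :
    Function.Bijective ((unitHom xp hS).onV x) := by
  constructor
  · exact fun f f' h => hS.toH0_injective x (congrArg Subtype.val h)
  · rintro ⟨v, hv⟩
    obtain ⟨f, rfl⟩ := (vertexSum_H0 hS x).le hv
    exact ⟨f, rfl⟩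

theorem unitHom_onE_bijective [NeZero e] (xp : Vertex F) (hS : isC0 F Λ e S) (η : Edge F) :
    Function.Bijective ((unitHom xp hS).onE η) := by
  obtain ⟨x, hx, -⟩ := exists_far (F := F) xp η
  constructor
  · intro f f' h
    have h1 : edgeToH0 xp S η f = edgeToH0 xp S η f' := congrArg Subtype.val h
    rw [edgeToH0_apply xp hx, edgeToH0_apply xp hx] at h1
    have h2 := congrArg (vertexSign xp x • ·) h1
    simp only [smul_smul, vertexSign_sq, one_smul] at h2
    exact hS.2.1.injective η x hx (hS.toH0_injective x h2)
  · rintro ⟨v, hv⟩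
    obtain ⟨f, rfl⟩ := (mem_edgeInv_H0_iff hS hx v).1 hv
    refine ⟨vertexSign xp x • f, Subtype.ext ?_⟩
    change edgeToH0 xp S η (vertexSign xp x • f) = _
    rw [edgeToH0_apply xp hx, map_zsmul, map_zsmul, smul_smul, vertexSign_sq, one_smul]

end Unit

/-! ### Isomorphism criteria. -/

section IsIso

variable {F : Type u} [Field F] [ValuativeRel F] {Λ : Type v} [CommRing Λ]

theorem GSystem.isIso_of_bijective {S T : GSystem.{u, v, w} F Λ} (φ : S ⟶ T)
    (hV : ∀ x, Function.Bijective (φ.onV x)) (hE : ∀ η, Function.Bijective (φ.onE η)) :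
    IsIso φ := by
  let eV := fun x => LinearEquiv.ofBijective (φ.onV x) (hV x)
  let eE := fun η => LinearEquiv.ofBijective (φ.onE η) (hE η)
  have hV' : ∀ x f, φ.onV x ((eV x).symm f) = f := fun x f => (eV x).apply_symm_apply f
  have hE' : ∀ η f, φ.onE η ((eE η).symm f) = f := fun η f => (eE η).apply_symm_apply f
  let ψ : T ⟶ S :=
    { onV := fun x => (eV x).symm
      onE := fun η => (eE η).symm
      comm_r := fun η x h f => (hV x).1 (by
        rw [φ.comm_r]
        erw [hV', hE'])
      comm_actV := fun g x y h f => (hV y).1 (by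
        rw [φ.comm_actV]
        erw [hV', hV'])
      comm_actE := fun g η θ h f => (hE θ).1 (by
        rw [φ.comm_actE]
        erw [hE', hE']) }
  refine ⟨ψ, ?_, ?_⟩
  · exact GSystem.Hom.ext (funext fun x => LinearMap.ext (eV x).symm_apply_apply)
      (funext fun η => LinearMap.ext (eE η).symm_apply_apply)
  · exact GSystem.Hom.ext (funext fun x => LinearMap.ext (hV' x))
      (funext fun η => LinearMap.ext (hE' η))

theorem isIso_of_bijective_hom {k : Type*} {G : Type*} [CommRing k] [Group G] {V W : Rep.{w} k G}
    (φ : V ⟶ W) (h : Function.Bijective φ.hom) : IsIso φ := by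
  have h1 : IsIso ((forget (Rep.{w} k G)).map φ) := (CategoryTheory.isIso_iff_bijective _).2 h
  exact isIso_of_reflects_iso φ (forget (Rep.{w} k G))

end IsIso

/-! ### Nilpotence of `p` in `Λ`. -/

section Char

/-- The element `p` lies in the maximal ideal of `𝔬`, hence maps into that of `Λ`, which is
nilpotent because `Λ` is Artinian. -/
theorem exists_natCast_pow_eq_zero (p : ℕ) (𝔬 : Type*) [CommRing 𝔬] [IsLocalRing 𝔬]
    [CharP (IsLocalRing.ResidueField 𝔬) p] (Λ : Type*) [CommRing Λ] [IsLocalRing Λ]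
    [IsArtinianRing Λ] [Algebra 𝔬 Λ] [IsLocalHom (algebraMap 𝔬 Λ)] : ∃ n, (p : Λ) ^ n = 0 := by
  have h1 : (p : 𝔬) ∈ IsLocalRing.maximalIdeal 𝔬 := by
    rw [← IsLocalRing.residue_eq_zero_iff, map_natCast, CharP.cast_eq_zero]
  have h2 : (p : Λ) ∈ IsLocalRing.maximalIdeal Λ := by
    rw [← map_natCast (algebraMap 𝔬 Λ)]
    exact fun h => h1 (IsLocalHom.map_nonunit _ h)
  obtain ⟨n, hn⟩ := IsArtinianRing.isNilpotent_jacobson_bot (R := Λ)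
  rw [IsLocalRing.jacobson_eq_maximalIdeal ⊥ bot_ne_top] at hn
  refine ⟨n, ?_⟩
  have h3 := Ideal.pow_mem_pow h2 n
  rwa [hn] at h3

end Char

/-! ### The adjunction and the theorem. -/

section Adjunction

variable {F : Type u} [Field F] [ValuativeRel F] [TopologicalSpace F]
  [IsNonarchimedeanLocalField F]
variable {Λ : Type v} [CommRing Λ] {e : ℕ} [NeZero e]

/-- The functor `𝓕 ↦ H_0(X, 𝓕)` is left adjoint to the functor `V ↦ 𝓕̂_V`. -/
def adjunctionH0Fhat {σ : Edge F} (xp : Vertex F)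
    (hH : ∀ S : C0.{u, v, w} F Λ e, isR0.{u, v, w} F Λ e σ ((H0functor.{u, v, w} F Λ e).obj S))
    (hF : ∀ V : R0.{u, v, w} F Λ e σ, isC0.{u, v, w} F Λ e ((Fhat.{u, v, w} F Λ e xp).obj V.obj)) :
    H0toR0.{u, v, w} hH ⊣ FhatToC0.{u, v, w} xp hF where
  unit :=
    { app := fun S => ObjectProperty.homMk (unitHom xp S.property)
      naturality := fun S T φ => by
        ext1
        apply GSystem.Hom.ext
        · funext x
          ext f
          exact Subtype.ext (H0map_toH0 φ.hom x f).symm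
        · funext η
          ext f
          apply Subtype.ext
          change edgeToH0 xp T.obj η (φ.hom.onE η f) = H0map φ.hom (edgeToH0 xp S.obj η f)
          obtain ⟨x, hx, -⟩ := exists_far (F := F) xp η
          rw [edgeToH0_apply xp hx, edgeToH0_apply xp hx, map_zsmul, H0map_toH0, φ.hom.comm_r] }
  counit :=
    { app := fun V => ObjectProperty.homMk (counitHom xp V.obj (hF V))
      naturality := fun V W φ => by
        ext1
        apply Rep.hom_ext
        apply Representation.IntertwiningMap.ext
        exact counitMap_naturality xp φ.hom ((Fhat.{u, v, w} F Λ e xp).map φ.hom) fun x f => rfl }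
  -- Both triangle identities are checked on vectors of the `𝓕(x)` and `𝓕(η)`, where the unit is a
  -- natural map and the counit an inclusion; on edges the signs cancel.
  left_triangle_components S := by
    ext1
    apply Rep.hom_ext
    apply Representation.IntertwiningMap.ext
    apply CoeffSystem.H0_hom_ext
    intro x f
    change counitMap xp (Rep.of (H0ρ S.property)) (H0map (unitHom xp S.property)
      (S.obj.toH0 x f)) = S.obj.toH0 x f
    rw [H0map_toH0]
    erw [counitMap_toH0]
    rfl
  right_triangle_components V := by
    ext1
    apply GSystem.Hom.ext
    · funext x
      ext f
      exact Subtype.ext (counitMap_toH0 xp V.obj x f)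
    · funext η
      ext f
      exact Subtype.ext (counitMap_edgeToH0 xp V.obj η f)

end Adjunction

end BruhatTits

end

open CategoryTheory BruhatTits in
theorem theorem3p4
    {F : Type u} [Field F] [ValuativeRel F] [TopologicalSpace F] [IsNonarchimedeanLocalField F]
    (p : ℕ) [CharP 𝓀[F] p]
    {𝔬 : Type*} [CommRing 𝔬] [IsDomain 𝔬] [IsDiscreteValuationRing 𝔬]
    [IsAdicComplete (IsLocalRing.maximalIdeal 𝔬) 𝔬] [CharP (IsLocalRing.ResidueField 𝔬) p]
    {Λ : Type v} [CommRing Λ] [IsLocalRing Λ] [IsArtinianRing Λ] [Algebra 𝔬 Λ]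
    [IsLocalHom (algebraMap 𝔬 Λ)]
    (hΛ : Function.Bijective (IsLocalRing.ResidueField.map (algebraMap 𝔬 Λ)))
    (e : ℕ) [NeZero e]
    (xp xm : Vertex F) (hσ : (tree F).Adj xp xm) :
    ∃ (hH : ∀ S : C0.{u, v, w} F Λ e,
        isR0.{u, v, w} F Λ e ⟨s(xp, xm), hσ⟩ ((H0functor.{u, v, w} F Λ e).obj S))
      (hF : ∀ V : R0.{u, v, w} F Λ e ⟨s(xp, xm), hσ⟩,
        isC0.{u, v, w} F Λ e ((Fhat.{u, v, w} F Λ e xp).obj V.obj))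
      (adj : H0toR0.{u, v, w} hH ⊣ FhatToC0.{u, v, w} xp hF),
      (∀ S : C0.{u, v, w} F Λ e, IsNaturalUnit.{u, v, w} xp S (adj.unit.app S).hom) ∧
      (∀ V : R0.{u, v, w} F Λ e ⟨s(xp, xm), hσ⟩,
        IsNaturalCounit.{u, v, w} xp V.obj (hF V) (adj.counit.app V).hom) ∧
      (∀ S : C0.{u, v, w} F Λ e, IsIso (adj.unit.app S)) ∧
      (∀ V : R0.{u, v, w} F Λ e ⟨s(xp, xm), hσ⟩, IsIso (adj.counit.app V)) ∧
      (H0toR0.{u, v, w} hH).IsEquivalence ∧ (FhatToC0.{u, v, w} xp hF).IsEquivalence := by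
  let σ : Edge F := ⟨s(xp, xm), hσ⟩
  have hp : Fact p.Prime := ⟨CharP.char_is_prime 𝓀[F] p⟩
  have hH : ∀ S : C0.{u, v, w} F Λ e,
      isR0.{u, v, w} F Λ e σ ((H0functor.{u, v, w} F Λ e).obj S) :=
    fun S => isR0_H0 S.property σ
  have hF : ∀ V : R0.{u, v, w} F Λ e σ,
      isC0.{u, v, w} F Λ e ((Fhat.{u, v, w} F Λ e xp).obj V.obj) :=
    fun V => isC0_Fhat xp V.obj
  let adj := adjunctionH0Fhat.{u, v, w} xp hH hF
  have hunit : ∀ S, IsIso (adj.unit.app S) := fun S =>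
    (ObjectProperty.isIso_hom_iff _).1 (GSystem.isIso_of_bijective (unitHom xp S.property)
      (unitHom_onV_bijective xp S.property) (unitHom_onE_bijective xp S.property))
  have hcounit : ∀ V, IsIso (adj.counit.app V) := fun V =>
    (ObjectProperty.isIso_hom_iff _).1 (isIso_of_bijective_hom (counitHom xp V.obj (hF V))
      ⟨counitMap_injective p (exists_natCast_pow_eq_zero p 𝔬 Λ) xp (σ := σ)
        (Sym2.mem_mk_left xp xm) V.obj, counitMap_surjective xp V.obj V.property⟩)
  exact ⟨hH, hF, adj, fun S => isNaturalUnit_unitHom xp S,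
    fun V => isNaturalCounit_counitHom xp V.obj (hF V), hunit, hcounit,
    adj.toEquivalence.isEquivalence_functor, adj.toEquivalence.isEquivalence_inverse⟩
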